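/- **Definitions.** A *Boolean relation* of arity $r$ is a set $R\subseteq\{0,1\}^r$. It is *affine* if it is the set of solutions of a system of equations $\bigoplus_{i\in I}x_i=c$ over $\mathrm{GF}_2$ (with $I\subseteq\{1,\dots,r\}$, $c\in\{0,1\}$). $\text{IM-conj}$ is the class of Boolean relations defined by a conjunction of pins $x_i=c$ ($c\in\{0,1\}$) and binary implications $x_i\rightarrow x_j$. Let $\Gamma_{\mathrm{pin}}=\{\{0\},\{1\}\}$ be the set of the two unary constant relations. A *constraint language* is a finite set $\Gamma$ of Boolean relations. An *instance* of CSP over $\Gamma$ is a finite set $V$ of variables together with a set $C$ of constraints $R(v_1,\dots,v_r)$, where $R\in\Gamma$ has arity $r$ and $(v_1,\dots,v_r)\in V^r$ (repetitions allowed). An assignment $\sigma\colon V\to\{0,1\}$ is satisfying if $(\sigma(v_1),\dots,\sigma(v_r))\in R$ for each constraint $R(v_1,\dots,v_r)\in C$. The degree of the instance is the greatest number of times any variable appears among its constraints (a variable appearing several times in a scope is counted with multiplicity). $\#\mathrm{CSP}_d(\Gamma)$ is the problem of computing the number of satisfying assignments of a given instance over $\Gamma$ of degree at most $d$. $\#\mathrm{BIS}$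 is the problem of computing the number of independent sets of a given bipartite graph (given with its bipartition). A *randomized approximation scheme* (RAS) for a counting problem $f$ takes an instance $x$ and a rational $\varepsilon\in(0,1)$ and produces a random natural number $Y$ with $\Pr\bigl(e^{-\varepsilon}f(x)\le Y\le e^{\varepsilon}f(x)\bigr)\ge\frac34$. An *approximation-preserving (AP) reduction* from $f$ to $g$ is a probabilistic oracle Turing machine $M$ that takes inputs $(x,\varepsilon)$, with $x$ an instance of $f$ and $\varepsilon\in(0,1)$ rational, such that (i) every oracle call made by $M$ is of the form $(w,\delta)$, where $w$ is an instance of $g$ and $0<\delta<1$ satisfies $\delta^{-1}\le\mathrm{poly}(|x|,\varepsilon^{-1})$; (ii) $M$ is a RAS for $f$ whenever the oracle is a RAS for $g$ (whose answers to different calls are independent); (iii) the run-time of $M$ is polynomial in the size of its input (of $x$ and of the numeral of $\varepsilon$) and in $\varepsilon^{-1}$. Problems $f$ and $g$ are *AP-interreducible*, $f\equiv_{\mathrm{AP}}g$, if there are AP-reductions from $f$ to $g$ and from $g$ to $f$. **Proposition.** Let $\Gamma\subseteq\text{IM-conj}$ be a constraint language that contains at least one relation that is not affine. Then, for every integer $d\ge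 3$, $$\#\mathrm{CSP}_d(\Gamma\cup\Gamma_{\mathrm{pin}})\equiv_{\mathrm{AP}}\#\mathrm{BIS}.$$ -/

import Mathlib

/-! ### Counting problems -/

/-- A counting problem `f : Σ* → ℕ` with `Σ = {0,1}`, defined on the strings that encode instances. -/
structure CountingProblem where
  Inst : Type
  encode : Inst → List Bool
  encode_injective : Function.Injective encode
  count : Inst → ℕ

/-- The restriction of a counting problem to the instances that satisfy `p`. -/
def CountingProblem.restrict (f : CountingProblem) (p : f.Inst → Prop) : CountingProblem where
  Inst := {I : f.Inst // p I}
  encode I := f.encode I.1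
  encode_injective _ _ h := Subtype.ext (f.encode_injective h)
  count I := f.count I.1

/-! ### Probabilistic oracle Turing machines

As in Mathlib's model of polynomial time (`Turing.FinTM2`), the storage of a machine consists of
finitely many stacks (a two-way tape is a pair of stacks); the head of the list is the top. -/

/-- The stacks of a machine. The input `(x, ε)` is on `input, epsNum, epsDen`. The oracle query
`(w, δ)` is read from `query, deltaNum, deltaDen`. The oracle's answer is written on `value`, which
is also the output stack. All the other stacks are work stacks. -/
inductive Tape (Work : Type) : Type
  | input
  | epsNum
  | epsDen
  | query
  | deltaNum
  | deltaDen
  | value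
  | work (i : Work)
deriving DecidableEq

/-- The instruction attached to a control state; each takes one step. -/
inductive Instr (State Work : Type) : Type
  /-- push a symbol and go to the given state -/
  | push (k : Tape Work) (b : Bool) (q : State)
  /-- pop a symbol (`none` if the stack is empty) and branch on it -/
  | pop (k : Tape Work) (q : Option Bool → State)
  /-- toss a fair coin and branch on it -/
  | flip (q : Bool → State)
  /-- call the oracle -/
  | call (q : State)
  | halt

structure OracleMachine where
  State : Type
  Work : Type
  [finiteState : Finite State]
  [finiteWork : Finite Work]
  [decEqWork : DecidableEq Work]
  start : State
  prog : State → Instr State Work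

attribute [instance] OracleMachine.finiteState OracleMachine.finiteWork OracleMachine.decEqWork

/-- The number with the given binary digits, least significant digit first. -/
def natOfBits : List Bool → ℕ
  | [] => 0
  | b :: l => b.toNat + 2 * natOfBits l

/-- A randomized procedure that gets a string and an error bound and produces a number. Used as an
oracle, it answers each call with a fresh independent sample. -/
abbrev RandomProc := List Bool → ℚ → PMF ℕ

namespace OracleMachine

variable (M : OracleMachine)

structure Cfg where
  state : M.State
  stk : Tape M.Work → List Bool

variable {M}

/-- The string part `w` of the oracle query that is currently written. -/
def Cfg.queryString (c : M.Cfg) : List Bool := c.stk .query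

/-- The error bound `δ` of the oracle query that is currently written. -/
def Cfg.queryDelta (c : M.Cfg) : ℚ :=
  (natOfBits (c.stk .deltaNum) : ℚ) / (natOfBits (c.stk .deltaDen) : ℚ)

/-- The number on the output stack. -/
def Cfg.output (c : M.Cfg) : ℕ := natOfBits (c.stk .value)

def Cfg.Halted (c : M.Cfg) : Prop := M.prog c.state = .halt

/-- The machine is about to call the oracle. -/
def Cfg.Calls (c : M.Cfg) : Prop := ∃ q, M.prog c.state = .call q

variable (M)

/-- One step of computation with oracle `O`; a halted configuration stays as it is. -/
noncomputable def step (O : RandomProc) (c : M.Cfg) : PMF M.Cfg :=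
  match M.prog c.state with
  | .push k b q => PMF.pure ⟨q, Function.update c.stk k (b :: c.stk k)⟩
  | .pop k q => PMF.pure ⟨q (c.stk k).head?, Function.update c.stk k (c.stk k).tail⟩
  | .flip q => (PMF.uniformOfFintype Bool).map fun b => ⟨q b, c.stk⟩
  | .call q => (O c.queryString c.queryDelta).map fun Y =>
      ⟨q, Function.update c.stk .value (Nat.bits Y)⟩
  | .halt => PMF.pure c

/-- The initial configuration on input `(x, ε)`; the numerator and denominator of `ε` are written
in binary. -/
def init (x : List Bool) (ε : ℚ) : M.Cfg where
  state := M.start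
  stk
    | .input => x
    | .epsNum => Nat.bits ε.num.toNat
    | .epsDen => Nat.bits ε.den
    | _ => []

/-- The distribution of the configuration after `t` steps on input `(x, ε)`. -/
noncomputable def run (O : RandomProc) (x : List Bool) (ε : ℚ) : ℕ → PMF M.Cfg
  | 0 => PMF.pure (M.init x ε)
  | t + 1 => (run O x ε t).bind (M.step O)

/-- The distribution of the number on the output stack after `t` steps on input `(x, ε)`. -/
noncomputable def outputAt (O : RandomProc) (x : List Bool) (ε : ℚ) (t : ℕ) : PMF ℕ :=
  (M.run O x ε t).map Cfg.output

end OracleMachine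

/-! ### Approximation schemes and approximation-preserving reductions -/

/-- `A` is a randomized approximation scheme for `f`. The condition on `Y` is
`e^{-ε} ≤ Y / f(x) ≤ e^ε`, which is read as `Y = 0` if `f(x) = 0`. -/
def IsRAS (f : CountingProblem) (A : RandomProc) : Prop :=
  ∀ (I : f.Inst) (ε : ℚ), 0 < ε → ε < 1 →
    3 / 4 ≤ (A (f.encode I) ε).toOuterMeasure
      {Y : ℕ | Real.exp (-(ε : ℝ)) * (f.count I : ℝ) ≤ (Y : ℝ) ∧
        (Y : ℝ) ≤ Real.exp (ε : ℝ) * (f.count I : ℝ)}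

/-- `M` is an approximation-preserving reduction from `f` to `g`, with time bound given by the
polynomial `P` and with bound on the error parameters of the oracle calls given by `D`. -/
structure IsAPReduction (M : OracleMachine) (f g : CountingProblem) (P D : Polynomial ℕ) :
    Prop where
  /-- Every oracle call that can occur is `(w, δ)` with `w` an instance of `g`, `0 < δ < 1` and
  `δ⁻¹ ≤ poly(|x|, ε⁻¹)`. -/
  calls : ∀ (O : RandomProc) (I : f.Inst) (ε : ℚ), 0 < ε → ε < 1 →
    ∀ (t : ℕ), ∀ c ∈ (M.run O (f.encode I) ε t).support, c.Calls →
      (∃ J : g.Inst, c.queryString = g.encode J) ∧ 0 < c.queryDelta ∧ c.queryDelta < 1 ∧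
        (c.queryDelta)⁻¹ ≤ ((D.eval ((f.encode I).length + ⌈ε⁻¹⌉₊) : ℕ) : ℚ)
  /-- On every computation path, whatever the oracle answers, the machine halts in time polynomial
  in the size of the input (the string `x` and the numeral of `ε`) and `ε⁻¹`. -/
  time : ∀ (O : RandomProc) (I : f.Inst) (ε : ℚ), 0 < ε → ε < 1 →
    ∀ c ∈ (M.run O (f.encode I) ε
      (P.eval ((f.encode I).length + Nat.size ε.den + ⌈ε⁻¹⌉₊))).support, c.Halted
  /-- The machine is a randomized approximation scheme for `f` whenever the oracle is a randomized
  approximation scheme for `g`. -/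
  ras : ∀ O : RandomProc, IsRAS g O →
    IsRAS f fun x ε => M.outputAt O x ε (P.eval (x.length + Nat.size ε.den + ⌈ε⁻¹⌉₊))

def APReducible (f g : CountingProblem) : Prop :=
  ∃ (M : OracleMachine) (P D : Polynomial ℕ), IsAPReduction M f g P D

def APInterreducible (f g : CountingProblem) : Prop := APReducible f g ∧ APReducible g f

infix:50 " ≤AP " => APReducible
infix:50 " ≡AP " => APInterreducible

/-! ### Encoding of numbers -/

/-- The self-delimiting unary numeral `1ⁿ0`. -/
def unary (n : ℕ) : List Bool := List.replicate n true ++ [false]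

theorem unary_append_inj {a b : ℕ} {s t : List Bool} (h : unary a ++ s = unary b ++ t) :
    a = b ∧ s = t := by
  induction a generalizing b with
  | zero => cases b with
    | zero => simpa [unary] using h
    | succ b => simp [unary, List.replicate_succ] at h
  | succ a ih => cases b with
    | zero => simp [unary, List.replicate_succ] at h
    | succ b =>
      have := @ih b (by simpa [unary, List.replicate_succ] using h)
      exact ⟨by rw [this.1], this.2⟩

theorem flatMap_code_inj {α : Type*} (e : α → List Bool) (hne : ∀ a, e a ≠ [])
    (he : ∀ a b s t, e a ++ s = e b ++ t → a = b ∧ s = t) :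
    Function.Injective fun l : List α => l.flatMap e := by
  intro l
  induction l with
  | nil =>
    intro l' h
    cases l' with
    | nil => rfl
    | cons b l' => simp [hne b] at h
  | cons a l ih =>
    intro l' h
    cases l' with
    | nil => simp [hne a] at h
    | cons b l' =>
      simp only [List.flatMap_cons] at h
      obtain ⟨h1, h2⟩ := he _ _ _ _ h
      rw [h1, ih h2]

theorem ofFn_code_inj {r n : ℕ} {u v : Fin r → Fin n} {s t : List Bool}
    (h : (List.ofFn u).flatMap (fun i : Fin n => unary i) ++ s =
      (List.ofFn v).flatMap (fun i : Fin n => unary i) ++ t) : u = v ∧ s = t := by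
  induction r with
  | zero => exact ⟨Subsingleton.elim _ _, by simpa using h⟩
  | succ r ih =>
    simp only [List.ofFn_succ, List.flatMap_cons, List.append_assoc] at h
    obtain ⟨h1, h2⟩ := unary_append_inj h
    obtain ⟨h3, h4⟩ := ih h2
    refine ⟨?_, h4⟩
    funext i
    refine Fin.cases (Fin.ext h1) (fun j => congrFun h3 j) i

/-! ### Boolean relations -/

/-- A Boolean relation: an arity `r` and a subset of `{0,1}^r`. -/
abbrev BoolRel := Σ r : ℕ, Finset (Fin r → Bool)

/-- `R` is the solution set of a system of equations `⨁_{i ∈ I} x_i = c` over `GF(2)`. -/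
def IsAffine (R : BoolRel) : Prop :=
  ∃ E : Set (Finset (Fin R.1) × ZMod 2), ∀ a : Fin R.1 → Bool,
    a ∈ R.2 ↔ ∀ e ∈ E, ∑ i ∈ e.1, (if a i then 1 else 0 : ZMod 2) = e.2

/-- A pin `x_i = c` or an implication `x_i → x_j`. -/
inductive IMClause (r : ℕ) : Type
  | pin (i : Fin r) (c : Bool)
  | imp (i j : Fin r)

def IMClause.Holds {r : ℕ} (a : Fin r → Bool) : IMClause r → Prop
  | .pin i c => a i = c
  | .imp i j => a i = true → a j = true

/-- The relations that are defined by a conjunction of pins and implications. -/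
def IMConj : Set BoolRel :=
  {R | ∃ φ : List (IMClause R.1), ∀ a : Fin R.1 → Bool, a ∈ R.2 ↔ ∀ κ ∈ φ, κ.Holds a}

def Rzero : BoolRel := ⟨1, {fun _ => false}⟩

def Rone : BoolRel := ⟨1, {fun _ => true}⟩

def pinLanguage : Finset BoolRel := {Rzero, Rone}

/-! ### Counting constraint satisfaction problems -/

/-- A constraint `R(v₁, …, v_r)` with `R ∈ Γ` over the variables `0, …, n - 1`. -/
abbrev Constraint (Γ : Finset BoolRel) (n : ℕ) := Σ R : Γ, (Fin R.1.1 → Fin n)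

/-- The name of the relation (its number in a fixed enumeration of `Γ`), then the scope. -/
noncomputable def Constraint.encode {Γ : Finset BoolRel} {n : ℕ} (c : Constraint Γ n) :
    List Bool :=
  unary (Γ.equivFin c.1) ++ (List.ofFn c.2).flatMap fun v : Fin n => unary v

theorem Constraint.encode_append_inj {Γ : Finset BoolRel} {n : ℕ} (c c' : Constraint Γ n)
    (s t : List Bool) (h : c.encode ++ s = c'.encode ++ t) : c = c' ∧ s = t := by
  obtain ⟨R, u⟩ := c
  obtain ⟨R', u'⟩ := c'
  simp only [Constraint.encode, List.append_assoc] at h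
  obtain ⟨h1, h2⟩ := unary_append_inj h
  have h3 : R = R' := Γ.equivFin.injective (Fin.ext h1)
  subst h3
  obtain ⟨h4, h5⟩ := ofFn_code_inj h2
  exact ⟨by rw [h4], h5⟩

/-- An instance of CSP over `Γ`: `n` variables and a set of constraints, listed without
repetition. -/
structure CSPInstance (Γ : Finset BoolRel) where
  n : ℕ
  cons : List (Constraint Γ n)
  nodup : cons.Nodup

namespace CSPInstance

variable {Γ : Finset BoolRel}

def Satisfies (I : CSPInstance Γ) (σ : Fin I.n → Bool) : Prop :=
  ∀ c ∈ I.cons, (fun i => σ (c.2 i)) ∈ c.1.1.2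

/-- The number `Z(I)` of satisfying assignments. -/
noncomputable def Z (I : CSPInstance Γ) : ℕ := Set.ncard {σ | I.Satisfies σ}

/-- The number of times that `v` appears among the constraints, with its multiplicity in each
scope. -/
def occurrences (I : CSPInstance Γ) (v : Fin I.n) : ℕ :=
  (I.cons.map fun c => (Finset.univ.filter fun i => c.2 i = v).card).sum

def degree (I : CSPInstance Γ) : ℕ := Finset.univ.sup I.occurrences

noncomputable def encode (I : CSPInstance Γ) : List Bool :=
  unary I.n ++ I.cons.flatMap Constraint.encode

theorem encode_injective : Function.Injective (encode (Γ := Γ)) := by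
  rintro ⟨n, l, hl⟩ ⟨n', l', hl'⟩ h
  obtain ⟨h1, h2⟩ := unary_append_inj h
  dsimp only at h1
  subst h1
  have h3 : l = l' := flatMap_code_inj Constraint.encode
    (fun c => by simp [Constraint.encode, unary]) Constraint.encode_append_inj h2
  subst h3
  rfl

end CSPInstance

/-- `#CSP(Γ)` -/
noncomputable def numCSP (Γ : Finset BoolRel) : CountingProblem where
  Inst := CSPInstance Γ
  encode := CSPInstance.encode
  encode_injective := CSPInstance.encode_injective
  count := CSPInstance.Z

/-- `#CSP_d(Γ)` -/
noncomputable def numCSPd (d : ℕ) (Γ : Finset BoolRel) : CountingProblem :=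
  (numCSP Γ).restrict fun I : CSPInstance Γ => I.degree ≤ d

/-! ### Counting independent sets in bipartite graphs -/

/-- A bipartite graph `(U, V, E)` with `|U| = m` and `|V| = n`, given by a list of its edges
(the edge set is the set of entries of the list). -/
structure BipartiteGraph where
  m : ℕ
  n : ℕ
  edges : List (Fin m × Fin n)

namespace BipartiteGraph

def graph (B : BipartiteGraph) : SimpleGraph (Fin B.m ⊕ Fin B.n) :=
  SimpleGraph.fromRel fun a b => ∃ e ∈ B.edges, a = Sum.inl e.1 ∧ b = Sum.inr e.2

noncomputable def numIndepSets (B : BipartiteGraph) : ℕ :=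
  Set.ncard {S : Set (Fin B.m ⊕ Fin B.n) | B.graph.IsIndepSet S}

def encode (B : BipartiteGraph) : List Bool :=
  unary B.m ++ (unary B.n ++ B.edges.flatMap fun e => unary e.1 ++ unary e.2)

theorem encode_injective : Function.Injective encode := by
  rintro ⟨m, n, l⟩ ⟨m', n', l'⟩ h
  obtain ⟨h1, h2⟩ := unary_append_inj h
  obtain ⟨h3, h4⟩ := unary_append_inj h2
  dsimp only at h1 h3
  subst h1 h3
  have h5 : l = l' := by
    refine flatMap_code_inj (fun e : Fin m × Fin n => unary e.1 ++ unary e.2)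
      (fun e => by simp [unary]) ?_ h4
    rintro ⟨a, b⟩ ⟨a', b'⟩ s t h
    simp only [List.append_assoc] at h
    obtain ⟨h6, h7⟩ := unary_append_inj h
    obtain ⟨h8, h9⟩ := unary_append_inj h7
    exact ⟨Prod.ext (Fin.ext h6) (Fin.ext h8), h9⟩
  rw [h5]

end BipartiteGraph

/-- `#BIS` -/
noncomputable def numBIS : CountingProblem where
  Inst := BipartiteGraph
  encode := BipartiteGraph.encode
  encode_injective := BipartiteGraph.encode_injective
  count := BipartiteGraph.numIndepSets

/-! Both reductions are deterministic transformations around a single oracle call.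
`apReducible_of_frag` turns such a transformation, given as a stack program with a polynomial time
bound, into an AP-reduction; the oracle's error parameter is `ε / 2 ^ j`, and some low binary digits
of its answer are dropped.

Reduction to #BIS. With the constants true and false added, every pin is an implication (true → x or
x → false). An instance with n variables becomes a bipartite graph with n + 1 blocks of k vertices
on either side: a left and a right block for each variable, the last left block for true and the
last right block for false. The two blocks of a variable are joined completely, and an implication x
→ y joins the left block of x to the right block of y. If an independent set meets exactly the left
blocks in A and the right blocks in B, then (A, B) contains no joined pair, and each such (A, B)
arises from (2^k - 1)^(|A| + |B|) choices. Always |A| + |B| ≤ n + 2, with equality exactly when (A,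
B) comes from an assignment (left block used for true, right block for false), and (A, B) is then
allowed iff the assignment is satisfying (`card_le_of_allowed`, `allowed_blocksOf_iff`). So for k ≥
4(n + 1) the count is close to Z · 2^(k(n+2)), where Z is the number of satisfying assignments. An
approximation of Z must be exactly 0 when Z = 0, and it must be an integer. Therefore one more left
block, joined to the whole right side, and one right vertex, joined to this block only, are added.
They bring the total within 2^N / 4 of (Z + 1/2) · 2^N with N = k(n+2) + 1 (`numIndepSets_bounds`),
and rounding down after division by 2^N is safe (`approx_of_div_pow`). The degree bound plays no
role here.

Reduction from #BIS. Let true mean "chosen" on the left and "not chosen" on the right: independent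
sets are the solutions of the implications u → v over the edges. Replacing each vertex by a directed
cycle of copies, with a separate copy for each edge, leaves at most three occurrences per variable
(`sum_imp_le`, `ncard_imp`). It remains to express one implication by a non-affine R in IM-conj and
pins. R is closed under ∧ and ∨, and non-affinity yields a chain a ≤ b ≤ c in R with a ⊕ b ⊕ c
outside R (`exists_isBadChain`). If the distance from a to c is minimal, then the interval [a, c]
meets R only in a, b, c (`exists_chain_eq_interval`). Pinning the coordinates where a and c agree
leaves these three tuples, which on suitable coordinates p, q read 00, 01, 11: the relation p → q,
with every other coordinate determined (`exists_isImpGadget`). This reduction preserves the count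
exactly. -/

/-! ### Call-free machine fragments -/

abbrev Stacks (W : Type) := Tape W → List Bool

/-- An instruction of a deterministic fragment. -/
inductive FragInstr (S W : Type) : Type
  | push (k : Tape W) (b : Bool) (q : S)
  | pop (k : Tape W) (q : Option Bool → S)

namespace FragInstr

def map {S S' W : Type} (f : S → S') : FragInstr S W → FragInstr S' W
  | .push k b q => .push k b (f q)
  | .pop k q => .pop k fun b => f (q b)

/-- The effect of one instruction on the stacks. -/
def exec {S W : Type} [DecidableEq W] (s : Stacks W) : FragInstr S W → S × Stacks W
  | .push k b q => (q, Function.update s k (b :: s k))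
  | .pop k q => (q (s k).head?, Function.update s k (s k).tail)

theorem exec_map {S S' W : Type} [DecidableEq W] (f : S → S') (s : Stacks W)
    (a : FragInstr S W) : (a.map f).exec s = (f (a.exec s).1, (a.exec s).2) := by
  cases a <;> rfl

def toInstr {S S' W : Type} (f : S → S') : FragInstr S W → Instr S' W
  | .push k b q => .push k b (f q)
  | .pop k q => .pop k fun b => f (q b)

end FragInstr

/-- A deterministic, oracle-free piece of a machine; the exit is represented by `none`. -/
structure Frag (W : Type) where
  S : Type
  [fin : Finite S]
  entry : Option S
  prog : S → FragInstr (Option S) W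

attribute [instance] Frag.fin

namespace Frag

variable {W : Type} [DecidableEq W]

/-- `F.Reach n o s o' s'`: in exactly `n` steps, `F` gets from state `o` and stacks `s` to
state `o'` and stacks `s'`, where `none` is the exit. -/
inductive Reach (F : Frag W) : ℕ → Option F.S → Stacks W → Option F.S → Stacks W → Prop
  | refl (o s) : Reach F 0 o s o s
  | head {n q s o₁ s₁} :
      Reach F n ((F.prog q).exec s).1 ((F.prog q).exec s).2 o₁ s₁ → Reach F (n + 1) (some q) s o₁ s₁

/-- Started on `s`, the fragment exits with `s'` after at most `t` steps. -/
def Runs (F : Frag W) (s s' : Stacks W) (t : ℕ) : Prop :=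
  ∃ n ≤ t, F.Reach n F.entry s none s'

theorem Runs.mono {F : Frag W} {s s' : Stacks W} {t t' : ℕ} (h : F.Runs s s' t) (ht : t ≤ t') :
    F.Runs s s' t' := by
  obtain ⟨n, hn, h⟩ := h
  exact ⟨n, hn.trans ht, h⟩

theorem Reach.trans {F : Frag W} {n n' : ℕ} {o o' o'' : Option F.S} {s s' s'' : Stacks W}
    (h : F.Reach n o s o' s') (h₁ : F.Reach n' o' s' o'' s'') :
    F.Reach (n + n') o s o'' s'' := by
  induction h with
  | refl => simpa using h₁
  | head _ ih => rw [Nat.add_right_comm]; exact .head (ih h₁)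

/-- Where the states of an embedded fragment go; the exit goes to `x`. -/
def into {S S' : Type} (x : Option S') (e : S → S') (o : Option S) : Option S' :=
  o.elim x fun q => some (e q)

/-- A fragment embedded in a larger one makes the same steps in the same number; only its exit is
redirected. The rules for sequencing and for loops all come from this simulation. -/
theorem Reach.lift {F G : Frag W} (e : F.S → G.S) (x : Option G.S)
    (h : ∀ q, G.prog (e q) = (F.prog q).map (into x e)) {n : ℕ} {o o' : Option F.S}
    {s s' : Stacks W} (hr : F.Reach n o s o' s') :
    G.Reach n (into x e o) s (into x e o') s' := by
  induction hr with
  | refl => exact .refl _ _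
  | head _ ih =>
    refine .head ?_
    rw [h, FragInstr.exec_map]
    exact ih

def skip : Frag W where
  S := Empty
  entry := none
  prog := Empty.elim

theorem runs_skip (s : Stacks W) : (skip : Frag W).Runs s s 0 := ⟨0, le_rfl, .refl _ _⟩

def push (k : Tape W) (b : Bool) : Frag W where
  S := Unit
  entry := some ()
  prog _ := .push k b none

theorem runs_push (k : Tape W) (b : Bool) (s : Stacks W) :
    (push k b).Runs s (Function.update s k (b :: s k)) 1 :=
  ⟨1, le_rfl, .head (.refl _ _)⟩

/-- Leaving `F` costs no step: its exit is identified with the entry of `G`, which may itself be the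
exit. Hence running times simply add up. -/
def seq (F G : Frag W) : Frag W where
  S := F.S ⊕ G.S
  entry := into (into none Sum.inr G.entry) Sum.inl F.entry
  prog
    | .inl q => (F.prog q).map (into (into none Sum.inr G.entry) Sum.inl)
    | .inr q => (G.prog q).map (into none Sum.inr)

theorem Runs.seq {F G : Frag W} {s s' s'' : Stacks W} {t t' : ℕ} (h : F.Runs s s' t)
    (h' : G.Runs s' s'' t') : (F.seq G).Runs s s'' (t + t') := by
  obtain ⟨n, hn, h⟩ := h
  obtain ⟨n', hn', h'⟩ := h'
  refine ⟨n + n', by omega, ?_⟩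
  have h1 := h.lift (G := F.seq G) Sum.inl (into none Sum.inr G.entry) fun _ => rfl
  have h2 := h'.lift (G := F.seq G) Sum.inr none fun _ => rfl
  exact h1.trans h2

/-- Pop a symbol from `k` and run `body` on it; then start again or exit, as `again` says. -/
def pop (k : Tape W) (again : Option Bool → Bool) (body : Option Bool → Frag W) : Frag W where
  S := Option (Σ b, (body b).S)
  entry := some none
  prog
    | none => .pop k fun b =>
        into (if again b then some none else none) (fun q => some ⟨b, q⟩) (body b).entry
    | some ⟨b, q⟩ => ((body b).prog q).map
        (into (if again b then some none else none) fun q => some ⟨b, q⟩)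

theorem reach_pop {k : Tape W} {again : Option Bool → Bool} {body : Option Bool → Frag W}
    {s s' : Stacks W} {n : ℕ}
    (h : (body (s k).head?).Reach n (body (s k).head?).entry (Function.update s k (s k).tail)
      none s') :
    (pop k again body).Reach (n + 1) (some none) s
      (if again (s k).head? then some none else none) s' := by
  have h1 := h.lift (G := pop k again body) (fun q => some ⟨(s k).head?, q⟩)
    (if again (s k).head? then some none else none) fun _ => rfl
  exact .head h1

theorem Runs.pop_exit {k : Tape W} {again : Option Bool → Bool} {body : Option Bool → Frag W}
    {s s' : Stacks W} {t : ℕ} (b : Option Bool) (hb : (s k).head? = b) (ha : again b = false)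
    (h : (body b).Runs (Function.update s k (s k).tail) s' t) :
    (pop k again body).Runs s s' (t + 1) := by
  subst hb
  obtain ⟨n, hn, h⟩ := h
  have := reach_pop (again := again) h
  rw [ha] at this
  exact ⟨n + 1, by omega, this⟩

theorem Runs.pop_again {k : Tape W} {again : Option Bool → Bool} {body : Option Bool → Frag W}
    {s s' s'' : Stacks W} {t t' : ℕ} (b : Option Bool) (hb : (s k).head? = b)
    (ha : again b = true) (h : (body b).Runs (Function.update s k (s k).tail) s' t)
    (h' : (pop k again body).Runs s' s'' t') :
    (pop k again body).Runs s s'' (t + t' + 1) := by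
  subst hb
  obtain ⟨n, hn, h⟩ := h
  obtain ⟨n', hn', h'⟩ := h'
  have := reach_pop (again := again) h
  rw [ha] at this
  exact ⟨n + 1 + n', by omega, this.trans h'⟩

end Frag

/-! ### The machine that runs a fragment, calls the oracle once and runs another fragment -/

namespace OracleMachine

/-- Run `F`, call the oracle, run `G` and halt. -/
abbrev ofFrags {W : Type} [Finite W] [DecidableEq W] (F G : Frag W) : OracleMachine where
  State := (F.S ⊕ G.S) ⊕ Bool
  Work := W
  start := F.entry.elim (.inr false) fun q => .inl (.inl q)
  prog
    | .inl (.inl q) => (F.prog q).toInstr fun o => o.elim (.inr false) fun q => .inl (.inl q)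
    | .inl (.inr q) => (G.prog q).toInstr fun o => o.elim (.inr true) fun q => .inl (.inr q)
    | .inr false => .call (G.entry.elim (.inr true) fun q => .inl (.inr q))
    | .inr true => .halt

/-- The distribution of the configuration after `n` more steps. -/
noncomputable def stepN (M : OracleMachine) (O : RandomProc) : ℕ → M.Cfg → PMF M.Cfg
  | 0, c => PMF.pure c
  | n + 1, c => (M.step O c).bind (stepN M O n)

theorem stepN_add (M : OracleMachine) (O : RandomProc) (a b : ℕ) (c : M.Cfg) :
    M.stepN O (a + b) c = (M.stepN O a c).bind (M.stepN O b) := by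
  induction a generalizing c with
  | zero => simp [stepN]
  | succ a ih =>
    rw [Nat.add_right_comm]
    simp only [stepN, PMF.bind_bind]
    congr 1
    funext c'
    exact ih c'

/-- `run` adds steps at the end, whereas `Reach` unfolds at the beginning; `stepN` has the direction
that suits inductions on `Reach`. -/
theorem run_eq_stepN (M : OracleMachine) (O : RandomProc) (x : List Bool) (ε : ℚ) (t : ℕ) :
    M.run O x ε t = M.stepN O t (M.init x ε) := by
  induction t with
  | zero => rfl
  | succ t ih =>
    rw [stepN_add, ← ih]
    simp only [run]
    congr 1
    funext c
    simp [stepN]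

theorem step_of_prog {M : OracleMachine} (O : RandomProc) {S : Type} {a : FragInstr S M.Work}
    (f : S → M.State) {q : M.State} {s : Stacks M.Work} (h : M.prog q = a.toInstr f) :
    M.step O ⟨q, s⟩ = PMF.pure ⟨f (a.exec s).1, (a.exec s).2⟩ := by
  unfold step
  simp only [h]
  cases a <;> rfl

section ofFrags

variable {W : Type} [Finite W] [DecidableEq W] (F G : Frag W)

/-- The state of `ofFrags F G` that corresponds to a state of `F`. -/
def preState (o : Option F.S) : (ofFrags F G).State :=
  o.elim (.inr false) fun q => .inl (.inl q)

/-- The state of `ofFrags F G` that corresponds to a state of `G`. -/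
def postState (o : Option G.S) : (ofFrags F G).State :=
  o.elim (.inr true) fun q => .inl (.inr q)

variable {F G}

theorem step_pre (O : RandomProc) (q : F.S) (s : Stacks W) :
    (ofFrags F G).step O ⟨preState F G (some q), s⟩ =
      PMF.pure ⟨preState F G ((F.prog q).exec s).1, ((F.prog q).exec s).2⟩ :=
  step_of_prog O (a := F.prog q) (preState F G) rfl

theorem step_post (O : RandomProc) (q : G.S) (s : Stacks W) :
    (ofFrags F G).step O ⟨postState F G (some q), s⟩ =
      PMF.pure ⟨postState F G ((G.prog q).exec s).1, ((G.prog q).exec s).2⟩ :=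
  step_of_prog O (a := G.prog q) (postState F G) rfl

theorem step_halt (O : RandomProc) (s : Stacks W) :
    (ofFrags F G).step O ⟨postState F G none, s⟩ = PMF.pure ⟨postState F G none, s⟩ := rfl

theorem step_call (O : RandomProc) (s : Stacks W) :
    (ofFrags F G).step O ⟨preState F G none, s⟩ =
      (O (s .query) ((natOfBits (s .deltaNum) : ℚ) / (natOfBits (s .deltaDen) : ℚ))).map
        fun Y => ⟨postState F G G.entry, Function.update s .value (Nat.bits Y)⟩ := rfl

theorem stepN_pre (O : RandomProc) {n : ℕ} {o o' : Option F.S} {s s' : Stacks W}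
    (h : F.Reach n o s o' s') :
    (ofFrags F G).stepN O n ⟨preState F G o, s⟩ = PMF.pure ⟨preState F G o', s'⟩ := by
  induction h with
  | refl => rfl
  | head _ ih => simp only [stepN]; rw [step_pre, PMF.pure_bind]; exact ih

theorem stepN_post (O : RandomProc) {n : ℕ} {o o' : Option G.S} {s s' : Stacks W}
    (h : G.Reach n o s o' s') :
    (ofFrags F G).stepN O n ⟨postState F G o, s⟩ = PMF.pure ⟨postState F G o', s'⟩ := by
  induction h with
  | refl => rfl
  | head _ ih => simp only [stepN]; rw [step_post, PMF.pure_bind]; exact ih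

theorem stepN_halt (O : RandomProc) (n : ℕ) (s : Stacks W) :
    (ofFrags F G).stepN O n ⟨postState F G none, s⟩ = PMF.pure ⟨postState F G none, s⟩ := by
  induction n with
  | zero => rfl
  | succ n ih => simp only [stepN]; rw [step_halt, PMF.pure_bind]; exact ih

/-- The final distribution: the oracle is called on what `F` has written, and `G` processes the
answer. -/
theorem run_ofFrags (O : RandomProc) (x : List Bool) (ε : ℚ) {s : Stacks W}
    {s' : ℕ → Stacks W} {t t' T : ℕ}
    (hF : F.Runs ((ofFrags F G).init x ε).stk s t)
    (hG : ∀ Y, G.Runs (Function.update s .value (Nat.bits Y)) (s' Y) t') (hT : t + t' + 1 ≤ T) :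
    (ofFrags F G).run O x ε T =
      (O (s .query) ((natOfBits (s .deltaNum) : ℚ) / (natOfBits (s .deltaDen) : ℚ))).map
        fun Y => ⟨postState F G none, s' Y⟩ := by
  obtain ⟨n, hn, hF⟩ := hF
  obtain ⟨m, rfl⟩ : ∃ m, T = n + (m + 1) := ⟨T - n - 1, by omega⟩
  rw [run_eq_stepN, stepN_add]
  have h1 := stepN_pre (G := G) O hF
  have h2 : (ofFrags F G).init x ε = ⟨preState F G F.entry, ((ofFrags F G).init x ε).stk⟩ := rfl
  rw [h2, h1, PMF.pure_bind]
  simp only [stepN]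
  rw [step_call, PMF.bind_map, PMF.map]
  congr 1
  funext Y
  obtain ⟨n', hn', hG⟩ := hG Y
  obtain ⟨l, rfl⟩ : ∃ l, m = n' + l := ⟨m - n', by omega⟩
  simp only [Function.comp]
  rw [stepN_add, stepN_post O hG, PMF.pure_bind, stepN_halt]

/-- The configurations that can occur: before the call, the computation leads to `s`. -/
theorem run_invariant (O : RandomProc) (x : List Bool) (ε : ℚ) {s : Stacks W} {t : ℕ}
    (hF : F.Runs ((ofFrags F G).init x ε).stk s t) (T : ℕ) (c : (ofFrags F G).Cfg)
    (hc : c ∈ ((ofFrags F G).run O x ε T).support) :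
    (∃ o n, c.state = preState F G o ∧ F.Reach n o c.stk none s) ∨
      ∃ o, c.state = postState F G o := by
  induction T generalizing c with
  | zero =>
    obtain ⟨n, -, hF⟩ := hF
    simp only [run, PMF.support_pure, Set.mem_singleton_iff] at hc
    subst hc
    exact .inl ⟨F.entry, n, rfl, hF⟩
  | succ T ih =>
    simp only [run, PMF.mem_support_bind_iff] at hc
    obtain ⟨c', hc', hc⟩ := hc
    obtain ⟨st, stk⟩ := c'
    rcases ih _ hc' with ⟨o, n, ho, hr⟩ | ⟨o, ho⟩
    · dsimp only at ho hr
      subst ho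
      cases hr with
      | refl =>
        rw [step_call, PMF.support_map] at hc
        obtain ⟨Y, -, rfl⟩ := hc
        exact .inr ⟨_, rfl⟩
      | head hr =>
        rw [step_pre, PMF.support_pure, Set.mem_singleton_iff] at hc
        subst hc
        exact .inl ⟨_, _, rfl, hr⟩
    · dsimp only at ho
      subst ho
      cases o with
      | none =>
        rw [step_halt, PMF.support_pure, Set.mem_singleton_iff] at hc
        subst hc
        exact .inr ⟨none, rfl⟩
      | some q =>
        rw [step_post, PMF.support_pure, Set.mem_singleton_iff] at hc
        subst hc
        exact .inr ⟨_, rfl⟩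

/-- States of the two fragments carry only pushes and pops, so a call can occur only at the exit of
`F`. By `run_invariant` the stacks there still lead to `s` in the remaining computation, which is
empty. -/
theorem stk_eq_of_calls (O : RandomProc) (x : List Bool) (ε : ℚ) {s : Stacks W} {t : ℕ}
    (hF : F.Runs ((ofFrags F G).init x ε).stk s t) (T : ℕ) (c : (ofFrags F G).Cfg)
    (hc : c ∈ ((ofFrags F G).run O x ε T).support) (hcall : c.Calls) : c.stk = s := by
  obtain ⟨q, hq⟩ := hcall
  rcases run_invariant O x ε hF T c hc with ⟨o, n, ho, hr⟩ | ⟨o, ho⟩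
  · rw [ho] at hq
    cases hr with
    | refl => rfl
    | @head n q' _ _ _ hr =>
      have : (ofFrags F G).prog (preState F G (some q')) = (F.prog q').toInstr (preState F G) := rfl
      rw [this] at hq
      cases h : F.prog q' <;> rw [h] at hq <;> cases hq
  · rw [ho] at hq
    cases o with
    | none => cases hq
    | some q' =>
      have : (ofFrags F G).prog (postState F G (some q')) =
        (G.prog q').toInstr (postState F G) := rfl
      rw [this] at hq
      cases h : G.prog q' <;> rw [h] at hq <;> cases hq

end ofFrags

end OracleMachine

/-! ### Polynomially bounded functions -/

/-- The coefficients are natural numbers, so every monomial is monotone. This makes polynomial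
bounds composable. -/
theorem Polynomial.eval_mono_nat (P : Polynomial ℕ) : Monotone fun n => P.eval n := by
  intro a b hab
  simp only [Polynomial.eval_eq_sum]
  exact Finset.sum_le_sum fun i _ => Nat.mul_le_mul_left _ (Nat.pow_le_pow_left hab _)

def PolyBdd (f : ℕ → ℕ) : Prop := ∃ P : Polynomial ℕ, ∀ n, f n ≤ P.eval n

namespace PolyBdd

theorem const (c : ℕ) : PolyBdd fun _ => c := ⟨Polynomial.C c, fun n => by simp⟩

theorem id : PolyBdd fun n => n := ⟨Polynomial.X, fun n => by simp⟩

theorem add {f g : ℕ → ℕ} (hf : PolyBdd f) (hg : PolyBdd g) : PolyBdd fun n => f n + g n := by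
  obtain ⟨P, hP⟩ := hf
  obtain ⟨Q, hQ⟩ := hg
  exact ⟨P + Q, fun n => by rw [Polynomial.eval_add]; exact add_le_add (hP n) (hQ n)⟩

theorem mul {f g : ℕ → ℕ} (hf : PolyBdd f) (hg : PolyBdd g) : PolyBdd fun n => f n * g n := by
  obtain ⟨P, hP⟩ := hf
  obtain ⟨Q, hQ⟩ := hg
  exact ⟨P * Q, fun n => by rw [Polynomial.eval_mul]; exact Nat.mul_le_mul (hP n) (hQ n)⟩

theorem comp {f g : ℕ → ℕ} (hf : PolyBdd f) (hg : PolyBdd g) : PolyBdd fun n => f (g n) := by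
  obtain ⟨P, hP⟩ := hf
  obtain ⟨Q, hQ⟩ := hg
  refine ⟨P.comp Q, fun n => ?_⟩
  rw [Polynomial.eval_comp]
  exact (hP _).trans (P.eval_mono_nat (hQ n))

theorem sum {ι : Type*} (s : Finset ι) {f : ι → ℕ → ℕ} (hf : ∀ i, PolyBdd (f i)) :
    PolyBdd fun n => ∑ i ∈ s, f i n := by
  classical
  induction s using Finset.induction_on with
  | empty => simpa using const 0
  | insert a s ha ih => simpa [Finset.sum_insert ha] using (hf a).add ih

end PolyBdd

/-! ### Configurations whose work stacks are unary counters -/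

/-- The contents of all stacks but the work stacks. -/
@[ext]
structure Core where
  inp : List Bool
  num : List Bool
  den : List Bool
  out : List Bool
  dnum : List Bool
  dden : List Bool
  val : List Bool

variable {R : Type}

namespace Core

/-- The stacks described by `c`, where the work stack `r` contains the number `ρ r` in unary. -/
def stk (c : Core) (ρ : R → ℕ) : Stacks R
  | .input => c.inp
  | .epsNum => c.num
  | .epsDen => c.den
  | .query => c.out
  | .deltaNum => c.dnum
  | .deltaDen => c.dden
  | .value => c.val
  | .work r => List.replicate (ρ r) true

variable (c : Core) (ρ : R → ℕ)

@[simp] theorem stk_input : c.stk ρ .input = c.inp := rfl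
@[simp] theorem stk_epsNum : c.stk ρ .epsNum = c.num := rfl
@[simp] theorem stk_epsDen : c.stk ρ .epsDen = c.den := rfl
@[simp] theorem stk_query : c.stk ρ .query = c.out := rfl
@[simp] theorem stk_deltaNum : c.stk ρ .deltaNum = c.dnum := rfl
@[simp] theorem stk_deltaDen : c.stk ρ .deltaDen = c.dden := rfl
@[simp] theorem stk_value : c.stk ρ .value = c.val := rfl
@[simp] theorem stk_work (r : R) : c.stk ρ (.work r) = List.replicate (ρ r) true := rfl

variable [DecidableEq R] (l : List Bool)

@[simp] theorem update_input :
    Function.update (c.stk ρ) .input l = { c with inp := l }.stk ρ := by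
  funext k; cases k <;> simp

@[simp] theorem update_epsNum :
    Function.update (c.stk ρ) .epsNum l = { c with num := l }.stk ρ := by
  funext k; cases k <;> simp

@[simp] theorem update_epsDen :
    Function.update (c.stk ρ) .epsDen l = { c with den := l }.stk ρ := by
  funext k; cases k <;> simp

@[simp] theorem update_query :
    Function.update (c.stk ρ) .query l = { c with out := l }.stk ρ := by
  funext k; cases k <;> simp

@[simp] theorem update_deltaNum :
    Function.update (c.stk ρ) .deltaNum l = { c with dnum := l }.stk ρ := by
  funext k; cases k <;> simp

@[simp] theorem update_deltaDen :
    Function.update (c.stk ρ) .deltaDen l = { c with dden := l }.stk ρ := by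
  funext k; cases k <;> simp

@[simp] theorem update_value :
    Function.update (c.stk ρ) .value l = { c with val := l }.stk ρ := by
  funext k; cases k <;> simp

theorem update_work (r : R) (n : ℕ) :
    Function.update (c.stk ρ) (.work r) (List.replicate n true) =
      c.stk (Function.update ρ r n) := by
  funext k
  cases k with
  | work i =>
    by_cases h : i = r
    · subst h; simp
    · simp [Function.update_of_ne, h]
  | _ => simp

end Core

namespace Frag

variable [DecidableEq R]

theorem runs_inc (r : R) (c : Core) (ρ : R → ℕ) :
    (push (.work r) true).Runs (c.stk ρ) (c.stk (Function.update ρ r (ρ r + 1))) 1 := by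
  have := runs_push (.work r) true (c.stk ρ)
  rwa [Core.stk_work, ← List.replicate_succ, Core.update_work] at this

/-- Pop symbols from `k` until it is empty; run `body` for each. -/
def forEach (k : Tape R) (body : Bool → Frag R) : Frag R :=
  pop k Option.isSome fun b => b.elim skip body

theorem runs_forEach_nil {k : Tape R} {body : Bool → Frag R} {s : Stacks R} (h : s k = []) :
    (forEach k body).Runs s s 1 := by
  refine Runs.pop_exit none (by simp [h]) rfl ?_
  have : Function.update s k (s k).tail = s := by
    funext q; simp only [Function.update_apply]; split_ifs <;> simp_all
  rw [this]
  exact runs_skip _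

theorem runs_forEach_cons {k : Tape R} {body : Bool → Frag R} {s s' s'' : Stacks R}
    {b : Bool} {l : List Bool} {t t' : ℕ} (h : s k = b :: l)
    (hb : (body b).Runs (Function.update s k l) s' t) (h₁ : (forEach k body).Runs s' s'' t') :
    (forEach k body).Runs s s'' (t + t' + 1) :=
  Runs.pop_again (some b) (by simp [h]) rfl (by simpa [h] using hb) h₁

/-- Move the stack `k` to `k'`, in reverse order. -/
def move (k k' : Tape R) : Frag R := forEach k fun b => push k' b

theorem runs_move {k k' : Tape R} (hk : k ≠ k') (s : Stacks R) :
    (move k k').Runs s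
      (Function.update (Function.update s k []) k' ((s k).reverse ++ s k')) (2 * (s k).length + 1) := by
  generalize hl : s k = l
  induction l generalizing s with
  | nil =>
    have : Function.update (Function.update s k []) k' ([].reverse ++ s k') = s := by
      funext q; simp only [Function.update_apply]; split_ifs <;> simp_all
    rw [this]
    exact runs_forEach_nil hl
  | cons b l ih =>
    have h1 := runs_push k' b (Function.update s k l)
    have h2 := ih (Function.update (Function.update s k l) k'
      (b :: (Function.update s k l) k')) (by simp [hk])
    refine Runs.mono (t := 1 + (2 * l.length + 1) + 1) ?_ (by simp; omega)
    have h3 := runs_forEach_cons hl h1 h2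
    have e : Function.update (Function.update s k []) k' ((b :: l).reverse ++ s k') =
        Function.update (Function.update (Function.update (Function.update s k l) k'
          (b :: Function.update s k l k')) k []) k' (l.reverse ++ Function.update
            (Function.update s k l) k' (b :: Function.update s k l k') k') := by
      funext q
      simp only [Function.update_apply]
      split_ifs <;> simp_all
    rw [e]
    exact h3

/-- Set the counter `r` to zero. -/
def clear (r : R) : Frag R := forEach (.work r) fun _ => skip

theorem runs_clear (r : R) (c : Core) (ρ : R → ℕ) :
    (clear r).Runs (c.stk ρ) (c.stk (Function.update ρ r 0)) (ρ r + 1) := by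
  generalize hn : ρ r = n
  induction n generalizing ρ with
  | zero =>
    have : Function.update ρ r 0 = ρ := by rw [← hn]; simp
    rw [this]
    exact runs_forEach_nil (by simp [hn])
  | succ n ih =>
    have h := ih (Function.update ρ r n) (by simp)
    rw [Function.update_idem] at h
    refine (runs_forEach_cons (b := true) (l := List.replicate n true) (by simp [hn, List.replicate_succ]) ?_ h).mono
      (t := 0 + (n + 1) + 1) (by omega)
    rw [Core.update_work]
    exact runs_skip _

end Frag

/-! ### Generators of strings -/

/-- Programs that write a string depending on the counters. They push the string on a stack, hence
write it from its end to its beginning. In `loop r i g`, the counter `r` runs from `0` to its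
original value minus one (in the order of the string), and `i` is an auxiliary counter. -/
inductive Gen (R : Type) : Type
  | nil
  | bit (b : Bool)
  | seq (g h : Gen R)
  | loop (r i : R) (g : Gen R)

namespace Gen

/-- A time bound when all counters are at most `B`. -/
def cost : Gen R → ℕ → ℕ
  | nil, _ => 0
  | bit _, _ => 1
  | seq g h, B => g.cost B + h.cost B
  | loop _ _ g, B => B * (g.cost B + 4) + 2

theorem polyBdd_cost (g : Gen R) : PolyBdd g.cost := by
  induction g with
  | nil => exact .const 0
  | bit b => exact .const 1
  | seq g h hg hh => exact hg.add hh
  | loop r i g hg => exact (PolyBdd.id.mul (hg.add (.const 4))).add (.const 2)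

variable [DecidableEq R]

/-- The counters in the `j`-th iteration of a loop. -/
def loopEnv (ρ : R → ℕ) (r i : R) (j : ℕ) : R → ℕ :=
  Function.update (Function.update ρ i (ρ r - 1 - j)) r j

/-- The string that is written. -/
def str : Gen R → (R → ℕ) → List Bool
  | nil, _ => []
  | bit b, _ => [b]
  | seq g h, ρ => g.str ρ ++ h.str ρ
  | loop r i g, ρ => (List.range (ρ r)).flatMap fun j => g.str (loopEnv ρ r i j)

/-- The auxiliary counters are free when they are needed. -/
def OK : Gen R → (R → ℕ) → Prop
  | nil, _ => True
  | bit _, _ => True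
  | seq g h, ρ => g.OK ρ ∧ h.OK ρ
  | loop r i g, ρ => r ≠ i ∧ ρ i = 0 ∧ ∀ j < ρ r, g.OK (loopEnv ρ r i j)

/-- The fragment that runs the generator; the symbol `b` is processed by `atom b`. -/
def compile (atom : Bool → Frag R) : Gen R → Frag R
  | nil => .skip
  | bit b => atom b
  | seq g h => (h.compile atom).seq (g.compile atom)
  | loop r i g => (Frag.forEach (.work r) fun _ => (g.compile atom).seq (.push (.work i) true)).seq
      (.forEach (.work i) fun _ => .push (.work r) true)

/-- The second half of a compiled loop: the units that the iterations moved from `r` to `i` are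
moved back, so that a loop leaves all counters unchanged. -/
theorem runs_restore (r i : R) (hri : r ≠ i) (c : Core) (ρ : R → ℕ) :
    (Frag.forEach (.work i) fun _ => Frag.push (.work r) true).Runs (c.stk ρ)
      (c.stk (Function.update (Function.update ρ i 0) r (ρ r + ρ i))) (2 * ρ i + 1) := by
  generalize hn : ρ i = n
  induction n generalizing ρ with
  | zero =>
    have : Function.update (Function.update ρ i 0) r (ρ r + 0) = ρ := by
      funext q; simp only [Function.update_apply]; split_ifs <;> simp_all
    rw [this]
    exact Frag.runs_forEach_nil (by simp [hn])
  | succ n ih =>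
    have h1 := Frag.runs_inc r c (Function.update ρ i n)
    rw [← Core.update_work] at h1
    have h2 := ih (Function.update (Function.update ρ i n) r (Function.update ρ i n r + 1))
      (by simp [hri.symm])
    refine Frag.Runs.mono (t := 1 + (2 * n + 1) + 1) ?_ (by omega)
    have h3 := Frag.runs_forEach_cons (k := .work i) (s := c.stk ρ) (b := true)
      (l := List.replicate n true) (body := fun _ => Frag.push (.work r) true)
      (by simp [hn, List.replicate_succ]) h1 h2
    have e : Function.update (Function.update ρ i 0) r (ρ r + (n + 1)) =
        Function.update (Function.update (Function.update (Function.update ρ i n) r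
          (Function.update ρ i n r + 1)) i 0) r (Function.update (Function.update ρ i n) r
            (Function.update ρ i n r + 1) r + n) := by
      funext q
      simp only [Function.update_apply]
      split_ifs <;> simp_all
      omega
    rw [e]
    exact h3

/-- `E` describes the effect of processing a string with `atom`. -/
theorem runs_compile {atom : Bool → Frag R} {E : List Bool → Core → Core} (hnil : ∀ c, E [] c = c)
    (happ : ∀ l l' c, E (l ++ l') c = E l (E l' c))
    (hatom : ∀ b c (ρ : R → ℕ), (atom b).Runs (c.stk ρ) ((E [b] c).stk ρ) 1)
    (g : Gen R) (B : ℕ) (c : Core) (ρ : R → ℕ) (hok : g.OK ρ) (hB : ∀ r, ρ r ≤ B) :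
    (g.compile atom).Runs (c.stk ρ) ((E (g.str ρ) c).stk ρ) (g.cost B) := by
  induction g generalizing c ρ with
  | nil => simp only [str, hnil]; exact Frag.runs_skip _
  | bit b => exact hatom b c ρ
  | seq g h hg hh =>
    simp only [str, happ, cost]
    rw [add_comm]
    exact (hh c ρ hok.2 hB).seq (hg _ ρ hok.1 hB)
  | loop r i g hg =>
    obtain ⟨hri, hi, hok⟩ := hok
    -- With `m` iterations left, `r` holds `m` and `i` holds the number of those done. Popping a
    -- unit of `r` leaves the current index in `r` itself. The largest index is handled first,
    -- because the string is pushed from its end.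
    have key : ∀ m ≤ ρ r, ∀ c : Core,
        (Frag.forEach (.work r) fun _ => (g.compile atom).seq (.push (.work i) true)).Runs
          (c.stk (Function.update (Function.update ρ i (ρ r - m)) r m))
          ((E ((List.range m).flatMap fun j => g.str (loopEnv ρ r i j)) c).stk
            (Function.update (Function.update ρ i (ρ r)) r 0)) (m * (g.cost B + 2) + 1) := by
      intro m
      induction m with
      | zero =>
        intro _ c
        simp only [List.range_zero, List.flatMap_nil, hnil, Nat.sub_zero, Nat.zero_mul]
        exact Frag.runs_forEach_nil (by simp)
      | succ m ih =>
        intro hm c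
        have h1 := hg c (loopEnv ρ r i m) (hok m (by omega)) (by
          intro q
          simp only [loopEnv, Function.update_apply]
          have := hB q
          have := hB r
          split_ifs <;> omega)
        have h2 := Frag.runs_inc i (E (g.str (loopEnv ρ r i m)) c) (loopEnv ρ r i m)
        have h3 := ih (by omega) (E (g.str (loopEnv ρ r i m)) c)
        have e1 : Function.update (loopEnv ρ r i m) i (loopEnv ρ r i m i + 1) =
            Function.update (Function.update ρ i (ρ r - m)) r m := by
          unfold loopEnv
          rw [Function.update_comm hri]
          simp only [Function.update_idem]
          congr 2
          simp [hri.symm]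
          omega
        rw [e1] at h2
        have h4 := h1.seq h2
        rw [List.range_succ, List.flatMap_append, happ]
        simp only [List.flatMap_cons, List.flatMap_nil, List.append_nil]
        refine (Frag.runs_forEach_cons (b := true) (l := List.replicate m true)
          (by simp [List.replicate_succ]) (t := g.cost B + 1) ?_ h3).mono (by ring_nf; omega)
        rw [Core.update_work, Function.update_idem, show ρ r - (m + 1) = ρ r - 1 - m by omega]
        exact h4
    have k1 := key (ρ r) le_rfl c
    rw [Nat.sub_self] at k1
    have e2 : Function.update (Function.update ρ i 0) r (ρ r) = ρ := by rw [← hi]; simp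
    rw [e2] at k1
    have k2 := runs_restore r i hri
      (E ((List.range (ρ r)).flatMap fun j => g.str (loopEnv ρ r i j)) c)
      (Function.update (Function.update ρ i (ρ r)) r 0)
    have e3 : Function.update (Function.update (Function.update (Function.update ρ i (ρ r)) r 0) i 0)
        r (Function.update (Function.update ρ i (ρ r)) r 0 r +
          Function.update (Function.update ρ i (ρ r)) r 0 i) = ρ := by
      funext q
      simp only [Function.update_apply]
      split_ifs <;> simp_all
    rw [e3] at k2
    refine (k1.seq k2).mono ?_
    have := hB r
    simp only [cost, Function.update_of_ne hri.symm, Function.update_self]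
    nlinarith [Nat.mul_le_mul_right (g.cost B + 4) this]

/-- Write the string on the query stack. -/
def write (g : Gen R) : Frag R := g.compile fun b => .push .query b

theorem runs_write (g : Gen R) {B : ℕ} (c : Core) {ρ : R → ℕ} (hok : g.OK ρ)
    (hB : ∀ r, ρ r ≤ B) :
    g.write.Runs (c.stk ρ) ({ c with out := g.str ρ ++ c.out }.stk ρ) (g.cost B) := by
  refine runs_compile (E := fun l c => { c with out := l ++ c.out }) (fun c => rfl)
    (fun l l' c => by simp) (fun b c ρ => ?_) g B c ρ hok hB
  have := Frag.runs_push .query b (c.stk ρ)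
  simpa using this

/-- Remove as many symbols from the output stack as the string has. -/
def dropValue (g : Gen R) : Frag R := g.compile fun _ => .pop .value (fun _ => false) fun _ => .skip

/-- The control flow of the generator is reused with a pop in place of each push, so the number of
dropped digits is never stored anywhere. -/
theorem runs_dropValue (g : Gen R) {B : ℕ} (c : Core) {ρ : R → ℕ} (hok : g.OK ρ)
    (hB : ∀ r, ρ r ≤ B) :
    g.dropValue.Runs (c.stk ρ) ({ c with val := c.val.drop (g.str ρ).length }.stk ρ)
      (g.cost B) := by
  refine runs_compile (E := fun l c => { c with val := c.val.drop l.length }) (fun c => rfl)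
    (fun l l' c => by simp [add_comm]) (fun b c ρ => ?_) g B c ρ hok hB
  refine Frag.Runs.pop_exit _ rfl rfl ?_
  simpa using Frag.runs_skip (W := R) _

end Gen

/-! ### Fragments that measure and parse the input and scale the error parameter -/

namespace Frag

variable [DecidableEq R]

/-- Increment all counters in the list. -/
def incs : List R → Frag R
  | [] => skip
  | r :: L => (push (.work r) true).seq (incs L)

theorem runs_incs (L : List R) (c : Core) (ρ : R → ℕ) :
    (incs L).Runs (c.stk ρ) (c.stk fun r => ρ r + L.count r) L.length := by
  induction L generalizing ρ with
  | nil => exact runs_skip (c.stk ρ)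
  | cons a L ih =>
    have h := (runs_inc a c ρ).seq (ih (Function.update ρ a (ρ a + 1)))
    have e : (fun r => ρ r + (a :: L).count r) =
        fun r => Function.update ρ a (ρ a + 1) r + L.count r := by
      funext r
      by_cases hr : r = a
      · subst hr; simp; omega
      · simp [hr, Ne.symm hr]
    rw [e]
    exact h.mono (by simp; omega)

/-- Read a unary numeral from the input and add it to the counters in the list. -/
def readUnary (L : List R) : Frag R :=
  pop .input (fun b => b == some true) fun b => if b = some true then incs L else skip

theorem runs_readUnary (L : List R) (a : ℕ) (rest : List Bool) (c : Core) (ρ : R → ℕ)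
    (hc : c.inp = unary a ++ rest) :
    (readUnary L).Runs (c.stk ρ) ({ c with inp := rest }.stk fun r => ρ r + a * L.count r)
      (a * (L.length + 1) + 1) := by
  induction a generalizing c ρ with
  | zero =>
    refine (Runs.pop_exit (some false) (by simp [hc, unary]) rfl (t := 0) ?_).mono (by simp)
    simpa [hc, unary] using runs_skip (W := R) _
  | succ a ih =>
    have hc' : c.inp = true :: (unary a ++ rest) := by
      rw [hc]; simp [unary, List.replicate_succ]
    have h := ih { c with inp := unary a ++ rest } (fun r => ρ r + L.count r) rfl
    have h1 := runs_incs L { c with inp := unary a ++ rest } ρ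
    have e : (fun r => ρ r + (a + 1) * L.count r) =
        fun r => (fun r => ρ r + L.count r) r + a * L.count r := by
      funext r; ring
    rw [e]
    refine (Runs.pop_again (some true) (by simp [hc']) rfl ?_ h).mono (t := L.length + _ + 1)
      (by ring_nf; omega)
    simpa [hc'] using h1

/-- Add the length of the input to the counters in the list. -/
def measure (L : List R) : Frag R :=
  (forEach .input fun b => (incs L).seq (push .value b)).seq (move .value .input)

/-- The input is moved to `value` and back, and the two reversals cancel. The stack `value` must be
empty, since its contents would otherwise end up in the input. -/
theorem runs_measure (L : List R) (c : Core) (ρ : R → ℕ) (hc : c.val = []) :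
    (measure L).Runs (c.stk ρ) (c.stk fun r => ρ r + c.inp.length * L.count r)
      (c.inp.length * (L.length + 4) + 2) := by
  have key : ∀ (l : List Bool) (c : Core) (ρ : R → ℕ), c.inp = l →
      (forEach .input fun b => (incs L).seq (push .value b)).Runs (c.stk ρ)
        ({ c with inp := [], val := l.reverse ++ c.val }.stk fun r => ρ r + l.length * L.count r)
        (l.length * (L.length + 2) + 1) := by
    intro l
    induction l with
    | nil =>
      intro c ρ hc
      have := runs_forEach_nil (k := .input) (body := fun b => (incs L).seq (push .value b))
        (s := c.stk ρ) (by simp [hc])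
      rw [show ({ c with inp := [], val := [].reverse ++ c.val } : Core) = c by ext1 <;> simp [hc]]
      simpa using this
    | cons b l ih =>
      intro c ρ hc
      have h1 := (runs_incs L { c with inp := l } ρ).seq (runs_push .value b _)
      simp only [Core.stk_value, Core.update_value] at h1
      have h2 := ih { c with inp := l, val := b :: c.val } (fun r => ρ r + L.count r) rfl
      have e : (fun r => ρ r + (b :: l).length * L.count r) =
          fun r => (fun r => ρ r + L.count r) r + l.length * L.count r := by
        funext r; simp; ring
      rw [e]
      have := runs_forEach_cons (k := .input) (body := fun b => (incs L).seq (push .value b))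
        (s := c.stk ρ) (b := b) (l := l) (by simp [hc]) (by simpa using h1) h2
      refine Runs.mono (t := L.length + 1 + (l.length * (L.length + 2) + 1) + 1) ?_
        (by simp; ring_nf; omega)
      simpa using this
  have h1 := key c.inp c ρ rfl
  have h2 := runs_move (R := R) (k := .value) (k' := .input) (by simp)
    ({ c with inp := [], val := c.inp.reverse ++ c.val }.stk fun r => ρ r + c.inp.length * L.count r)
  have h3 : (move .value .input).Runs ({ c with inp := [], val := c.inp.reverse ++ c.val }.stk
      fun r => ρ r + c.inp.length * L.count r) (c.stk fun r => ρ r + c.inp.length * L.count r)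
      (2 * c.inp.length + 1) := by
    obtain ⟨inp, num, den, out, dnum, dden, val⟩ := c
    dsimp only at hc
    subst hc
    simpa using h2
  exact (h1.seq h3).mono (by ring_nf; omega)

/-- Run `F` until the input is used up. -/
def records (F : Frag R) : Frag R := forEach .input fun b => (push .input b).seq F

/-- `K done rest` are the stacks when the records in `done` (in reverse order) have been processed
and those in `rest` remain. -/
theorem runs_records {α : Type*} (F : Frag R) (e : α → List Bool) (hne : ∀ a, e a ≠ [])
    (K : List α → List α → Stacks R) (hK : ∀ d l, K d l .input = l.flatMap e) (T : ℕ)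
    (l₀ : List α)
    (hF : ∀ d a l, d.reverse ++ a :: l = l₀ → F.Runs (K d (a :: l)) (K (a :: d) l) T) :
    (records F).Runs (K [] l₀) (K l₀.reverse []) (l₀.length * (T + 2) + 1) := by
  have key : ∀ (l d : List α), d.reverse ++ l = l₀ →
      (records F).Runs (K d l) (K l₀.reverse []) (l.length * (T + 2) + 1) := by
    intro l
    induction l with
    | nil =>
      intro d hd
      rw [← hd]
      simp only [List.append_nil, List.reverse_reverse]
      exact (runs_forEach_nil (by simp [hK])).mono (by simp)
    | cons a l ih =>
      intro d hd
      obtain ⟨b, m, hm⟩ := List.exists_cons_of_ne_nil (hne a)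
      have h1 := hF d a l hd
      have h2 := ih (a :: d) (by simpa using hd)
      have h3 : K d (a :: l) .input = b :: (m ++ l.flatMap e) := by simp [hK, hm]
      -- The loop test has to pop a symbol; pushing it back turns the test into a peek, and `F` sees
      -- the entire record.
      have h4 := runs_push .input b (Function.update (K d (a :: l)) .input (m ++ l.flatMap e))
      rw [Function.update_self, Function.update_idem, ← h3, Function.update_eq_self] at h4
      exact (runs_forEach_cons h3 (h4.seq h1) h2).mono (by simp; ring_nf; omega)
  exact key l₀ [] rfl

/-- Read a unary numeral `j < n` from the input and run `h j`. -/
def decode : (n : ℕ) → (ℕ → Frag R) → Frag R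
  | 0, _ => skip
  | n + 1, h => pop .input (fun _ => false) fun b =>
      if b = some true then decode n fun j => h (j + 1) else h 0

/-- The bound `n` is fixed (it will be the number of relations), so the numeral is kept in the
control state and a different fragment can follow each value. -/
theorem runs_decode (n : ℕ) (h : ℕ → Frag R) (j : ℕ) (hj : j < n) (rest : List Bool) (c : Core)
    (ρ : R → ℕ) (hc : c.inp = unary j ++ rest) {s : Stacks R} {t : ℕ}
    (hr : (h j).Runs ({ c with inp := rest }.stk ρ) s t) :
    (decode n h).Runs (c.stk ρ) s (t + n) := by
  induction n generalizing c j h with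
  | zero => omega
  | succ n ih =>
    cases j with
    | zero =>
      refine (Runs.pop_exit (some false) (by simp [hc, unary]) rfl (t := t) ?_).mono (by omega)
      simpa [hc, unary] using hr
    | succ j =>
      have hc' : c.inp = true :: (unary j ++ rest) := by
        rw [hc]; simp [unary, List.replicate_succ]
      refine (Runs.pop_exit (some true) (by simp [hc']) rfl (t := t + n) ?_).mono (by omega)
      simp only [if_true]
      rw [Core.stk_input, Core.update_input, hc']
      exact ih (fun j => h (j + 1)) j (by omega) _ rfl hr

/-- Copy the error parameter, divided by `2 ^ j`, to the query. -/
def scaleEps (j : ℕ) : Frag R :=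
  (move .epsNum .value).seq ((move .value .deltaNum).seq ((move .epsDen .value).seq
    ((move .value .deltaDen).seq ((fun F => (push .deltaDen false).seq F)^[j] skip))))

theorem runs_pushes (j : ℕ) (c : Core) (ρ : R → ℕ) :
    ((fun F => (push .deltaDen false).seq F)^[j] skip : Frag R).Runs (c.stk ρ)
      ({ c with dden := List.replicate j false ++ c.dden }.stk ρ) j := by
  induction j generalizing c with
  | zero => exact runs_skip _
  | succ j ih =>
    rw [Function.iterate_succ_apply']
    have h := (runs_push .deltaDen false (c.stk ρ)).seq
      (by simpa using ih { c with dden := false :: c.dden })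
    have e : List.replicate (j + 1) false ++ c.dden =
      List.replicate j false ++ false :: c.dden := by simp [List.replicate_succ']
    rw [e]
    exact h.mono (by omega)

/-- Passing each numeral through `value` reverses it twice. The zeros pushed on top are least
significant digits, hence multiply the denominator by `2 ^ j`. -/
theorem runs_scaleEps (j : ℕ) (c : Core) (ρ : R → ℕ) (h1 : c.dnum = []) (h2 : c.dden = [])
    (h3 : c.val = []) :
    (scaleEps j : Frag R).Runs (c.stk ρ)
      ({ c with num := [], den := [], dnum := c.num,
                dden := List.replicate j false ++ c.den }.stk ρ)
      (4 * c.num.length + 4 * c.den.length + 4 + j) := by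
  obtain ⟨inp, num, den, out, dnum, dden, val⟩ := c
  dsimp only at h1 h2 h3
  subst h1 h2 h3
  have m1 := runs_move (R := R) (k := .epsNum) (k' := .value) (by simp)
    (Core.stk ⟨inp, num, den, out, [], [], []⟩ ρ)
  have m2 := runs_move (R := R) (k := .value) (k' := .deltaNum) (by simp)
    (Core.stk ⟨inp, [], den, out, [], [], num.reverse⟩ ρ)
  have m3 := runs_move (R := R) (k := .epsDen) (k' := .value) (by simp)
    (Core.stk ⟨inp, [], den, out, num, [], []⟩ ρ)
  have m4 := runs_move (R := R) (k := .value) (k' := .deltaDen) (by simp)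
    (Core.stk ⟨inp, [], [], out, num, [], den.reverse⟩ ρ)
  have m5 := runs_pushes (R := R) j ⟨inp, [], [], out, num, den, []⟩ ρ
  simp only [Core.update_epsNum, Core.update_epsDen, Core.update_value, Core.update_deltaNum,
    Core.update_deltaDen, Core.stk_epsNum, Core.stk_epsDen, Core.stk_value, Core.stk_deltaNum,
    Core.stk_deltaDen, List.append_nil, List.reverse_reverse, List.length_reverse] at m1 m2 m3 m4 m5
  exact (m1.seq (m2.seq (m3.seq (m4.seq m5)))).mono (by dsimp only; omega)

end Frag

/-! ### Binary numerals -/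

theorem natOfBits_bits (n : ℕ) : natOfBits (Nat.bits n) = n := by
  induction n using Nat.binaryRec' with
  | zero => simp [natOfBits]
  | bit b n h ih =>
    rw [Nat.bits_append_bit n b h, natOfBits, ih, Nat.bit_val]
    omega

theorem natOfBits_replicate_append (j : ℕ) (l : List Bool) :
    natOfBits (List.replicate j false ++ l) = 2 ^ j * natOfBits l := by
  induction j with
  | zero => simp
  | succ j ih => simp [List.replicate_succ, natOfBits, ih]; ring

theorem natOfBits_drop (N : ℕ) (l : List Bool) : natOfBits (l.drop N) = natOfBits l / 2 ^ N := by
  induction N generalizing l with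
  | zero => simp
  | succ N ih =>
    cases l with
    | nil => simp [natOfBits]
    | cons b l =>
      simp only [List.drop_succ_cons, ih, natOfBits, pow_succ']
      rw [← Nat.div_div_eq_div_mul]
      congr 1
      cases b
      · simp
      · simp; omega

/-! ### The reduction computed by a fragment -/

/-- `F` writes an instance of `g`, and the oracle's answer is divided by a power of two whose
exponent is the length of the string generated by `G`. -/
theorem apReducible_of_frag [Finite R] [DecidableEq R] {f g : CountingProblem} (F : Frag R)
    (G : Gen R) (j : ℕ) {T : ℕ → ℕ} (hT : PolyBdd T)
    (h : ∀ I : f.Inst, ∃ (J : g.Inst) (ρ : R → ℕ),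
      (∀ num den, F.Runs (Core.stk ⟨f.encode I, num, den, [], [], [], []⟩ fun _ => 0)
        (Core.stk ⟨[], num, den, g.encode J, [], [], []⟩ ρ) (T (f.encode I).length)) ∧
      G.OK ρ ∧ (∀ r, ρ r ≤ T (f.encode I).length) ∧
      ∀ ε : ℝ, 0 < ε → ε < 1 → ∀ Y : ℕ,
        Real.exp (-(ε / 2 ^ j)) * g.count J ≤ Y → Y ≤ Real.exp (ε / 2 ^ j) * g.count J →
        Real.exp (-ε) * f.count I ≤ (Y / 2 ^ (G.str ρ).length : ℕ) ∧
          ((Y / 2 ^ (G.str ρ).length : ℕ) : ℝ) ≤ Real.exp ε * f.count I) :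
    APReducible f g := by
  obtain ⟨P, hP⟩ := hT
  obtain ⟨Q, hQ⟩ := G.polyBdd_cost.comp ⟨P, fun n => le_refl (P.eval n)⟩
  have setup : ∀ (I : f.Inst), ∃ (J : g.Inst) (ρ : R → ℕ),
      (∀ ε : ℚ, 0 < ε → ε < 1 → (F.seq (.scaleEps j)).Runs
        ((OracleMachine.ofFrags (F.seq (.scaleEps j)) G.dropValue).init (f.encode I) ε).stk
        (Core.stk ⟨[], [], [], g.encode J, Nat.bits ε.num.toNat,
          List.replicate j false ++ Nat.bits ε.den, []⟩ ρ)
        (P.eval (f.encode I).length + (8 * Nat.size ε.den + 4 + j))) ∧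
      (∀ (ε : ℚ) (Y : ℕ), G.dropValue.Runs
        (Function.update (Core.stk ⟨[], [], [], g.encode J, Nat.bits ε.num.toNat,
          List.replicate j false ++ Nat.bits ε.den, []⟩ ρ) .value (Nat.bits Y))
        (Core.stk ⟨[], [], [], g.encode J, Nat.bits ε.num.toNat,
          List.replicate j false ++ Nat.bits ε.den, (Nat.bits Y).drop (G.str ρ).length⟩ ρ)
        (Q.eval (f.encode I).length)) ∧
      ∀ ε : ℝ, 0 < ε → ε < 1 → ∀ Y : ℕ,
        Real.exp (-(ε / 2 ^ j)) * g.count J ≤ Y → Y ≤ Real.exp (ε / 2 ^ j) * g.count J →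
        Real.exp (-ε) * f.count I ≤ (Y / 2 ^ (G.str ρ).length : ℕ) ∧
          ((Y / 2 ^ (G.str ρ).length : ℕ) : ℝ) ≤ Real.exp ε * f.count I := by
    intro I
    obtain ⟨J, ρ, h1, h2, h3, h4⟩ := h I
    refine ⟨J, ρ, fun ε h0 h1' => ?_, fun ε Y => ?_, h4⟩
    · have r1 := h1 (Nat.bits ε.num.toNat) (Nat.bits ε.den)
      have r2 := Frag.runs_scaleEps (R := R) j
        ⟨[], Nat.bits ε.num.toNat, Nat.bits ε.den, g.encode J, [], [], []⟩ ρ rfl rfl rfl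
      have r3 := r1.seq r2
      have e : ((OracleMachine.ofFrags (F.seq (.scaleEps j)) G.dropValue).init (f.encode I) ε).stk =
          Core.stk ⟨f.encode I, Nat.bits ε.num.toNat, Nat.bits ε.den, [], [], [], []⟩
            fun _ => 0 := by
        funext k; cases k <;> rfl
      rw [e]
      refine r3.mono ?_
      -- Since ε < 1, the numerator is no longer than the denominator, the only numeral that the
      -- time bound mentions.
      have hn : Nat.size ε.num.toNat ≤ Nat.size ε.den := by
        refine Nat.size_le_size ?_
        have : ε.num < ε.den := Rat.num_lt_denom_iff.2 h1'
        omega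
      have := hP (f.encode I).length
      dsimp only
      rw [Nat.size_eq_bits_len, Nat.size_eq_bits_len]
      omega
    · have := G.runs_dropValue (B := P.eval (f.encode I).length)
        ⟨[], [], [], g.encode J, Nat.bits ε.num.toNat,
          List.replicate j false ++ Nat.bits ε.den, Nat.bits Y⟩ h2
        fun r => (h3 r).trans (hP _)
      rw [Core.update_value]
      exact this.mono (hQ _)
  have hdelta : ∀ (ε : ℚ), 0 < ε → (natOfBits (Nat.bits ε.num.toNat) : ℚ) /
      (natOfBits (List.replicate j false ++ Nat.bits ε.den) : ℚ) = ε / 2 ^ j := by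
    intro ε h0
    rw [natOfBits_replicate_append, natOfBits_bits, natOfBits_bits]
    have : ((ε.num.toNat : ℕ) : ℚ) = (ε.num : ℚ) := by
      rw [← Int.cast_natCast, Int.toNat_of_nonneg (Rat.num_nonneg.2 h0.le)]
    rw [this]
    conv_rhs => rw [← Rat.num_div_den ε]
    push_cast
    rw [div_div, mul_comm]
  have htime : ∀ (I : f.Inst) (ε : ℚ),
      P.eval (f.encode I).length + (8 * Nat.size ε.den + 4 + j) + Q.eval (f.encode I).length + 1 ≤
      (P + Q + Polynomial.C 8 * Polynomial.X + Polynomial.C (5 + j)).eval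
        ((f.encode I).length + Nat.size ε.den + ⌈ε⁻¹⌉₊) := by
    intro I ε
    have hp := P.eval_mono_nat (show (f.encode I).length ≤
      (f.encode I).length + Nat.size ε.den + ⌈ε⁻¹⌉₊ by omega)
    have hq := Q.eval_mono_nat (show (f.encode I).length ≤
      (f.encode I).length + Nat.size ε.den + ⌈ε⁻¹⌉₊ by omega)
    simp only [Polynomial.eval_add, Polynomial.eval_mul, Polynomial.eval_C, Polynomial.eval_X]
    dsimp only at hp hq
    omega
  refine ⟨OracleMachine.ofFrags (F.seq (.scaleEps j)) G.dropValue,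
    P + Q + Polynomial.C 8 * Polynomial.X + Polynomial.C (5 + j),
    Polynomial.C (2 ^ j) * Polynomial.X, ?_, ?_, ?_⟩
  · intro O I ε h0 h1 t c hc hcall
    obtain ⟨J, ρ, hrun, -, -⟩ := setup I
    have hs := OracleMachine.stk_eq_of_calls O _ ε (hrun ε h0 h1) t c hc hcall
    have hq : c.queryDelta = ε / 2 ^ j := by
      rw [← hdelta ε h0, OracleMachine.Cfg.queryDelta, hs]
      rfl
    have h2 : (1 : ℚ) ≤ 2 ^ j := one_le_pow₀ (by norm_num)
    refine ⟨⟨J, ?_⟩, ?_, ?_, ?_⟩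
    · rw [OracleMachine.Cfg.queryString, hs]
      rfl
    · rw [hq]; positivity
    · rw [hq]
      exact (div_le_self h0.le h2).trans_lt h1
    · rw [hq, inv_div, Polynomial.eval_mul, Polynomial.eval_C, Polynomial.eval_X, div_eq_mul_inv]
      push_cast
      have := Nat.le_ceil ε⁻¹
      gcongr
      linarith [Nat.cast_nonneg (α := ℚ) (f.encode I).length]
  · intro O I ε h0 h1 c hc
    obtain ⟨J, ρ, hrun, hpost, -⟩ := setup I
    rw [OracleMachine.run_ofFrags O _ ε (hrun ε h0 h1) (hpost ε) (by have := htime I ε; omega),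
      PMF.support_map] at hc
    obtain ⟨Y, -, rfl⟩ := hc
    rfl
  · intro O hO I ε h0 h1
    obtain ⟨J, ρ, hrun, hpost, hcount⟩ := setup I
    have hp : (0 : ℚ) < ε / 2 ^ j := by positivity
    have h2 : (1 : ℚ) ≤ 2 ^ j := one_le_pow₀ (by norm_num)
    refine (hO J (ε / 2 ^ j) hp ((div_le_self h0.le h2).trans_lt h1)).trans ?_
    dsimp only
    rw [OracleMachine.outputAt, OracleMachine.run_ofFrags O _ ε (hrun ε h0 h1) (hpost ε)
      (by have := htime I ε; omega), PMF.map_comp, PMF.toOuterMeasure_map_apply,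
      Core.stk_query, Core.stk_deltaNum, Core.stk_deltaDen, hdelta ε h0]
    -- The output is a function of the oracle's answer, so it suffices that every good answer is
    -- mapped to a good output; the probability 3/4 carries over.
    refine MeasureTheory.OuterMeasure.mono _ ?_
    rintro Y ⟨hY1, hY2⟩
    push_cast at hY1 hY2
    have := hcount ε (by exact_mod_cast h0) (by exact_mod_cast h1) Y hY1 hY2
    simpa [OracleMachine.Cfg.output, natOfBits_drop, natOfBits_bits] using this

/-! ### Counting independent sets in blown-up bipartite graphs -/

section BlockCount

open scoped Classical in
/-- The families of subsets whose nonempty members are those with index in `A`. -/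
theorem card_support_eq {α κ : Type} [Fintype α] [Fintype κ] (A : Finset α) :
    (Finset.univ.filter fun S : α → Set κ => (Finset.univ.filter fun i => (S i).Nonempty) = A).card =
      (2 ^ Fintype.card κ - 1) ^ A.card := by
  have h : (Finset.univ.filter fun S : α → Set κ =>
      (Finset.univ.filter fun i => (S i).Nonempty) = A) =
      Fintype.piFinset fun i => if i ∈ A then Finset.univ.erase ∅ else {∅} := by
    ext S
    simp only [Finset.mem_filter, Finset.mem_univ, true_and, Fintype.mem_piFinset, Finset.ext_iff]
    refine forall_congr' fun i => ?_
    by_cases hi : i ∈ A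
    · simp [hi, Set.nonempty_iff_ne_empty]
    · simp [hi, Set.not_nonempty_iff_eq_empty]
  rw [h, Fintype.card_piFinset]
  have : ∀ i, (if i ∈ A then Finset.univ.erase ∅ else {∅} : Finset (Set κ)).card =
      if i ∈ A then 2 ^ Fintype.card κ - 1 else 1 := by
    intro i
    split_ifs
    · rw [Finset.card_erase_of_mem (Finset.mem_univ _), Finset.card_univ, Fintype.card_set]
    · simp
  simp [this]

/-- The pairs of sets of blocks that have no forbidden pair between them. -/
def Allowed {α : Type} (P : α → α → Prop) (X : Finset α × Finset α) : Prop :=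
  ∀ i ∈ X.1, ∀ j ∈ X.2, ¬ P i j

/-- The pairs of families of sets whose nonempty blocks are allowed. -/
def AllowedBlocks {α κ : Type} (P : α → α → Prop) (X : (α → Set κ) × (α → Set κ)) : Prop :=
  ∀ i j, P i j → (X.1 i).Nonempty → ¬ (X.2 j).Nonempty

-- Pairs of families are grouped by the sets of indices of their nonempty blocks. Allowedness
-- depends on these index sets only, and each nonempty block can be chosen in `2 ^ |κ| - 1` ways.
open scoped Classical in
theorem card_allowedBlocks {α κ : Type} [Fintype α] [Fintype κ] (P : α → α → Prop) :
    (Finset.univ.filter (AllowedBlocks (κ := κ) P)).card =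
      ∑ X ∈ Finset.univ.filter (Allowed P),
        (2 ^ Fintype.card κ - 1) ^ (X.1.card + X.2.card) := by
  rw [Finset.card_eq_sum_card_fiberwise (t := Finset.univ.filter (Allowed P))
    (f := fun X => (Finset.univ.filter fun i => (X.1 i).Nonempty,
      Finset.univ.filter fun i => (X.2 i).Nonempty))]
  · refine Finset.sum_congr rfl fun X hX => ?_
    rw [pow_add, ← card_support_eq (κ := κ), ← card_support_eq (κ := κ), ← Finset.card_product]
    congr 1
    ext ⟨S, T⟩
    simp only [Finset.mem_filter, Finset.mem_univ, true_and] at hX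
    simp only [Finset.mem_filter, Finset.mem_univ, true_and, Finset.mem_product]
    constructor
    · rintro ⟨-, rfl⟩
      exact ⟨rfl, rfl⟩
    · rintro ⟨h1, h2⟩
      refine ⟨?_, by rw [h1, h2]⟩
      intro i j hP hi hj
      refine hX i ?_ j ?_ hP
      · rw [← h1]; simpa using hi
      · rw [← h2]; simpa using hj
  · intro X hX
    simp only [Finset.coe_filter, Finset.mem_univ, true_and, Set.mem_ofPred_eq] at hX ⊢
    intro i hi j hj hP
    simp only [Finset.mem_filter, Finset.mem_univ, true_and] at hi hj
    exact hX i j hP hi hj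

variable {n : ℕ}

open scoped Classical in
/-- The pair of sets of blocks that corresponds to an assignment. The last block on either side
represents a constant. -/
noncomputable def blocksOf (σ : Fin n → Bool) : Finset (Fin (n + 1)) × Finset (Fin (n + 1)) :=
  (Finset.univ.filter fun i => i = Fin.last n ∨ ∃ x, σ x = true ∧ i = x.castSucc,
    Finset.univ.filter fun i => i = Fin.last n ∨ ∃ x, σ x = false ∧ i = x.castSucc)

theorem blocksOf_injective : Function.Injective (blocksOf (n := n)) := by
  intro σ τ h
  funext x
  have h1 : x.castSucc ∈ (blocksOf σ).1 ↔ x.castSucc ∈ (blocksOf τ).1 := by rw [h]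
  simp only [blocksOf, Finset.mem_filter, Finset.mem_univ, true_and, Fin.castSucc_ne_last,
    false_or, Fin.castSucc_inj] at h1
  rw [Bool.eq_iff_iff]
  constructor
  · intro hx
    obtain ⟨y, hy, rfl⟩ := h1.1 ⟨x, hx, rfl⟩
    exact hy
  · intro hx
    obtain ⟨y, hy, rfl⟩ := h1.2 ⟨x, hx, rfl⟩
    exact hy

-- The sum is arranged by variables, because the condition `P x x` limits the two blocks of each
-- variable jointly.
open scoped Classical in
theorem card_add_card (A B : Finset (Fin (n + 1))) :
    A.card + B.card =
      ∑ x : Fin n, ((if x.castSucc ∈ A then 1 else 0) + (if x.castSucc ∈ B then 1 else 0)) +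
        ((if Fin.last n ∈ A then 1 else 0) + (if Fin.last n ∈ B then 1 else 0)) := by
  have h : ∀ A : Finset (Fin (n + 1)), A.card = ∑ i, if i ∈ A then 1 else 0 := by
    intro A; simp
  rw [h A, h B, ← Finset.sum_add_distrib, Fin.sum_univ_castSucc]

-- Each variable contributes at most one of its two blocks, and the constant blocks contribute at
-- most two. Equality forces exactly one block per variable, which is an assignment, and both
-- constant blocks.
open scoped Classical in
theorem card_le_of_allowed {P : Fin (n + 1) → Fin (n + 1) → Prop}
    (hP : ∀ x : Fin n, P x.castSucc x.castSucc) {X : Finset (Fin (n + 1)) × Finset (Fin (n + 1))}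
    (hX : Allowed P X) :
    X.1.card + X.2.card ≤ n + 2 ∧ (X.1.card + X.2.card = n + 2 → ∃ σ, X = blocksOf σ) := by
  have hle : ∀ x ∈ (Finset.univ : Finset (Fin n)), ((if x.castSucc ∈ X.1 then 1 else 0) +
      (if x.castSucc ∈ X.2 then 1 else 0)) ≤ 1 := by
    intro x _
    have := fun h1 h2 => hX x.castSucc h1 x.castSucc h2 (hP x)
    split_ifs <;> simp_all
  have hsum := Finset.sum_le_sum hle
  simp only [Finset.sum_const, Finset.card_univ, Fintype.card_fin, smul_eq_mul, mul_one] at hsum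
  rw [card_add_card]
  refine ⟨?_, fun h => ?_⟩
  · refine add_le_add hsum ?_
    split_ifs <;> simp
  · have hlast : Fin.last n ∈ X.1 ∧ Fin.last n ∈ X.2 := by
      by_contra hc
      have : ((if Fin.last n ∈ X.1 then 1 else 0) + (if Fin.last n ∈ X.2 then 1 else 0)) ≤ 1 := by
        split_ifs <;> simp_all
      omega
    have heq : ∑ x : Fin n, ((if x.castSucc ∈ X.1 then 1 else 0) +
        (if x.castSucc ∈ X.2 then 1 else 0)) = ∑ x : Fin n, 1 := by
      simp only [hlast.1, hlast.2, if_true] at h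
      simp only [Finset.sum_const, Finset.card_univ, Fintype.card_fin, smul_eq_mul, mul_one]
      omega
    have hx := (Finset.sum_eq_sum_iff_of_le hle).1 heq
    refine ⟨fun x => decide (x.castSucc ∈ X.1), Prod.ext ?_ ?_⟩
    · ext i
      refine Fin.lastCases ?_ (fun x => ?_) i
      · simp [blocksOf, hlast.1]
      · simp [blocksOf]
    · ext i
      refine Fin.lastCases ?_ (fun x => ?_) i
      · simp [blocksOf, hlast.2]
      · have := hx x (Finset.mem_univ _)
        have hdis := fun h1 h2 => hX x.castSucc h1 x.castSucc h2 (hP x)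
        simp only [blocksOf, Finset.mem_filter, Finset.mem_univ, true_and, Fin.castSucc_ne_last,
          false_or, Fin.castSucc_inj, decide_eq_false_iff_not, exists_eq_right']
        split_ifs at this <;> simp_all

theorem card_blocksOf (σ : Fin n → Bool) :
    (blocksOf σ).1.card + (blocksOf σ).2.card = n + 2 := by
  classical
  rw [card_add_card]
  simp only [blocksOf, Finset.mem_filter, Finset.mem_univ, true_and, Fin.castSucc_ne_last,
    false_or, Fin.castSucc_inj, exists_eq_right']
  have : ∀ x ∈ (Finset.univ : Finset (Fin n)),
      ((if σ x = true then 1 else 0) + if σ x = false then 1 else 0) = 1 := by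
    intro x _
    cases σ x <;> simp
  rw [Finset.sum_congr rfl this]
  simp

open scoped Classical in
/-- The sum over the allowed pairs is dominated by those that come from assignments. -/
theorem sum_allowed_bounds {P : Fin (n + 1) → Fin (n + 1) → Prop}
    (hP : ∀ x : Fin n, P x.castSucc x.castSucc) (q : ℕ) (hq : 1 ≤ q) :
    (Finset.univ.filter fun σ : Fin n → Bool => Allowed P (blocksOf σ)).card * (q - 1) ^ (n + 2) ≤
      ∑ X ∈ Finset.univ.filter (Allowed P), (q - 1) ^ (X.1.card + X.2.card) ∧
    ∑ X ∈ Finset.univ.filter (Allowed P), (q - 1) ^ (X.1.card + X.2.card) ≤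
      (Finset.univ.filter fun σ : Fin n → Bool => Allowed P (blocksOf σ)).card * q ^ (n + 2) +
        4 ^ (n + 1) * q ^ (n + 1) := by
  set Z := Finset.univ.filter fun σ : Fin n → Bool => Allowed P (blocksOf σ)
  have himg : (Finset.univ.filter (Allowed P)).filter (fun X => X.1.card + X.2.card = n + 2) =
      Z.image blocksOf := by
    ext X
    simp only [Finset.mem_filter, Finset.mem_univ, true_and, Finset.mem_image, Z]
    constructor
    · rintro ⟨hX, hc⟩
      obtain ⟨σ, rfl⟩ := (card_le_of_allowed hP hX).2 hc
      exact ⟨σ, hX, rfl⟩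
    · rintro ⟨σ, hσ, rfl⟩
      exact ⟨hσ, card_blocksOf σ⟩
  have hcard : ((Finset.univ.filter (Allowed P)).filter
      (fun X => X.1.card + X.2.card = n + 2)).card = Z.card := by
    rw [himg, Finset.card_image_of_injective _ blocksOf_injective]
  have hmain : ∑ X ∈ (Finset.univ.filter (Allowed P)).filter
      (fun X => X.1.card + X.2.card = n + 2), (q - 1) ^ (X.1.card + X.2.card) =
      Z.card * (q - 1) ^ (n + 2) := by
    rw [← hcard, ← smul_eq_mul, ← Finset.sum_const]
    refine Finset.sum_congr rfl fun X hX => ?_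
    rw [(Finset.mem_filter.1 hX).2]
  rw [← Finset.sum_filter_add_sum_filter_not _ (fun X => X.1.card + X.2.card = n + 2), hmain]
  refine ⟨Nat.le_add_right _ _, add_le_add (Nat.mul_le_mul_left _
    (Nat.pow_le_pow_left (Nat.sub_le _ _) _)) ?_⟩
  -- Every other allowed pair uses at most `n + 1` blocks and so loses a factor of about `q`; there
  -- are at most `4 ^ (n + 1)` pairs altogether.
  have hb : ∀ X ∈ (Finset.univ.filter (Allowed P)).filter
      (fun X => ¬ X.1.card + X.2.card = n + 2), (q - 1) ^ (X.1.card + X.2.card) ≤ q ^ (n + 1) := by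
    intro X hX
    simp only [Finset.mem_filter, Finset.mem_univ, true_and] at hX
    have := (card_le_of_allowed hP hX.1).1
    exact (Nat.pow_le_pow_left (Nat.sub_le _ _) _).trans (Nat.pow_le_pow_right hq (by omega))
  refine (Finset.sum_le_card_nsmul _ _ _ hb).trans ?_
  rw [smul_eq_mul]
  refine Nat.mul_le_mul_right _ ?_
  refine (Finset.card_le_univ _).trans (le_of_eq ?_)
  simp only [Fintype.card_prod, Fintype.card_finset, Fintype.card_fin]
  rw [← Nat.mul_pow]

end BlockCount

/-! ### Independent sets of the blown-up graph, block by block -/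

namespace BipartiteGraph

theorem isIndepSet_iff (B : BipartiteGraph) (S : Set (Fin B.m ⊕ Fin B.n)) :
    B.graph.IsIndepSet S ↔ ∀ e ∈ B.edges, ¬ (Sum.inl e.1 ∈ S ∧ Sum.inr e.2 ∈ S) := by
  constructor
  · rintro h e he ⟨h1, h2⟩
    exact h h1 h2 (by simp) (by
      rw [graph, SimpleGraph.fromRel_adj]
      exact ⟨by simp, .inl ⟨e, he, rfl, rfl⟩⟩)
  · intro h a ha b hb hab hadj
    rw [graph, SimpleGraph.fromRel_adj] at hadj
    rcases hadj.2 with ⟨e, he, rfl, rfl⟩ | ⟨e, he, rfl, rfl⟩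
    · exact h e he ⟨ha, hb⟩
    · exact h e he ⟨hb, ha⟩

end BipartiteGraph

/-- Split a set of vertices into its blocks. -/
def splitBlocks (n k l : ℕ) :
    Set (Fin (n * k + k) ⊕ Fin (n * k + l)) ≃
      ((Fin n → Set (Fin k)) × Set (Fin k)) × ((Fin n → Set (Fin k)) × Set (Fin l)) :=
  let side (l : ℕ) : (Fin (n * k + l) → Prop) ≃ (Fin n → Fin k → Prop) × (Fin l → Prop) :=
    (Equiv.arrowCongr finSumFinEquiv.symm (Equiv.refl Prop)).trans
      ((Equiv.sumArrowEquivProdArrow _ _ _).trans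
        (Equiv.prodCongr ((Equiv.arrowCongr finProdFinEquiv.symm (Equiv.refl Prop)).trans
          (Equiv.curry _ _ _)) (Equiv.refl _)))
  (Equiv.sumArrowEquivProdArrow _ _ _).trans (Equiv.prodCongr (side k) (side l))

/-- The edges of the graph: all edges from the additional left block, and the complete bipartite
graphs between the blocks related by `P`. -/
def IsBlockEdge {n k : ℕ} (P : Fin n → Fin n → Prop) (e : Fin (n * k + k) × Fin (n * k + 1)) :
    Prop :=
  n * k ≤ e.1 ∨ ∃ i j, P i j ∧ ∃ x y : Fin k, (e.1 : ℕ) = i * k + x ∧ (e.2 : ℕ) = j * k + y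

theorem indep_splitBlocks {n k : ℕ} (P : Fin n → Fin n → Prop)
    (S : Set (Fin (n * k + k) ⊕ Fin (n * k + 1))) :
    (∀ e, IsBlockEdge P e → ¬ (Sum.inl e.1 ∈ S ∧ Sum.inr e.2 ∈ S)) ↔
      AllowedBlocks P ((splitBlocks n k 1 S).1.1, (splitBlocks n k 1 S).2.1) ∧
      ((splitBlocks n k 1 S).1.2.Nonempty →
        (∀ j, (splitBlocks n k 1 S).2.1 j = ∅) ∧ (splitBlocks n k 1 S).2.2 = ∅) := by
  have e11 : ∀ i x, x ∈ (splitBlocks n k 1 S).1.1 i ↔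
    Sum.inl (Fin.castAdd k (finProdFinEquiv (i, x))) ∈ S := fun i x => Iff.rfl
  have e12 : ∀ x, x ∈ (splitBlocks n k 1 S).1.2 ↔ Sum.inl (Fin.natAdd (n * k) x) ∈ S :=
    fun x => Iff.rfl
  have e21 : ∀ i x, x ∈ (splitBlocks n k 1 S).2.1 i ↔
    Sum.inr (Fin.castAdd 1 (finProdFinEquiv (i, x))) ∈ S := fun i x => Iff.rfl
  have e22 : ∀ x, x ∈ (splitBlocks n k 1 S).2.2 ↔ Sum.inr (Fin.natAdd (n * k) x) ∈ S :=
    fun x => Iff.rfl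
  constructor
  · intro h
    refine ⟨?_, ?_⟩
    · rintro i j hP ⟨x, hx⟩ ⟨y, hy⟩
      rw [e11] at hx
      rw [e21] at hy
      refine h (_, _) (.inr ⟨i, j, hP, x, y, ?_, ?_⟩) ⟨hx, hy⟩ <;> simp <;> ring
    · rintro ⟨x, hx⟩
      rw [e12] at hx
      refine ⟨fun j => ?_, ?_⟩
      · rw [Set.eq_empty_iff_forall_notMem]
        intro y hy
        rw [e21] at hy
        exact h (_, _) (.inl (by simp)) ⟨hx, hy⟩
      · rw [Set.eq_empty_iff_forall_notMem]
        intro y hy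
        rw [e22] at hy
        exact h (_, _) (.inl (by simp)) ⟨hx, hy⟩
  · rintro ⟨h1, h2⟩ ⟨a, b⟩ he ⟨ha, hb⟩
    rcases he with he | ⟨i, j, hP, x, y, hx, hy⟩
    · obtain ⟨x, rfl⟩ : ∃ x, a = Fin.natAdd (n * k) x :=
        ⟨⟨a - n * k, by dsimp only at he; omega⟩, Fin.ext (by dsimp only at he; simp; omega)⟩
      obtain ⟨h3, h4⟩ := h2 ⟨x, (e12 x).2 ha⟩
      induction b using Fin.addCases with
      | left b =>
        obtain ⟨⟨j, y⟩, rfl⟩ := finProdFinEquiv.surjective b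
        have := (e21 j y).2 hb
        rw [h3] at this
        exact this
      | right b =>
        have := (e22 b).2 hb
        rw [h4] at this
        exact this
    · have ea : a = Fin.castAdd k (finProdFinEquiv (i, x)) :=
        Fin.ext (by simp at hx ⊢; rw [hx]; ring)
      have eb : b = Fin.castAdd 1 (finProdFinEquiv (j, y)) :=
        Fin.ext (by simp at hy ⊢; rw [hy]; ring)
      subst ea eb
      exact h1 i j hP ⟨x, (e11 i x).2 ha⟩ ⟨y, (e21 j y).2 hb⟩

-- If the additional left block is unused, the additional right vertex is free, whence the factor 2.
-- If it is used, the whole right side is empty and the remaining left blocks are arbitrary.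
open scoped Classical in
theorem card_split_indep {n k : ℕ} (P : Fin n → Fin n → Prop) :
    (Finset.univ.filter fun X : ((Fin n → Set (Fin k)) × Set (Fin k)) ×
        ((Fin n → Set (Fin k)) × Set (Fin 1)) =>
      AllowedBlocks P (X.1.1, X.2.1) ∧ (X.1.2.Nonempty → (∀ j, X.2.1 j = ∅) ∧ X.2.2 = ∅)).card =
    2 * (Finset.univ.filter (AllowedBlocks (κ := Fin k) P)).card + (2 ^ k - 1) * (2 ^ k) ^ n := by
  have h : (Finset.univ.filter fun X : ((Fin n → Set (Fin k)) × Set (Fin k)) ×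
        ((Fin n → Set (Fin k)) × Set (Fin 1)) =>
      AllowedBlocks P (X.1.1, X.2.1) ∧ (X.1.2.Nonempty → (∀ j, X.2.1 j = ∅) ∧ X.2.2 = ∅)) =
      ((Finset.univ.filter (AllowedBlocks (κ := Fin k) P)) ×ˢ
        (Finset.univ : Finset (Set (Fin 1)))).image
          (fun Y => ((Y.1.1, ∅), (Y.1.2, Y.2))) ∪
      (((Finset.univ : Finset (Set (Fin k))).erase ∅) ×ˢ
        (Finset.univ : Finset (Fin n → Set (Fin k)))).image
          (fun Y => ((Y.2, Y.1), (fun _ => ∅, ∅))) := by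
    ext ⟨⟨s, h⟩, ⟨t, w⟩⟩
    simp only [Finset.mem_filter, Finset.mem_univ, true_and, Finset.mem_union, Finset.mem_image,
      Finset.mem_product, and_true, Prod.exists, Prod.mk.injEq, Finset.mem_erase]
    constructor
    · rintro ⟨h1, h2⟩
      rcases Set.eq_empty_or_nonempty h with rfl | hne
      · exact .inl ⟨s, t, w, h1, ⟨rfl, rfl⟩, rfl, rfl⟩
      · obtain ⟨h3, rfl⟩ := h2 hne
        exact .inr ⟨h, s, hne.ne_empty, ⟨rfl, rfl⟩, (funext h3).symm, rfl⟩
    · rintro (⟨s, t, w, h1, ⟨rfl, rfl⟩, rfl, rfl⟩ | ⟨h, s, hne, ⟨rfl, rfl⟩, rfl, rfl⟩)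
      · exact ⟨h1, fun h => absurd h (by simp)⟩
      · exact ⟨fun i j _ _ => by simp, fun _ => ⟨fun _ => rfl, rfl⟩⟩
  rw [h, Finset.card_union_of_disjoint, Finset.card_image_of_injective,
    Finset.card_image_of_injective, Finset.card_product, Finset.card_product,
    Finset.card_erase_of_mem (Finset.mem_univ _)]
  · simp only [Finset.card_univ, Fintype.card_set, Fintype.card_fin, Fintype.card_pi,
      Finset.prod_const]
    ring
  · rintro ⟨h, s⟩ ⟨h', s'⟩ he
    simp only [Prod.mk.injEq] at he
    exact Prod.ext he.1.2 he.1.1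
  · rintro ⟨⟨s, t⟩, w⟩ ⟨⟨s', t'⟩, w'⟩ he
    simp only [Prod.mk.injEq] at he ⊢
    tauto
  · rw [Finset.disjoint_left]
    intro X hX hX'
    simp only [Finset.mem_image, Finset.mem_product, Finset.mem_erase] at hX hX'
    obtain ⟨Y, -, rfl⟩ := hX
    obtain ⟨Y', ⟨⟨h1, -⟩, -⟩, he⟩ := hX'
    simp only [Prod.mk.injEq] at he
    exact h1 he.1.2

open scoped Classical in
theorem numIndepSets_blocks {n k : ℕ} (P : Fin n → Fin n → Prop)
    (edges : List (Fin (n * k + k) × Fin (n * k + 1))) (h : ∀ e, e ∈ edges ↔ IsBlockEdge P e) :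
    BipartiteGraph.numIndepSets ⟨n * k + k, n * k + 1, edges⟩ =
      2 * (Finset.univ.filter (AllowedBlocks (κ := Fin k) P)).card + (2 ^ k - 1) * (2 ^ k) ^ n := by
  rw [← card_split_indep, BipartiteGraph.numIndepSets]
  have : {S | (BipartiteGraph.graph ⟨n * k + k, n * k + 1, edges⟩).IsIndepSet S} =
      (splitBlocks n k 1) ⁻¹' {X | AllowedBlocks P (X.1.1, X.2.1) ∧
        (X.1.2.Nonempty → (∀ j, X.2.1 j = ∅) ∧ X.2.2 = ∅)} := by
    ext S
    simp only [Set.mem_ofPred_eq, Set.mem_preimage]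
    rw [BipartiteGraph.isIndepSet_iff, ← indep_splitBlocks]
    simp only [h]
  rw [this, Set.ncard_preimage_of_injective_subset_range (splitBlocks n k 1).injective
    (by simp), ← Set.ncard_coe_finset]
  congr 1
  ext X
  simp

/-! ### Recovering the number of satisfying assignments by rounding -/

/-- If `W` is close to `(Z + 1/2) 2^N`, then a good approximation of `W` yields one of `Z`. -/
theorem approx_of_div_pow {Z Y N : ℕ} {W : ℝ} (hlo : (Z + 1 / 4 : ℝ) * 2 ^ N ≤ W)
    (hhi : W ≤ (Z + 3 / 4 : ℝ) * 2 ^ N) {ε : ℝ} (h0 : 0 < ε) (h1 : ε < 1)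
    (hY1 : Real.exp (-(ε / 2 ^ 5)) * W ≤ Y) (hY2 : (Y : ℝ) ≤ Real.exp (ε / 2 ^ 5) * W) :
    Real.exp (-ε) * Z ≤ (Y / 2 ^ N : ℕ) ∧ ((Y / 2 ^ N : ℕ) : ℝ) ≤ Real.exp ε * Z := by
  obtain ⟨δ, hδ⟩ : ∃ δ, δ = ε / 2 ^ 5 := ⟨_, rfl⟩
  rw [← hδ] at hY1 hY2
  have hε : ε = 32 * δ := by rw [hδ]; ring
  have hδ0 : 0 < δ := by rw [hδ]; positivity
  have hδ1 : δ < 1 / 32 := by rw [hε] at h1; linarith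
  have hN : (0 : ℝ) < 2 ^ N := by positivity
  have hZ : (0 : ℝ) ≤ Z := Nat.cast_nonneg _
  set out := Y / 2 ^ N with hout
  have ho1 : (out : ℝ) * 2 ^ N ≤ Y := by
    exact_mod_cast Nat.div_mul_le_self Y (2 ^ N)
  have ho2 : (Y : ℝ) < (out + 1) * 2 ^ N := by
    have := Nat.lt_mul_div_succ Y (pow_pos (zero_lt_two) N : 0 < 2 ^ N)
    rw [mul_comm] at this
    exact_mod_cast this
  have hexp1 : Real.exp δ ≤ 1 + 2 * δ := by
    have := Real.exp_bound_div_one_sub_of_interval hδ0.le (by linarith)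
    refine this.trans ?_
    rw [div_le_iff₀ (by linarith)]
    nlinarith
  have hexp2 : 1 - δ ≤ Real.exp (-δ) := Real.one_sub_le_exp_neg δ
  have hexp3 : 1 + 32 * δ ≤ Real.exp ε := by
    rw [hε]; linarith [Real.add_one_le_exp (32 * δ)]
  have hexp4 : Real.exp (-ε) * (1 + 32 * δ) ≤ 1 := by
    have : Real.exp (-ε) * Real.exp ε = 1 := by rw [← Real.exp_add]; simp
    refine le_trans ?_ this.le
    exact mul_le_mul_of_nonneg_left hexp3 (Real.exp_pos _).le
  have hyu : (out : ℝ) ≤ (1 + 2 * δ) * (Z + 3 / 4) := by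
    have : (out : ℝ) * 2 ^ N ≤ ((1 + 2 * δ) * (Z + 3 / 4)) * 2 ^ N := by
      calc (out : ℝ) * 2 ^ N ≤ Real.exp δ * W := ho1.trans hY2
        _ ≤ Real.exp δ * ((Z + 3 / 4 : ℝ) * 2 ^ N) :=
          mul_le_mul_of_nonneg_left hhi (Real.exp_pos _).le
        _ ≤ (1 + 2 * δ) * ((Z + 3 / 4 : ℝ) * 2 ^ N) := by gcongr
        _ = _ := by ring
    exact le_of_mul_le_mul_right this hN
  have hyl : (1 - δ) * (Z + 1 / 4) < out + 1 := by
    have : ((1 - δ) * (Z + 1 / 4)) * 2 ^ N < (out + 1 : ℝ) * 2 ^ N := by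
      calc ((1 - δ) * (Z + 1 / 4)) * 2 ^ N = (1 - δ) * ((Z + 1 / 4 : ℝ) * 2 ^ N) := by ring
        _ ≤ Real.exp (-δ) * ((Z + 1 / 4 : ℝ) * 2 ^ N) := by gcongr
        _ ≤ Real.exp (-δ) * W := mul_le_mul_of_nonneg_left hlo (Real.exp_pos _).le
        _ ≤ Y := hY1
        _ < _ := ho2
    exact lt_of_mul_lt_mul_right this hN.le
  constructor
  · rcases le_or_gt Z out with h | h
    · have h' : (Z : ℝ) ≤ out := by exact_mod_cast h
      refine le_trans ?_ h'
      exact mul_le_of_le_one_left hZ (Real.exp_le_one_iff.2 (by linarith))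
    · have h' : (out : ℝ) + 1 ≤ Z := by exact_mod_cast h
      -- The margin 1/4 in `hyl` absorbs the error δ unless `Z` is at least about 1/(4δ). Then
      -- losing a whole unit by rounding down is only a relative error of order δ, well within ε =
      -- 32δ.
      have h2 : 1 ≤ 5 * δ * Z := by nlinarith
      have h3 : (1 - 6 * δ) * Z ≤ out := by nlinarith
      refine le_trans ?_ h3
      have h4 : 1 ≤ (1 - 6 * δ) * (1 + 32 * δ) := by nlinarith
      have h5 : Real.exp (-ε) ≤ 1 - 6 * δ := by
        have h6 : Real.exp (-ε) * (1 + 32 * δ) ≤ (1 - 6 * δ) * (1 + 32 * δ) := hexp4.trans h4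
        exact le_of_mul_le_mul_right h6 (by linarith)
      exact mul_le_mul_of_nonneg_right h5 hZ
  · rcases le_or_gt out Z with h | h
    · have h' : (out : ℝ) ≤ Z := by exact_mod_cast h
      refine le_trans h' ?_
      exact le_mul_of_one_le_left hZ (by linarith)
    · have h' : (Z : ℝ) + 1 ≤ out := by exact_mod_cast h
      -- An output of at least `Z + 1` needs 2δ(Z + 3/4) ≥ 1/4 by `hyu`, so again `Z` is large. In
      -- particular the output is 0 when `Z = 0`.
      have h2 : (1 + 2 * δ) * (Z + 3 / 4) ≤ (1 + 32 * δ) * Z := by nlinarith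
      exact hyu.trans (h2.trans (mul_le_mul_of_nonneg_right hexp3 hZ))

-- With q = 2^k the total is 2C + (q - 1)q^(n+1), where C lies between Z(q - 1)^(n+2) and Zq^(n+2) +
-- 4^(n+1)q^(n+1). The main part is 2Zq^(n+2) + q^(n+2) = (Z + 1/2) · 2q^(n+2), and q ≥ 16^(n+1)
-- keeps the deviation below a quarter of 2q^(n+2).
open scoped Classical in
theorem numIndepSets_bounds {n k : ℕ} (hk : 4 * (n + 1) ≤ k)
    (P : Fin (n + 1) → Fin (n + 1) → Prop) (hP : ∀ x : Fin n, P x.castSucc x.castSucc)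
    (edges : List (Fin ((n + 1) * k + k) × Fin ((n + 1) * k + 1)))
    (h : ∀ e, e ∈ edges ↔ IsBlockEdge P e) :
    ((Finset.univ.filter fun σ : Fin n → Bool => Allowed P (blocksOf σ)).card + 1 / 4 : ℝ) *
        2 ^ ((n + 1) * k + k + 1) ≤
      BipartiteGraph.numIndepSets ⟨(n + 1) * k + k, (n + 1) * k + 1, edges⟩ ∧
    (BipartiteGraph.numIndepSets ⟨(n + 1) * k + k, (n + 1) * k + 1, edges⟩ : ℝ) ≤
      ((Finset.univ.filter fun σ : Fin n → Bool => Allowed P (blocksOf σ)).card + 3 / 4 : ℝ) *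
        2 ^ ((n + 1) * k + k + 1) := by
  have hC : (Finset.univ.filter (AllowedBlocks (κ := Fin k) P)).card =
      ∑ X ∈ Finset.univ.filter (Allowed P), (2 ^ k - 1) ^ (X.1.card + X.2.card) := by
    convert card_allowedBlocks (κ := Fin k) P
    simp
  rw [numIndepSets_blocks P edges h, hC]
  have hq1 : 1 ≤ 2 ^ k := Nat.one_le_two_pow
  obtain ⟨hlo, hhi⟩ := sum_allowed_bounds hP (2 ^ k) hq1
  have hZ : (Finset.univ.filter fun σ : Fin n → Bool => Allowed P (blocksOf σ)).card ≤ 2 ^ n := by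
    refine (Finset.card_le_univ _).trans (le_of_eq ?_)
    simp
  have hq : 16 ^ (n + 1) ≤ 2 ^ k := by
    calc 16 ^ (n + 1) = 2 ^ (4 * (n + 1)) := by rw [pow_mul]; norm_num
      _ ≤ 2 ^ k := Nat.pow_le_pow_right (by norm_num) hk
  have hpow : (2 : ℝ) ^ ((n + 1) * k + k + 1) = 2 * (2 ^ k) ^ (n + 2) := by
    rw [← pow_mul]; ring
  rw [hpow]
  generalize (Finset.univ.filter fun σ : Fin n → Bool => Allowed P (blocksOf σ)).card = Z at *
  generalize ∑ X ∈ Finset.univ.filter (Allowed P), (2 ^ k - 1) ^ (X.1.card + X.2.card) = C at *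
  have hcast : ((2 ^ k - 1 : ℕ) : ℝ) = 2 ^ k - 1 := by push_cast [hq1]; ring
  have hlo' : (Z : ℝ) * (2 ^ k - 1) ^ (n + 2) ≤ C := by
    rw [← hcast]; exact_mod_cast hlo
  have hhi' : (C : ℝ) ≤ Z * (2 ^ k) ^ (n + 2) + 4 ^ (n + 1) * (2 ^ k) ^ (n + 1) := by
    exact_mod_cast hhi
  have hq' : (16 : ℝ) ^ (n + 1) ≤ 2 ^ k := by exact_mod_cast hq
  have hZ' : (Z : ℝ) ≤ 2 ^ n := by exact_mod_cast hZ
  push_cast [hq1]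
  generalize (2 : ℝ) ^ k = q at *
  have hq0 : 0 < q := lt_of_lt_of_le (by positivity) hq'
  have hqn : 0 < q ^ (n + 1) := by positivity
  have e1 : q ^ (n + 2) = q * q ^ (n + 1) := by ring
  have h44 : (4 : ℝ) ^ n ≤ 16 ^ n := pow_le_pow_left₀ (by norm_num) (by norm_num) n
  have h16 : (16 : ℝ) ^ (n + 1) = 16 * 16 ^ n := by ring
  have h1n : (1 : ℝ) ≤ 16 ^ n := one_le_pow₀ (by norm_num)
  constructor
  -- Bernoulli's inequality for (1 - 1/q)^(n+2). The lower bound then needs q ≥ 4Z(n + 2) + 2, which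
  -- follows from Z ≤ 2^n and n + 2 ≤ 2^(n+1).
  · have hb : q ^ (n + 2) - (n + 2) * q ^ (n + 1) ≤ (q - 1) ^ (n + 2) := by
      have hq2 : (1 : ℝ) ≤ q := by
        refine le_trans ?_ hq'
        exact one_le_pow₀ (by norm_num)
      have := one_add_mul_le_pow (a := -(1 / q)) (by
        have : 1 / q ≤ 1 := by rw [div_le_one hq0]; exact hq2
        linarith) (n + 2)
      have h2 := mul_le_mul_of_nonneg_right this (pow_pos hq0 (n + 2)).le
      rw [← mul_pow] at h2
      have e2 : (1 + -(1 / q)) * q = q - 1 := by field_simp; ring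
      rw [e2] at h2
      refine le_trans (le_of_eq ?_) h2
      rw [e1]
      push_cast
      field_simp
      ring
    have hn : (n : ℝ) + 2 ≤ 2 ^ (n + 1) := by
      have : n + 2 ≤ 2 ^ (n + 1) := Nat.lt_two_pow_self (n := n + 1)
      exact_mod_cast this
    have hzn : (Z : ℝ) * (n + 2) ≤ 2 * 4 ^ n := by
      calc (Z : ℝ) * (n + 2) ≤ 2 ^ n * 2 ^ (n + 1) := by gcongr
        _ = 2 * 4 ^ n := by rw [show (4 : ℝ) = 2 * 2 by norm_num, mul_pow]; ring
    have hfin : (4 * (Z * (n + 2)) + 2) * q ^ (n + 1) ≤ q * q ^ (n + 1) := by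
      gcongr
      nlinarith
    have hc : (Z : ℝ) * (q ^ (n + 2) - (n + 2) * q ^ (n + 1)) ≤ C :=
      (mul_le_mul_of_nonneg_left hb (Nat.cast_nonneg _)).trans hlo'
    rw [e1] at hc ⊢
    nlinarith
  · have h4 : (4 * 4 ^ (n + 1)) * q ^ (n + 1) ≤ q * q ^ (n + 1) := by
      gcongr
      rw [pow_succ]
      nlinarith
    rw [e1] at hhi' ⊢
    nlinarith

/-! ### Rules for the strings emitted by generators -/

namespace Gen

variable [DecidableEq R]

/-- With counters `ρ`, the generator works properly and writes `l`. -/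
def Emits (g : Gen R) (ρ : R → ℕ) (l : List Bool) : Prop := g.OK ρ ∧ g.str ρ = l

theorem emits_nil (ρ : R → ℕ) : (nil : Gen R).Emits ρ [] := ⟨trivial, rfl⟩

theorem emits_bit (b : Bool) (ρ : R → ℕ) : (bit b : Gen R).Emits ρ [b] := ⟨trivial, rfl⟩

theorem Emits.seq {g h : Gen R} {ρ : R → ℕ} {l m : List Bool} (hg : g.Emits ρ l)
    (hh : h.Emits ρ m) : (g.seq h).Emits ρ (l ++ m) :=
  ⟨⟨hg.1, hh.1⟩, by rw [str, hg.2, hh.2]⟩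

theorem Emits.loop {g : Gen R} {r i : R} {ρ : R → ℕ} {l : ℕ → List Bool} (hri : r ≠ i)
    (hi : ρ i = 0) (h : ∀ j < ρ r, g.Emits (loopEnv ρ r i j) (l j)) :
    (Gen.loop r i g).Emits ρ ((List.range (ρ r)).flatMap l) := by
  refine ⟨⟨hri, hi, fun j hj => (h j hj).1⟩, ?_⟩
  rw [str, List.flatMap_def, List.flatMap_def]
  congr 1
  exact List.map_congr_left fun j hj => (h j (List.mem_range.1 hj)).2

theorem flatMap_range_replicate (n m : ℕ) :
    ((List.range n).flatMap fun _ => List.replicate m true) = List.replicate (n * m) true := by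
  induction n with
  | zero => simp
  | succ n ih => rw [List.range_succ, List.flatMap_append, ih]; simp [add_mul]

/-- Repeat a string of ones. -/
theorem Emits.loop_ones {g : Gen R} {r i : R} {ρ : R → ℕ} {m : ℕ} (hri : r ≠ i)
    (hi : ρ i = 0) (h : ∀ j < ρ r, g.Emits (loopEnv ρ r i j) (List.replicate m true)) :
    (Gen.loop r i g).Emits ρ (List.replicate (ρ r * m) true) := by
  rw [← flatMap_range_replicate]
  exact Emits.loop hri hi h

theorem Emits.seq_ones {g h : Gen R} {ρ : R → ℕ} {a b : ℕ}
    (hg : g.Emits ρ (List.replicate a true)) (hh : h.Emits ρ (List.replicate b true)) :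
    (g.seq h).Emits ρ (List.replicate (a + b) true) := by
  rw [List.replicate_add]
  exact hg.seq hh

theorem Emits.unary {g : Gen R} {ρ : R → ℕ} {a : ℕ} (hg : g.Emits ρ (List.replicate a true)) :
    (g.seq (bit false)).Emits ρ (unary a) :=
  hg.seq (emits_bit false ρ)

/-- The constant string of `m` ones. -/
def ones (m : ℕ) : Gen R := (fun g => (bit true).seq g)^[m] nil

theorem emits_ones (m : ℕ) (ρ : R → ℕ) : (ones m : Gen R).Emits ρ (List.replicate m true) := by
  induction m with
  | zero => exact emits_nil ρ
  | succ m ih =>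
    rw [ones, Function.iterate_succ_apply', List.replicate_succ]
    exact (emits_bit true ρ).seq ih

theorem emits_rep {r i : R} {ρ : R → ℕ} (hri : r ≠ i) (hi : ρ i = 0) :
    (loop r i (bit true)).Emits ρ (List.replicate (ρ r) true) := by
  have := Emits.loop_ones (g := bit true) (m := 1) hri hi fun j _ => emits_bit true _
  rwa [mul_one] at this

/-- A list of generators, run one after the other. -/
def concat (L : List (Gen R)) : Gen R := L.foldr seq nil

theorem emits_concat {α : Type*} (L : List α) (g : α → Gen R) (l : α → List Bool) (ρ : R → ℕ)
    (h : ∀ a ∈ L, (g a).Emits ρ (l a)) : (concat (L.map g)).Emits ρ (L.flatMap l) := by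
  induction L with
  | nil => exact emits_nil ρ
  | cons a L ih =>
    rw [List.flatMap_cons]
    exact (h a (by simp)).seq (ih fun b hb => h b (by simp [hb]))

end Gen

namespace Frag

variable [DecidableEq R]

/-- Read unary numerals into the given counters. -/
def readAll : List R → Frag R
  | [] => skip
  | r :: L => (readUnary [r]).seq (readAll L)

theorem runs_readAll {B : ℕ} (L : List (R × ℕ)) (hL : ∀ p ∈ L, p.2 ≤ B) (rest : List Bool)
    (c : Core) (ρ : R → ℕ) (hc : c.inp = (L.flatMap fun p => unary p.2) ++ rest) :
    (readAll (L.map Prod.fst)).Runs (c.stk ρ)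
      ({ c with inp := rest }.stk fun q => ρ q + (L.map fun p : R × ℕ => if p.1 = q then p.2 else 0).sum)
      (L.length * (2 * B + 1)) := by
  induction L generalizing c ρ with
  | nil =>
    obtain ⟨inp, num, den, out, dnum, dden, val⟩ := c
    dsimp only at hc
    subst hc
    simpa [readAll] using runs_skip (W := R) _
  | cons p L ih =>
    have h1 := runs_readUnary [p.1] p.2 ((L.flatMap fun p => unary p.2) ++ rest) c ρ (by simp [hc])
    have h2 := ih (fun p hp => hL p (by simp [hp]))
      { c with inp := (L.flatMap fun p => unary p.2) ++ rest }
      (fun r => ρ r + p.2 * [p.1].count r) rfl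
    have e : (fun q => ρ q + ((p :: L).map fun p => if p.1 = q then p.2 else 0).sum) =
        fun q => (fun r => ρ r + p.2 * [p.1].count r) q +
          (L.map fun p => if p.1 = q then p.2 else 0).sum := by
      funext q
      by_cases hq : p.1 = q
      · simp [hq]; omega
      · simp [hq]
    rw [e]
    refine (h1.seq h2).mono ?_
    have := hL p (by simp)
    simp only [List.length_cons, List.length_nil]
    nlinarith

/-- Set the given counters to zero. -/
def clearAll : List R → Frag R
  | [] => skip
  | r :: L => (clear r).seq (clearAll L)

theorem runs_clearAll {B : ℕ} (L : List R) (c : Core) (ρ : R → ℕ) (hρ : ∀ r, ρ r ≤ B) :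
    (clearAll L).Runs (c.stk ρ) (c.stk fun q => if q ∈ L then 0 else ρ q)
      (L.length * (B + 1)) := by
  induction L generalizing ρ with
  | nil => simpa [clearAll] using runs_skip (W := R) _
  | cons r L ih =>
    have h2 := ih (Function.update ρ r 0) (fun q => by
      rw [Function.update_apply]; split_ifs <;> simp [hρ])
    have e : (fun q => if q ∈ r :: L then 0 else ρ q) =
        fun q => if q ∈ L then 0 else Function.update ρ r 0 q := by
      funext q
      by_cases h1 : q = r
      · simp [h1]
      · simp [h1]
    rw [e]
    refine ((runs_clear r c ρ).seq h2).mono ?_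
    have := hρ r
    simp only [List.length_cons]
    nlinarith

end Frag

/-! ### Writing a blown-up bipartite graph -/

/-- The counters used for writing a blown-up graph, apart from those for the current constraint:
the number of variables (twice), the block size (three times), and auxiliary ones. -/
inductive BlockReg (V : Type)
  | n | n' | k | a | b | s | s₁ | s₂ | s₃ | s₄
  | scope (v : V)
deriving DecidableEq

instance {V : Type} [Finite V] : Finite (BlockReg V) := by
  refine Finite.of_injective (β := Option V × Fin 11) (fun
    | .n => (none, 0) | .n' => (none, 1) | .k => (none, 2) | .a => (none, 3) | .b => (none, 4)
    | .s => (none, 5) | .s₁ => (none, 6) | .s₂ => (none, 7) | .s₃ => (none, 8)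
    | .s₄ => (none, 9) | .scope v => (some v, 10)) ?_
  intro r r' h
  cases r <;> cases r' <;> simp_all

section BlockGen

variable {V : Type} [DecidableEq V]

/-- The counters: `n` variables, block size `k`, and `w` for the current constraint. -/
def blockEnv (n k : ℕ) (w : V → ℕ) : BlockReg V → ℕ
  | .n => n
  | .n' => n
  | .k => k
  | .a => k
  | .b => k
  | .s | .s₁ | .s₂ | .s₃ | .s₄ => 0
  | .scope v => w v

/-- The counters that may contain the number of a block. -/
def IsBlockIndex (r : BlockReg V) : Prop := r = .n ∨ r = .n' ∨ ∃ v, r = .scope v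

open Gen in
/-- Writes `ρ r * ρ k` ones. -/
def blockStart (r : BlockReg V) : Gen (BlockReg V) :=
  loop r .s₁ (loop .k .s (bit true))

open Gen in
/-- Writes the number of a vertex of block `ρ r`. -/
def vertexGen (r x : BlockReg V) : Gen (BlockReg V) :=
  ((blockStart r).seq (loop x .s (bit true))).seq (bit false)

theorem emits_blockStart {r : BlockReg V} (hr : IsBlockIndex r) {ρ : BlockReg V → ℕ}
    (h0 : ρ .s = 0) (h1 : ρ .s₁ = 0) :
    (blockStart r).Emits ρ (List.replicate (ρ r * ρ .k) true) := by
  refine Gen.Emits.loop_ones ?_ h1 fun j _ => ?_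
  · rcases hr with rfl | rfl | ⟨v, rfl⟩ <;> simp
  · have := Gen.emits_rep (r := (.k : BlockReg V)) (i := .s)
      (ρ := Gen.loopEnv ρ r .s₁ j) (by simp) (by
        rcases hr with rfl | rfl | ⟨v, rfl⟩ <;> simp [Gen.loopEnv, h0])
    convert this using 2
    rcases hr with rfl | rfl | ⟨v, rfl⟩ <;> simp [Gen.loopEnv]

theorem emits_vertexGen {r x : BlockReg V} (hr : IsBlockIndex r) (hx : x ≠ .s)
    {ρ : BlockReg V → ℕ} (h0 : ρ .s = 0) (h1 : ρ .s₁ = 0) :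
    (vertexGen r x).Emits ρ (unary (ρ r * ρ .k + ρ x)) :=
  ((emits_blockStart hr h0 h1).seq_ones (Gen.emits_rep hx h0)).unary

/-- The code of an edge. -/
def edgeCode (e : ℕ × ℕ) : List Bool := unary e.1 ++ unary e.2

/-- The complete bipartite graph between two blocks. -/
def blockList (k i j : ℕ) : List (ℕ × ℕ) :=
  (List.range k).flatMap fun a => (List.range k).map fun b => (i * k + a, j * k + b)

-- A counter that drives a loop holds the current index inside it. The two offsets therefore run
-- over the copies `a` and `b` of the block size, while `k` keeps its value for computing the block
-- starts.
open Gen in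
def blockGen (r r' : BlockReg V) : Gen (BlockReg V) :=
  loop .a .s₂ (loop .b .s₃
    ((vertexGen r .a).seq (vertexGen r' .b)))

theorem emits_blockGen {r r' : BlockReg V} (hr : IsBlockIndex r) (hr' : IsBlockIndex r')
    {ρ : BlockReg V → ℕ} {k : ℕ} (hk : ρ .k = k) (ha : ρ .a = k)
    (hb : ρ .b = k) (h0 : ρ .s = 0) (h1 : ρ .s₁ = 0)
    (h2 : ρ .s₂ = 0) (h3 : ρ .s₃ = 0) :
    (blockGen r r').Emits ρ ((blockList k (ρ r) (ρ r')).flatMap edgeCode) := by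
  rw [blockList, List.flatMap_assoc]
  conv => arg 3; rw [← ha]
  refine Gen.Emits.loop (by simp) h2 fun i _ => ?_
  rw [List.flatMap_map]
  have e : Gen.loopEnv ρ .a .s₂ i .b = ρ .a := by
    simp [Gen.loopEnv, ha, hb]
  rw [← e]
  refine Gen.Emits.loop (by simp) (by simp [Gen.loopEnv, h3])
    fun j _ => ?_
  rw [edgeCode]
  refine Gen.Emits.seq ?_ ?_
  · convert emits_vertexGen hr (x := .a) (by simp) (ρ := Gen.loopEnv _ _ _ _) ?_ ?_ using 2
    · rcases hr with rfl | rfl | ⟨v, rfl⟩ <;> simp [Gen.loopEnv, hk, ha, hb]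
    · simp [Gen.loopEnv, h0]
    · simp [Gen.loopEnv, h1]
  · convert emits_vertexGen hr' (x := .b) (by simp) (ρ := Gen.loopEnv _ _ _ _) ?_ ?_ using 2
    · rcases hr' with rfl | rfl | ⟨v, rfl⟩ <;> simp [Gen.loopEnv, hk, ha, hb]
    · simp [Gen.loopEnv, h0]
    · simp [Gen.loopEnv, h1]

open Gen in
/-- Writes the number of a vertex of the additional left block. -/
def extraGen : Gen (BlockReg V) :=
  (((blockStart .n).seq (loop .k .s (bit true))).seq
    (loop .a .s (bit true))).seq (bit false)

open Gen in
/-- Writes the number of the additional right vertex. -/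
def extraRightGen : Gen (BlockReg V) :=
  ((blockStart .n).seq (loop .k .s (bit true))).seq (bit false)

theorem emits_extraGen {ρ : BlockReg V → ℕ} (h0 : ρ .s = 0) (h1 : ρ .s₁ = 0) :
    (extraGen (V := V)).Emits ρ
      (unary (ρ .n * ρ .k + ρ .k + ρ .a)) :=
  (((emits_blockStart (.inl rfl) h0 h1).seq_ones (Gen.emits_rep (by simp) h0)).seq_ones
    (Gen.emits_rep (by simp) h0)).unary

theorem emits_extraRightGen {ρ : BlockReg V → ℕ} (h0 : ρ .s = 0)
    (h1 : ρ .s₁ = 0) :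
    (extraRightGen (V := V)).Emits ρ (unary (ρ .n * ρ .k + ρ .k)) :=
  ((emits_blockStart (.inl rfl) h0 h1).seq_ones (Gen.emits_rep (by simp) h0)).unary

/-- The edges at the additional left block. -/
def extraList (n k : ℕ) : List (ℕ × ℕ) :=
  (List.range k).flatMap fun a =>
    ((List.range n).flatMap fun j => (List.range k).map fun b => (n * k + k + a, j * k + b)) ++
      (((List.range k).map fun b => (n * k + k + a, n * k + b)) ++ [(n * k + k + a, n * k + k)])

-- The block index runs over the copy `n'`, as `n` is needed for the left vertex. The last two
-- pieces are the right constant block, whose index is `n` itself, and the additional right vertex.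
open Gen in
def extraEdgesGen : Gen (BlockReg V) :=
  loop .a .s₂
    ((loop .n' .s₄ (loop .b .s₃
      (extraGen.seq (vertexGen .n' .b)))).seq
    ((loop .b .s₃ (extraGen.seq (vertexGen .n .b))).seq
      (extraGen.seq extraRightGen)))

theorem emits_extraEdgesGen (n k : ℕ) (w : V → ℕ) :
    (extraEdgesGen (V := V)).Emits (blockEnv n k w) ((extraList n k).flatMap edgeCode) := by
  rw [extraList, List.flatMap_assoc]
  refine Gen.Emits.loop (R := BlockReg V) (r := .a) (by simp) rfl fun i hi => ?_
  rw [List.flatMap_append, List.flatMap_append, List.flatMap_assoc, List.flatMap_map]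
  refine Gen.Emits.seq ?_ (Gen.Emits.seq ?_ ?_)
  · refine Gen.Emits.loop (R := BlockReg V) (r := .n') (by simp) rfl fun j hj => ?_
    rw [List.flatMap_map]
    refine Gen.Emits.loop (R := BlockReg V) (r := .b) (by simp) rfl fun b hb => ?_
    exact (emits_extraGen rfl rfl).seq (emits_vertexGen (.inr (.inl rfl)) (by simp) rfl rfl)
  · refine Gen.Emits.loop (R := BlockReg V) (r := .b) (by simp) rfl fun b hb => ?_
    exact (emits_extraGen rfl rfl).seq (emits_vertexGen (.inl rfl) (by simp) rfl rfl)
  · rw [List.flatMap_singleton]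
    exact (emits_extraGen rfl rfl).seq (emits_extraRightGen rfl rfl)

open Gen in
/-- Writes the two numbers of vertices, the edges at the additional block, and the complete
bipartite graphs between the two blocks of each variable. -/
def graphHeadGen : Gen (BlockReg V) :=
  extraGen.seq ((((((blockStart .n).seq (loop .k .s (bit true))).seq
    (bit true))).seq (bit false)).seq (extraEdgesGen.seq
      (loop .n .s₄ (blockGen .n .n))))

theorem emits_graphHeadGen (n k : ℕ) (w : V → ℕ) :
    (graphHeadGen (V := V)).Emits (blockEnv n k w)
      (unary (n * k + k + k) ++ (unary (n * k + k + 1) ++ ((extraList n k).flatMap edgeCode ++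
        (((List.range n).flatMap fun i => blockList k i i).flatMap edgeCode)))) := by
  -- Outside the loops `a` holds `k`, so `extraGen` writes the number just after the last left
  -- vertex, which is the number of left vertices.
  refine (emits_extraGen rfl rfl).seq (Gen.Emits.seq ?_ ((emits_extraEdgesGen n k w).seq ?_))
  · exact Gen.Emits.unary (((emits_blockStart (.inl rfl) rfl rfl).seq_ones
      (Gen.emits_rep (by simp) rfl)).seq_ones (b := 1) (Gen.emits_bit true _))
  · rw [List.flatMap_assoc]
    refine Gen.Emits.loop (R := BlockReg V) (r := .n) (by simp) rfl fun i hi => ?_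
    exact emits_blockGen (.inl rfl) (.inl rfl) rfl rfl rfl rfl rfl rfl rfl

end BlockGen

/-! ### The reduction to `#BIS` -/

theorem exists_fin_edges {m n : ℕ} (l : List (ℕ × ℕ)) (h : ∀ e ∈ l, e.1 < m ∧ e.2 < n) :
    ∃ l' : List (Fin m × Fin n), (∀ e, e ∈ l' ↔ ((e.1 : ℕ), (e.2 : ℕ)) ∈ l) ∧
      (l'.flatMap fun e => unary e.1 ++ unary e.2) = l.flatMap edgeCode := by
  induction l with
  | nil => exact ⟨[], by simp, rfl⟩
  | cons a l ih =>
    obtain ⟨l', h1, h2⟩ := ih fun e he => h e (by simp [he])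
    obtain ⟨ha1, ha2⟩ := h a (by simp)
    refine ⟨(⟨a.1, ha1⟩, ⟨a.2, ha2⟩) :: l', fun e => ?_, ?_⟩
    · simp only [List.mem_cons, h1, Prod.ext_iff, Fin.ext_iff]
    · rw [List.flatMap_cons, List.flatMap_cons, h2]
      rfl

theorem mem_blockList {k i j x y : ℕ} :
    (x, y) ∈ blockList k i j ↔ ∃ a b : Fin k, x = i * k + a ∧ y = j * k + b := by
  simp only [blockList, List.mem_flatMap, List.mem_range, List.mem_map, Prod.mk.injEq]
  constructor
  · rintro ⟨a, ha, b, hb, rfl, rfl⟩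
    exact ⟨⟨a, ha⟩, ⟨b, hb⟩, rfl, rfl⟩
  · rintro ⟨a, b, rfl, rfl⟩
    exact ⟨a, a.2, b, b.2, rfl, rfl⟩

theorem mem_extraList {n k x y : ℕ} :
    (x, y) ∈ extraList n k ↔
      (n + 1) * k ≤ x ∧ x < (n + 1) * k + k ∧ y < (n + 1) * k + 1 := by
  have e : (n + 1) * k = n * k + k := by ring
  simp only [extraList, List.mem_flatMap, List.mem_range, List.mem_append, List.mem_map,
    Prod.mk.injEq, List.mem_singleton, e]
  constructor
  · rintro ⟨a, ha, ⟨j, hj, b, hb, rfl, rfl⟩ | ⟨b, hb, rfl, rfl⟩ | ⟨rfl, rfl⟩⟩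
    · have : j * k + k ≤ n * k := by
        calc j * k + k = (j + 1) * k := by ring
          _ ≤ n * k := Nat.mul_le_mul_right k hj
      omega
    · omega
    · omega
  · rintro ⟨h1, h2, h3⟩
    refine ⟨x - (n * k + k), by omega, ?_⟩
    have hx : n * k + k + (x - (n * k + k)) = x := by omega
    rw [hx]
    rcases lt_or_ge y (n * k) with hy | hy
    · have hk : 0 < k := by
        rcases Nat.eq_zero_or_pos k with rfl | hk
        · simp at hy
        · exact hk
      refine .inl ⟨y / k, (Nat.div_lt_iff_lt_mul hk).2 hy, y % k, Nat.mod_lt _ hk, rfl, ?_⟩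
      rw [mul_comm]
      exact Nat.div_add_mod y k
    · rcases lt_or_ge y (n * k + k) with hy' | hy'
      · exact .inr (.inl ⟨y - n * k, by omega, rfl, by omega⟩)
      · exact .inr (.inr ⟨rfl, by omega⟩)

section ToBIS

variable {Γ : Finset BoolRel}

/-- The pair of blocks that may not both be used, by a clause. -/
def clausePair {r n : ℕ} (u : Fin r → Fin n) : IMClause r → Fin (n + 1) × Fin (n + 1)
  | .pin i true => (Fin.last n, (u i).castSucc)
  | .pin i false => ((u i).castSucc, Fin.last n)
  | .imp i j => ((u i).castSucc, (u j).castSucc)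

/-- Under an assignment, a left block is used iff its variable is true, a right block iff its
variable is false, and both constant blocks are used. The forbidden pair of a clause is thus exactly
its falsifying pattern. -/
theorem clausePair_blocksOf {r n : ℕ} (u : Fin r → Fin n) (κ : IMClause r) (σ : Fin n → Bool) :
    ¬ ((clausePair u κ).1 ∈ (blocksOf σ).1 ∧ (clausePair u κ).2 ∈ (blocksOf σ).2) ↔
      κ.Holds fun i => σ (u i) := by
  rcases κ with ⟨i, _ | _⟩ | ⟨i, j⟩ <;>
    simp [clausePair, blocksOf, IMClause.Holds]

variable (φ : (R : Γ) → List (IMClause R.1.1))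

/-- The pairs of blocks that may not both be used, by the constraints. -/
def constraintPairs {n : ℕ} (c : Constraint Γ n) : List (Fin (n + 1) × Fin (n + 1)) :=
  (φ c.1).map (clausePair c.2)

/-- The relation between blocks that belongs to a list of constraints. -/
def blockRel {n : ℕ} (l : List (Constraint Γ n)) (i j : Fin (n + 1)) : Prop :=
  (∃ x : Fin n, i = x.castSucc ∧ j = x.castSucc) ∨ ∃ c ∈ l, (i, j) ∈ constraintPairs φ c

variable {φ} in
theorem allowed_blocksOf_iff (hφ : ∀ (R : Γ) a, a ∈ R.1.2 ↔ ∀ κ ∈ φ R, κ.Holds a)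
    (I : CSPInstance Γ) (σ : Fin I.n → Bool) :
    Allowed (blockRel φ I.cons) (blocksOf σ) ↔ I.Satisfies σ := by
  constructor
  · intro h c hc
    rw [hφ]
    intro κ hκ
    rw [← clausePair_blocksOf]
    rintro ⟨h1, h2⟩
    exact h _ h1 _ h2 (.inr ⟨c, hc, List.mem_map.2 ⟨κ, hκ, rfl⟩⟩)
  · rintro h i hi j hj (⟨x, rfl, rfl⟩ | ⟨c, hc, hm⟩)
    · simp [blocksOf] at hi hj
      simp [hi] at hj
    · obtain ⟨κ, hκ, he⟩ := List.mem_map.1 hm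
      refine (clausePair_blocksOf c.2 κ σ).2 ((hφ _ _).1 (h c hc) κ hκ) ?_
      rw [he]
      exact ⟨hi, hj⟩

/-- The counters for the scope of the current constraint. -/
abbrev ScopeReg (Γ : Finset BoolRel) := Σ R : Γ, Fin R.1.1

noncomputable instance : DecidableEq (ScopeReg Γ) := Classical.decEq _

/-- Writes the complete bipartite graph that belongs to a clause. -/
def clauseGen (R : Γ) : IMClause R.1.1 → Gen (BlockReg (ScopeReg Γ))
  | .pin i true => blockGen .n (.scope ⟨R, i⟩)
  | .pin i false => blockGen (.scope ⟨R, i⟩) .n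
  | .imp i j => blockGen (.scope ⟨R, i⟩) (.scope ⟨R, j⟩)

def constraintGen (R : Γ) : Gen (BlockReg (ScopeReg Γ)) := Gen.concat ((φ R).map (clauseGen R))

/-- The edges that belong to a constraint. -/
def constraintList (k : ℕ) {n : ℕ} (c : Constraint Γ n) : List (ℕ × ℕ) :=
  (constraintPairs φ c).flatMap fun p => blockList k p.1 p.2

theorem emits_constraintGen {n : ℕ} (k : ℕ) (c : Constraint Γ n) {w : ScopeReg Γ → ℕ}
    (hw : ∀ i, w ⟨c.1, i⟩ = c.2 i) :
    (constraintGen φ c.1).Emits (blockEnv n k w) ((constraintList φ k c).flatMap edgeCode) := by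
  rw [constraintList, constraintPairs, List.flatMap_map, List.flatMap_assoc]
  refine Gen.emits_concat _ _ _ _ fun κ _ => ?_
  rcases κ with ⟨i, _ | _⟩ | ⟨i, j⟩
  · have := emits_blockGen (r := (.scope ⟨c.1, i⟩ : BlockReg (ScopeReg Γ))) (r' := .n)
      (.inr (.inr ⟨_, rfl⟩)) (.inl rfl) (ρ := blockEnv n k w) rfl rfl rfl rfl rfl rfl rfl
    rw [show blockEnv n k w (.scope ⟨c.1, i⟩) = c.2 i from hw i] at this
    exact this
  · have := emits_blockGen (r' := (.scope ⟨c.1, i⟩ : BlockReg (ScopeReg Γ))) (r := .n)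
      (.inl rfl) (.inr (.inr ⟨_, rfl⟩)) (ρ := blockEnv n k w) rfl rfl rfl rfl rfl rfl rfl
    rw [show blockEnv n k w (.scope ⟨c.1, i⟩) = c.2 i from hw i] at this
    exact this
  · have := emits_blockGen (r := (.scope ⟨c.1, i⟩ : BlockReg (ScopeReg Γ))) (r' := .scope ⟨c.1, j⟩)
      (.inr (.inr ⟨_, rfl⟩)) (.inr (.inr ⟨_, rfl⟩)) (ρ := blockEnv n k w)
      rfl rfl rfl rfl rfl rfl rfl
    rw [show blockEnv n k w (.scope ⟨c.1, i⟩) = c.2 i from hw i,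
      show blockEnv n k w (.scope ⟨c.1, j⟩) = c.2 j from hw j] at this
    exact this

/-- The counters for the scope of a constraint with relation `R`. -/
def scopeRegs (R : Γ) : List (BlockReg (ScopeReg Γ)) := List.ofFn fun i => .scope ⟨R, i⟩

/-- Read and handle the scope of a constraint with relation `R`. -/
def scopeFrag (R : Γ) : Frag (BlockReg (ScopeReg Γ)) :=
  (Frag.readAll (scopeRegs R)).seq
    ((constraintGen φ R).write.seq (Frag.clearAll (scopeRegs R)))

def scopeCost (R : Γ) (B : ℕ) : ℕ :=
  R.1.1 * (2 * B + 1) + ((constraintGen φ R).cost B + R.1.1 * (B + 1))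

/-- Each coordinate of each relation has its own counter. The counters are zero between constraints,
so reading, which adds, sets the right values, and clearing them afterwards restores this state. -/
theorem runs_scopeFrag {n k B : ℕ} (c : Constraint Γ n) (hn : n ≤ B) (hk : k ≤ B)
    (rest : List Bool) (C : Core)
    (hC : C.inp = ((List.ofFn c.2).flatMap fun v : Fin n => unary v) ++ rest) :
    (scopeFrag φ c.1).Runs (C.stk (blockEnv n k fun _ => 0))
      ({ C with inp := rest, out := (constraintList φ k c).flatMap edgeCode ++ C.out }.stk
        (blockEnv n k fun _ => 0)) (scopeCost φ c.1 B) := by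
  have h1 := Frag.runs_readAll (B := B)
    (List.ofFn fun i => ((.scope ⟨c.1, i⟩ : BlockReg (ScopeReg Γ)), (c.2 i : ℕ)))
    (by
      intro p hp
      obtain ⟨i, rfl⟩ := List.mem_ofFn.1 hp
      exact (c.2 i).2.le.trans hn)
    rest C (blockEnv n k fun _ => 0) (by
      rw [hC]
      congr 1
      rw [List.flatMap_def, List.flatMap_def, List.map_ofFn, List.map_ofFn]
      rfl)
  rw [List.map_ofFn] at h1
  have hρ : (fun q => blockEnv n k (fun _ => 0) q +
      ((List.ofFn fun i => ((.scope ⟨c.1, i⟩ : BlockReg (ScopeReg Γ)), (c.2 i : ℕ))).map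
        fun p : (BlockReg (ScopeReg Γ)) × ℕ => if p.1 = q then p.2 else 0).sum) =
      blockEnv n k fun v => if h : v.1 = c.1 then c.2 (h ▸ v.2) else 0 := by
    funext q
    rw [List.map_ofFn, List.sum_ofFn]
    cases q with
    | scope v =>
      obtain ⟨R, i⟩ := v
      simp only [blockEnv, Function.comp, BlockReg.scope.injEq, zero_add]
      by_cases h : R = c.1
      · subst h
        simp
      · rw [dif_neg h]
        refine Finset.sum_eq_zero fun j _ => if_neg fun he => h ?_
        exact (congrArg Sigma.fst he).symm
    | _ => simp [blockEnv]
  rw [hρ] at h1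
  have hem := emits_constraintGen φ k c
    (w := fun v => if h : v.1 = c.1 then c.2 (h ▸ v.2) else 0) (by intro i; simp)
  have hB : ∀ r, blockEnv n k (fun v : ScopeReg Γ => if h : v.1 = c.1 then
      (c.2 (h ▸ v.2) : ℕ) else 0) r ≤ B := by
    intro r
    cases r with
    | scope v =>
      simp only [blockEnv]
      split_ifs
      · exact (Fin.is_lt _).le.trans hn
      · exact Nat.zero_le _
    | _ => simp [blockEnv, hn, hk]
  have h2 := (constraintGen φ c.1).runs_write { C with inp := rest } hem.1 hB
  rw [hem.2] at h2
  have h3 := Frag.runs_clearAll (scopeRegs c.1)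
    { C with inp := rest, out := (constraintList φ k c).flatMap edgeCode ++ C.out } _ hB
  have hρ' : (fun q : BlockReg (ScopeReg Γ) => if q ∈ scopeRegs c.1 then 0
      else blockEnv n k (fun v : ScopeReg Γ => if h : v.1 = c.1 then
        (c.2 (h ▸ v.2) : ℕ) else 0) q) = blockEnv n k fun _ => 0 := by
    funext q
    cases q with
    | scope v =>
      obtain ⟨R, i⟩ := v
      by_cases h : R = c.1
      · subst h
        simp [blockEnv, scopeRegs]
      · split_ifs
        · rfl
        · simp [blockEnv, h]
    | _ => simp [blockEnv, scopeRegs]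
  rw [hρ'] at h3
  refine (h1.seq (h2.seq h3)).mono ?_
  simp [scopeCost, scopeRegs]

/-- Read and handle a constraint. -/
noncomputable def constraintFrag : Frag (BlockReg (ScopeReg Γ)) :=
  Frag.decode Γ.card fun j =>
    if h : j < Γ.card then scopeFrag φ (Γ.equivFin.symm ⟨j, h⟩) else .skip

noncomputable def constraintCost (B : ℕ) : ℕ := (∑ R : Γ, scopeCost φ R B) + Γ.card

theorem runs_constraintFrag {n k B : ℕ} (c : Constraint Γ n) (hn : n ≤ B) (hk : k ≤ B)
    (rest : List Bool) (C : Core) (hC : C.inp = c.encode ++ rest) :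
    (constraintFrag φ).Runs (C.stk (blockEnv n k fun _ => 0))
      ({ C with inp := rest, out := (constraintList φ k c).flatMap edgeCode ++ C.out }.stk
        (blockEnv n k fun _ => 0)) (constraintCost φ B) := by
  rw [Constraint.encode, List.append_assoc] at hC
  refine Frag.runs_decode _ _ (Γ.equivFin c.1) (Fin.is_lt _) _ _ _ hC ?_
  rw [dif_pos (Fin.is_lt _)]
  simp only [Fin.eta, Equiv.symm_apply_apply]
  refine (runs_scopeFrag φ c hn hk rest _ rfl).mono ?_
  exact Finset.single_le_sum (f := fun R => scopeCost φ R B) (fun _ _ => Nat.zero_le _)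
    (Finset.mem_univ c.1)

/-- The fragment that writes the graph for a CSP instance. -/
noncomputable def toBISFrag : Frag (BlockReg (ScopeReg Γ)) :=
  (Frag.measure [.k, .k, .k, .k, .a, .a, .a, .a,
    .b, .b, .b, .b]).seq
  ((Frag.readUnary [.n, .n']).seq
    ((Frag.records (constraintFrag φ)).seq graphHeadGen.write))

noncomputable def toBISCost (l : ℕ) : ℕ :=
  (l * 16 + 2) + ((l * 3 + 1) + ((l * (constraintCost φ (4 * l) + 2) + 1) +
    (graphHeadGen (V := ScopeReg Γ)).cost (4 * l)))

theorem polyBdd_toBISCost : PolyBdd (toBISCost φ) := by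
  have h4 : PolyBdd fun l => 4 * l := (PolyBdd.const 4).mul .id
  have hs : ∀ R : Γ, PolyBdd (scopeCost φ R) := fun R =>
    ((PolyBdd.const _).mul (((PolyBdd.const 2).mul .id).add (.const 1))).add
      ((Gen.polyBdd_cost _).add ((PolyBdd.const _).mul (PolyBdd.id.add (.const 1))))
  have hc : PolyBdd (constraintCost φ) := (PolyBdd.sum _ hs).add (.const _)
  exact ((PolyBdd.id.mul (.const 16)).add (.const 2)).add
    (((PolyBdd.id.mul (.const 3)).add (.const 1)).add
      (((PolyBdd.id.mul ((hc.comp h4).add (.const 2))).add (.const 1)).add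
        ((Gen.polyBdd_cost _).comp h4)))

/-- The edges of the graph for a CSP instance. -/
def graphList (k : ℕ) (I : CSPInstance Γ) : List (ℕ × ℕ) :=
  extraList I.n k ++ (((List.range I.n).flatMap fun i => blockList k i i) ++
    I.cons.reverse.flatMap (constraintList φ k))

theorem length_le_length_flatMap {α β : Type*} (e : α → List β) (he : ∀ a, e a ≠ [])
    (l : List α) : l.length ≤ (l.flatMap e).length := by
  induction l with
  | nil => simp
  | cons a l ih =>
    have := List.length_pos_of_ne_nil (he a)
    simp only [List.flatMap_cons, List.length_append, List.length_cons]
    omega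

theorem Constraint.encode_ne_nil {n : ℕ} (c : Constraint Γ n) : c.encode ≠ [] := by
  simp [Constraint.encode, unary]

theorem runs_toBISFrag (I : CSPInstance Γ) (num den : List Bool) :
    (toBISFrag φ).Runs (Core.stk ⟨I.encode, num, den, [], [], [], []⟩ fun _ => 0)
      (Core.stk ⟨[], num, den, unary (I.n * (4 * I.encode.length) + 4 * I.encode.length +
        4 * I.encode.length) ++ (unary (I.n * (4 * I.encode.length) + 4 * I.encode.length + 1) ++
          (graphList φ (4 * I.encode.length) I).flatMap edgeCode), [], [], []⟩
        (blockEnv I.n (4 * I.encode.length) fun _ => 0)) (toBISCost φ I.encode.length) := by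
  -- Listing each of `k`, `a`, `b` four times in `measure` produces this value. It gives the
  -- inequality `4 * (n + 1) ≤ k` needed in `numIndepSets_bounds`.
  set k := 4 * I.encode.length with hk
  have hlen : I.n + 1 + (I.cons.flatMap Constraint.encode).length = I.encode.length := by
    simp [CSPInstance.encode, unary]
    omega
  have hn : I.n ≤ k := by omega
  have h1 := Frag.runs_measure (R := BlockReg (ScopeReg Γ))
    [.k, .k, .k, .k, .a, .a, .a, .a,
    .b, .b, .b, .b] ⟨I.encode, num, den, [], [], [], []⟩ (fun _ => 0) rfl
  have h2 := Frag.runs_readUnary (R := BlockReg (ScopeReg Γ)) [.n, .n'] I.n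
    (I.cons.flatMap Constraint.encode) ⟨I.encode, num, den, [], [], [], []⟩
    (blockEnv 0 k fun _ => 0) rfl
  have e1 : (fun r : BlockReg (ScopeReg Γ) => (fun _ => 0) r + I.encode.length *
      [.k, .k, .k, .k, .a, .a, .a, .a,
        .b, .b, .b, .b].count r) = blockEnv 0 k fun _ => 0 := by
    funext r
    cases r <;> simp [blockEnv, hk, mul_comm]
  have e2 : (fun r : BlockReg (ScopeReg Γ) => blockEnv 0 k (fun _ => 0) r + I.n *
      [.n, .n'].count r) = blockEnv I.n k fun _ => 0 := by
    funext r
    cases r <;> simp [blockEnv]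
  rw [e1] at h1
  rw [e2] at h2
  -- The edges of each constraint are pushed on top of the earlier ones, so the constraints end up
  -- in reverse order; the head of the encoding is written last, when everything else is below it.
  have h3 := Frag.runs_records (constraintFrag φ) (Constraint.encode (Γ := Γ) (n := I.n))
    Constraint.encode_ne_nil
    (fun d l => Core.stk ⟨l.flatMap Constraint.encode, num, den,
      (d.flatMap (constraintList φ k)).flatMap edgeCode, [], [], []⟩ (blockEnv I.n k fun _ => 0))
    (fun d l => rfl) (constraintCost φ k) I.cons (by
      intro d a l _
      have := runs_constraintFrag φ (k := k) a hn le_rfl (l.flatMap Constraint.encode)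
        ⟨(a :: l).flatMap Constraint.encode, num, den,
          (d.flatMap (constraintList φ k)).flatMap edgeCode, [], [], []⟩ (by simp)
      simpa using this)
  have hem := emits_graphHeadGen (V := ScopeReg Γ) I.n k fun _ => 0
  have h4 := (graphHeadGen (V := ScopeReg Γ)).runs_write (B := k)
    ⟨[], num, den, (I.cons.reverse.flatMap (constraintList φ k)).flatMap edgeCode, [], [], []⟩
    hem.1 (by
      intro r
      cases r <;> simp [blockEnv, hn])
  rw [hem.2] at h4
  have h5 := h1.seq (h2.seq (h3.seq h4))
  have hcons := length_le_length_flatMap _ (Constraint.encode_ne_nil (Γ := Γ) (n := I.n)) I.cons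
  have e3 : unary (I.n * k + k + k) ++ (unary (I.n * k + k + 1) ++
      ((extraList I.n k).flatMap edgeCode ++
        (((List.range I.n).flatMap fun i => blockList k i i).flatMap edgeCode))) ++
      (I.cons.reverse.flatMap (constraintList φ k)).flatMap edgeCode =
      unary (I.n * k + k + k) ++ (unary (I.n * k + k + 1) ++
        (graphList φ k I).flatMap edgeCode) := by
    simp only [graphList, List.flatMap_append, List.append_assoc]
  rw [← e3]
  refine Frag.Runs.mono h5 ?_
  rw [toBISCost, ← hk]
  refine add_le_add (le_of_eq (by simp)) (add_le_add ?_ (add_le_add ?_ le_rfl))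
  · simp only [List.length_cons, List.length_nil]
    omega
  · refine Nat.add_le_add_right (Nat.mul_le_mul_right _ ?_) 1
    omega

theorem mem_graphList {k : ℕ} (I : CSPInstance Γ)
    (e : Fin ((I.n + 1) * k + k) × Fin ((I.n + 1) * k + 1)) :
    ((e.1 : ℕ), (e.2 : ℕ)) ∈ graphList φ k I ↔ IsBlockEdge (blockRel φ I.cons) e := by
  simp only [graphList, List.mem_append, IsBlockEdge]
  refine or_congr ?_ ?_
  · rw [mem_extraList]
    exact ⟨fun h => h.1, fun h => ⟨h, e.1.2, e.2.2⟩⟩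
  · constructor
    · rintro (h | h)
      · obtain ⟨i, hi, h⟩ := List.mem_flatMap.1 h
        rw [mem_blockList] at h
        exact ⟨Fin.castSucc ⟨i, List.mem_range.1 hi⟩, Fin.castSucc ⟨i, List.mem_range.1 hi⟩,
          .inl ⟨_, rfl, rfl⟩, h⟩
      · obtain ⟨c, hc, h⟩ := List.mem_flatMap.1 h
        obtain ⟨p, hp, h⟩ := List.mem_flatMap.1 h
        rw [mem_blockList] at h
        exact ⟨p.1, p.2, .inr ⟨c, List.mem_reverse.1 hc, hp⟩, h⟩
    · rintro ⟨i, j, (⟨x, rfl, rfl⟩ | ⟨c, hc, hp⟩), h⟩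
      · exact .inl (List.mem_flatMap.2 ⟨x, List.mem_range.2 x.2, mem_blockList.2 h⟩)
      · exact .inr (List.mem_flatMap.2 ⟨c, List.mem_reverse.2 hc,
          List.mem_flatMap.2 ⟨_, hp, mem_blockList.2 h⟩⟩)

theorem graphList_lt {k : ℕ} (I : CSPInstance Γ) (e : ℕ × ℕ) (he : e ∈ graphList φ k I) :
    e.1 < (I.n + 1) * k + k ∧ e.2 < (I.n + 1) * k + 1 := by
  have hb : ∀ i j : ℕ, i < I.n + 1 → j < I.n + 1 → e ∈ blockList k i j →
      e.1 < (I.n + 1) * k + k ∧ e.2 < (I.n + 1) * k + 1 := by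
    intro i j hi hj h
    obtain ⟨x, y⟩ := e
    obtain ⟨a, b, rfl, rfl⟩ := mem_blockList.1 h
    have h1 : (i + 1) * k ≤ (I.n + 1) * k := Nat.mul_le_mul_right k hi
    have h2 : (j + 1) * k ≤ (I.n + 1) * k := Nat.mul_le_mul_right k hj
    rw [add_mul i, one_mul] at h1
    rw [add_mul j, one_mul] at h2
    have := a.2
    have := b.2
    constructor <;> dsimp only <;> omega
  simp only [graphList, List.mem_append] at he
  rcases he with h | h | h
  · obtain ⟨x, y⟩ := e
    rw [mem_extraList] at h
    exact ⟨h.2.1, h.2.2⟩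
  · obtain ⟨i, hi, h⟩ := List.mem_flatMap.1 h
    have := List.mem_range.1 hi
    exact hb i i (by omega) (by omega) h
  · obtain ⟨c, hc, h⟩ := List.mem_flatMap.1 h
    obtain ⟨p, hp, h⟩ := List.mem_flatMap.1 h
    exact hb _ _ p.1.2 p.2.2 h

open scoped Classical in
variable {φ} in
theorem toBIS_spec (hφ : ∀ (R : Γ) a, a ∈ R.1.2 ↔ ∀ κ ∈ φ R, κ.Holds a) (I : CSPInstance Γ) :
    ∃ (J : BipartiteGraph) (ρ : BlockReg (ScopeReg Γ) → ℕ),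
      (∀ num den, (toBISFrag φ).Runs (Core.stk ⟨I.encode, num, den, [], [], [], []⟩ fun _ => 0)
        (Core.stk ⟨[], num, den, J.encode, [], [], []⟩ ρ)
        (toBISCost φ I.encode.length + 4 * I.encode.length)) ∧
      extraGen.OK ρ ∧ (∀ r, ρ r ≤ toBISCost φ I.encode.length + 4 * I.encode.length) ∧
      ∀ ε : ℝ, 0 < ε → ε < 1 → ∀ Y : ℕ,
        Real.exp (-(ε / 2 ^ 5)) * J.numIndepSets ≤ Y →
        Y ≤ Real.exp (ε / 2 ^ 5) * J.numIndepSets →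
        Real.exp (-ε) * I.Z ≤ (Y / 2 ^ (extraGen.str ρ).length : ℕ) ∧
          ((Y / 2 ^ (extraGen.str ρ).length : ℕ) : ℝ) ≤ Real.exp ε * I.Z := by
  obtain ⟨k, hk⟩ : ∃ k, k = 4 * I.encode.length := ⟨_, rfl⟩
  have hlen : I.n + 1 ≤ I.encode.length := by simp [CSPInstance.encode, unary]
  obtain ⟨edges, he1, he2⟩ := exists_fin_edges (graphList φ k I) (graphList_lt φ I)
  refine ⟨⟨(I.n + 1) * k + k, (I.n + 1) * k + 1, edges⟩,
    blockEnv I.n k fun _ => 0, ?_, ?_, ?_, ?_⟩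
  · intro num den
    have := runs_toBISFrag φ I num den
    rw [← hk] at this
    have e : BipartiteGraph.encode ⟨(I.n + 1) * k + k, (I.n + 1) * k + 1, edges⟩ =
        unary (I.n * k + k + k) ++ (unary (I.n * k + k + 1) ++
          (graphList φ k I).flatMap edgeCode) := by
      rw [← he2, show I.n * k + k + k = (I.n + 1) * k + k by ring,
        show I.n * k + k + 1 = (I.n + 1) * k + 1 by ring]
      rfl
    rw [e]
    exact this.mono (Nat.le_add_right _ _)
  · exact (emits_extraGen (ρ := blockEnv I.n k fun _ => 0) rfl rfl).1
  · intro r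
    cases r <;> simp only [blockEnv] <;> omega
  · intro ε h0 h1 Y hY1 hY2
    -- The unary numeral of the number of left vertices, with its final zero, has exactly as many
    -- symbols as there are digits to drop, so `extraGen` also performs the division.
    have hlen' : ((extraGen (V := ScopeReg Γ)).str (blockEnv I.n k fun _ => 0)).length =
        (I.n + 1) * k + k + 1 := by
      rw [(emits_extraGen (V := ScopeReg Γ) (ρ := blockEnv I.n k fun _ => 0) rfl rfl).2]
      simp [blockEnv, unary, add_mul]
    rw [hlen']
    have hZ : I.Z =
        (Finset.univ.filter fun σ : Fin I.n → Bool =>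
          Allowed (blockRel φ I.cons) (blocksOf σ)).card := by
      rw [CSPInstance.Z, ← Set.ncard_coe_finset]
      congr 1
      ext σ
      simp [allowed_blocksOf_iff hφ]
    obtain ⟨hlo, hhi⟩ := numIndepSets_bounds (n := I.n) (k := k) (by omega)
      (blockRel φ I.cons) (fun x => .inl ⟨x, rfl, rfl⟩) edges
      (fun e => (he1 e).trans (mem_graphList φ I e))
    rw [hZ]
    exact approx_of_div_pow hlo hhi h0 h1 hY1 hY2

end ToBIS

/-- Relations defined by pins and implications reduce to `#BIS`, without a bound on the degree. -/
theorem numCSPd_apReducible_numBIS (Γ : Finset BoolRel) (hΓ : (Γ : Set BoolRel) ⊆ IMConj) (d : ℕ) :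
    APReducible (numCSPd d Γ) numBIS := by
  classical
  have hφ : ∀ R : Γ, ∃ φ : List (IMClause R.1.1), ∀ a, a ∈ R.1.2 ↔ ∀ κ ∈ φ, κ.Holds a :=
    fun R => hΓ R.2
  choose φ hφ using hφ
  exact apReducible_of_frag (R := BlockReg (ScopeReg Γ)) (toBISFrag φ) extraGen 5
    (T := fun l => toBISCost φ l + 4 * l)
    ((polyBdd_toBISCost φ).add ((PolyBdd.const 4).mul .id)) fun I => toBIS_spec hφ I.1

/-! ### A definable implication in a relation that is not affine -/

section Chain

variable {r : ℕ} {S : Finset (Fin r → Bool)}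

/-- A chain in `S` whose sum is not in `S`. -/
structure IsBadChain (S : Finset (Fin r → Bool)) (a b c : Fin r → Bool) : Prop where
  bot_mem : a ∈ S
  mid_mem : b ∈ S
  top_mem : c ∈ S
  le_mid : ∀ i, a i = true → b i = true
  mid_le : ∀ i, b i = true → c i = true
  sum_notMem : (fun i => a i ^^ (b i ^^ c i)) ∉ S

/-- Some clause of φ fails on the affine hull of `S`. It cannot be a pin, nor an implication that
reduces on `S` to an affine equation (premise always false, conclusion always true, or both sides
equal). For a genuine implication, closure under ∧ and ∨ supplies the chain. -/
theorem exists_isBadChain {φ : List (IMClause r)} (hφ : ∀ a, a ∈ S ↔ ∀ κ ∈ φ, κ.Holds a)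
    (hand : ∀ x ∈ S, ∀ y ∈ S, (fun i => x i && y i) ∈ S)
    (hor : ∀ x ∈ S, ∀ y ∈ S, (fun i => x i || y i) ∈ S) (hS : ¬ IsAffine ⟨r, S⟩) :
    ∃ a b c, IsBadChain S a b c := by
  by_contra hno
  push Not at hno
  -- All equations valid on `S`: if even these did not imply every clause, there would be a bad
  -- chain.
  refine hS ⟨{e | ∀ a ∈ S, ∑ i ∈ e.1, (if a i then 1 else 0 : ZMod 2) = e.2}, fun a =>
    ⟨fun ha e he => he a ha, fun ha => (hφ a).2 fun κ hκ => ?_⟩⟩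
  have hpin : ∀ i c, (∀ z ∈ S, z i = c) → a i = c := by
    intro i c h
    have := ha ({i}, if c then 1 else 0) fun z hz => by rw [Finset.sum_singleton, h z hz]
    rw [Finset.sum_singleton] at this
    revert this
    cases a i <;> cases c <;> simp
  cases κ with
  | pin i c => exact hpin i c fun z hz => (hφ z).1 hz _ hκ
  | imp i j =>
    intro hi
    have himp : ∀ z ∈ S, z i = true → z j = true := fun z hz => (hφ z).1 hz _ hκ
    by_contra hj
    obtain ⟨x, hx, hxi⟩ : ∃ x ∈ S, x i = true := by
      by_contra! h
      simp [hpin i false fun z hz => by simpa using h z hz] at hi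
    obtain ⟨y, hy, hyj⟩ : ∃ y ∈ S, y j = false := by
      by_contra! h
      exact hj (hpin j true fun z hz => by simpa using h z hz)
    obtain ⟨z, hz, hzi, hzj⟩ : ∃ z ∈ S, z i = false ∧ z j = true := by
      by_contra! h
      have hij : i ≠ j := fun h => hj (h ▸ hi)
      have := ha ({i, j}, 0) fun z hz => by
        rw [Finset.sum_pair hij, show z i = z j from Bool.eq_iff_iff.2
          ⟨himp z hz, fun hzj => by_contra fun hzi => h z hz (by simpa using hzi) hzj⟩]
        exact CharTwo.add_self_eq_zero _
      rw [Finset.sum_pair hij] at this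
      simp [hi, hj] at this
    have hyi : y i = false := by
      by_contra h
      simp [himp y hy (by simpa using h)] at hyj
    -- The chain is y ∧ z ≤ z ≤ x ∨ z. At (i, j) its members read 00, 01, 11, with sum 10, which
    -- violates the implication.
    refine hno _ z _ ⟨hand y hy z hz, hz, hor x hx z hz, fun i => by simp, fun i => ?_, fun h => ?_⟩
    · simp +contextual
    · have := himp _ h
      simp [hzi, hzj, hxi, hyi, hyj] at this

/-- Distance between the ends of a chain. -/
theorem card_filter_ne_lt {a a' c c' : Fin r → Bool} (h : ∀ i, a' i ≠ c' i → a i ≠ c i)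
    (i : Fin r) (hi : a i ≠ c i) (hi' : a' i = c' i) :
    (Finset.univ.filter fun i => a' i ≠ c' i).card < (Finset.univ.filter fun i => a i ≠ c i).card := by
  refine Finset.card_lt_card ⟨fun j hj => ?_, fun hle => ?_⟩
  · simpa using h j (by simpa using hj)
  · have := hle (x := i) (by simpa using hi)
    simp [hi'] at this

/-- Coordinatewise facts for a ≤ w ≤ b ≤ c and v = w ⊕ b ⊕ c: the chains w ≤ b ≤ c and a ≤ w ≤ v
span subintervals of [a, c], proper ones if w differs from a and b respectively. -/
theorem bool_chain_low : ∀ {a w b c : Bool}, (a = true → w = true) → (w = true → b = true) →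
    (b = true → c = true) → (w ≠ c → a ≠ c) ∧ (w ≠ a → a ≠ c ∧ w = c) ∧
      (w = true → (w ^^ (b ^^ c)) = true) ∧ (a ≠ (w ^^ (b ^^ c)) → a ≠ c) ∧
      (w ≠ b → a ≠ c ∧ a = (w ^^ (b ^^ c))) := by
  decide

/-- The dual facts for a ≤ b ≤ w ≤ c, with v = a ⊕ b ⊕ w and the chains a ≤ b ≤ w and v ≤ w ≤ c. -/
theorem bool_chain_high : ∀ {a b w c : Bool}, (a = true → b = true) → (b = true → w = true) →
    (w = true → c = true) → (a ≠ w → a ≠ c) ∧ (w ≠ c → a ≠ c ∧ a = w) ∧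
      ((a ^^ (b ^^ w)) = true → w = true) ∧ ((a ^^ (b ^^ w)) ≠ c → a ≠ c) ∧
      (w ≠ b → a ≠ c ∧ (a ^^ (b ^^ w)) = c) := by
  decide

/-- The interval spanned by a shortest bad chain contains nothing else. -/
theorem exists_chain_eq_interval {φ : List (IMClause r)} (hφ : ∀ a, a ∈ S ↔ ∀ κ ∈ φ, κ.Holds a)
    (hS : ¬ IsAffine ⟨r, S⟩) :
    ∃ a b c, IsBadChain S a b c ∧ ∀ z ∈ S, (∀ i, a i = true → z i = true) →
      (∀ i, z i = true → c i = true) → z = a ∨ z = b ∨ z = c := by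
  have hand : ∀ x ∈ S, ∀ y ∈ S, (fun i => x i && y i) ∈ S := by
    intro x hx y hy
    refine (hφ _).2 fun κ hκ => ?_
    have h1 := (hφ _).1 hx κ hκ
    have h2 := (hφ _).1 hy κ hκ
    cases κ <;> simp_all [IMClause.Holds]
  have hor : ∀ x ∈ S, ∀ y ∈ S, (fun i => x i || y i) ∈ S := by
    intro x hx y hy
    refine (hφ _).2 fun κ hκ => ?_
    have h1 := (hφ _).1 hx κ hκ
    have h2 := (hφ _).1 hy κ hκ
    cases κ with
    | pin => simp_all [IMClause.Holds]
    | imp i j =>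
      simp only [IMClause.Holds, Bool.or_eq_true] at *
      exact Or.imp h1 h2
  obtain ⟨a₀, b₀, c₀, h₀⟩ := exists_isBadChain hφ hand hor hS
  obtain ⟨⟨a, b, c⟩, habc, hmin⟩ := exists_minimalFor_of_wellFoundedLT
    (fun t : (Fin r → Bool) × (Fin r → Bool) × (Fin r → Bool) => IsBadChain S t.1 t.2.1 t.2.2)
    (fun t => (Finset.univ.filter fun i => t.1 i ≠ t.2.2 i).card) ⟨(a₀, b₀, c₀), h₀⟩
  have hsum : ∀ a' ∈ S, ∀ b' ∈ S, ∀ c' ∈ S, (∀ i, a' i = true → b' i = true) →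
      (∀ i, b' i = true → c' i = true) → (∀ i, a' i ≠ c' i → a i ≠ c i) →
      (∃ i, a i ≠ c i ∧ a' i = c' i) → (fun i => a' i ^^ (b' i ^^ c' i)) ∈ S := by
    rintro a' ha' b' hb' c' hc' h1 h2 h3 ⟨i, h4, h5⟩
    by_contra h
    have hlt := card_filter_ne_lt h3 i h4 h5
    exact absurd (hmin (j := (a', b', c')) ⟨ha', hb', hc', h1, h2, h⟩ hlt.le) (not_le.2 hlt)
  dsimp only at habc
  obtain ⟨hamem, hbmem, hcmem, hab, hbc, hbad⟩ := id habc
  have hlow : ∀ w ∈ S, (∀ i, a i = true → w i = true) → (∀ i, w i = true → b i = true) →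
      w = a ∨ w = b := by
    intro w hw haw hwb
    by_contra! h
    obtain ⟨i, hi⟩ := Function.ne_iff.1 h.1
    obtain ⟨j, hj⟩ := Function.ne_iff.1 h.2
    have H := fun k => bool_chain_low (haw k) (hwb k) (hbc k)
    -- Minimality, applied to a shorter chain, puts v = w ⊕ b ⊕ c in `S`. Applied again to a ≤ w ≤ v
    -- it gives a ⊕ w ⊕ v = a ⊕ b ⊕ c in `S`, a contradiction.
    have hv := hsum w hw b hbmem c hcmem hwb hbc (fun k => (H k).1) ⟨i, (H i).2.1 hi⟩
    have := hsum a hamem w hw _ hv haw (fun k => (H k).2.2.1) (fun k => (H k).2.2.2.1)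
      ⟨j, (H j).2.2.2.2 hj⟩
    refine hbad ?_
    convert this using 2 with k
    cases a k <;> cases b k <;> cases c k <;> cases w k <;> rfl
  have hhigh : ∀ w ∈ S, (∀ i, b i = true → w i = true) → (∀ i, w i = true → c i = true) →
      w = b ∨ w = c := by
    intro w hw hbw hwc
    by_contra! h
    obtain ⟨i, hi⟩ := Function.ne_iff.1 h.1
    obtain ⟨j, hj⟩ := Function.ne_iff.1 h.2
    have H := fun k => bool_chain_high (hab k) (hbw k) (hwc k)
    have hv := hsum a hamem b hbmem w hw hab hbw (fun k => (H k).1) ⟨j, (H j).2.1 hj⟩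
    have := hsum _ hv w hw c hcmem (fun k => (H k).2.2.1) hwc (fun k => (H k).2.2.2.1)
      ⟨i, (H i).2.2.2.2 hi⟩
    refine hbad ?_
    convert this using 2 with k
    cases a k <;> cases b k <;> cases c k <;> cases w k <;> rfl
  refine ⟨a, b, c, habc, fun z hz haz hzc => ?_⟩
  -- An arbitrary z in the interval is determined by z ∧ b and z ∨ b, which lie below and above b.
  have h1 := hlow _ (hand z hz b hbmem) (fun i hi => by simp [haz i hi, hab i hi]) (by simp)
  have h2 := hhigh _ (hor z hz b hbmem) (by simp +contextual)
    (fun i hi => by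
      rcases Bool.or_eq_true_iff.1 hi with h | h
      exacts [hzc i h, hbc i h])
  rcases h1 with h1 | h1 <;> rcases h2 with h2 | h2
  · exact .inl (funext fun i => (by decide : ∀ a b z : Bool, (z && b) = a → (z || b) = b → z = a)
      _ _ _ (congrFun h1 i) (congrFun h2 i))
  -- Here z is the complement of b in [a, c], that is a ⊕ b ⊕ c, which is not in `S`.
  · refine absurd ?_ hbad
    convert hz using 1
    exact funext fun i => (by decide : ∀ a b c z : Bool, (z && b) = a → (z || b) = c →
      (a ^^ (b ^^ c)) = z) _ _ _ _ (congrFun h1 i) (congrFun h2 i)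
  · exact .inr (.inl (funext fun i => (by decide : ∀ b z : Bool, (z && b) = b → (z || b) = b →
      z = b) _ _ (congrFun h1 i) (congrFun h2 i)))
  · exact .inr (.inr (funext fun i => (by decide : ∀ b c z : Bool, (z && b) = b → (z || b) = c →
      z = c) _ _ _ (congrFun h1 i) (congrFun h2 i)))

/-- Pinning the coordinates in `P` to `s` leaves an implication between the coordinates `p` and
`q`; they determine all the others. -/
structure IsImpGadget (S : Finset (Fin r → Bool)) (s : Fin r → Bool) (P : Finset (Fin r))
    (p q : Fin r) (ext : Bool → Bool → Fin r → Bool) : Prop where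
  ne : p ≠ q
  left_notMem : p ∉ P
  right_notMem : q ∉ P
  mem_iff : ∀ z, (∀ i ∈ P, z i = s i) →
    (z ∈ S ↔ (z p = true → z q = true) ∧ z = ext (z p) (z q))
  ext_left : ∀ x y, (x = true → y = true) → ext x y p = x
  ext_right : ∀ x y, (x = true → y = true) → ext x y q = y
  ext_pin : ∀ x y, ∀ i ∈ P, ext x y i = s i

/-- Pinning the coordinates where a and c agree confines tuples to [a, c], hence to a, b, c. With p
separating b from c and q separating a from b, these read 00, 01, 11. Such p and q exist, for b = c
or a = b would make the sum of the chain equal to a or c. -/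
theorem exists_isImpGadget {φ : List (IMClause r)} (hφ : ∀ a, a ∈ S ↔ ∀ κ ∈ φ, κ.Holds a)
    (hS : ¬ IsAffine ⟨r, S⟩) : ∃ s P p q ext, IsImpGadget S s P p q ext := by
  obtain ⟨a, b, c, ⟨ha, hb, hc, hab, hbc, hbad⟩, hall⟩ := exists_chain_eq_interval hφ hS
  obtain ⟨p, hp⟩ : ∃ p, b p ≠ c p := by
    by_contra! h
    refine hbad ?_
    convert ha using 2 with i
    rw [h i]; simp
  obtain ⟨q, hq⟩ : ∃ q, a q ≠ b q := by
    by_contra! h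
    refine hbad ?_
    convert hc using 2 with i
    rw [h i]; simp
  have hbp : b p = false ∧ c p = true :=
    (by decide : ∀ b c : Bool, b ≠ c → (b = true → c = true) → b = false ∧ c = true) _ _ hp (hbc p)
  have haq : a q = false ∧ b q = true :=
    (by decide : ∀ a b : Bool, a ≠ b → (a = true → b = true) → a = false ∧ b = true) _ _ hq (hab q)
  have hap : a p = false := by
    by_contra h
    simpa [hbp.1] using hab p (by simpa using h)
  have hcq : c q = true := hbc q haq.2
  have hconst : ∀ i, a i = c i → b i = a i := fun i => (by decide : ∀ a b c : Bool,
    (a = true → b = true) → (b = true → c = true) → a = c → b = a) _ _ _ (hab i) (hbc i)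
  -- The value of the extension at the excluded pattern (true, false) is immaterial.
  refine ⟨a, Finset.univ.filter fun i => a i = c i, p, q,
    fun x y => if x then c else if y then b else a, ?_, ?_, ?_, ?_, ?_, ?_, ?_⟩
  · rintro rfl
    simp [hbp.1] at haq
  · simp [hap, hbp.2]
  · simp [haq.1, hcq]
  · intro z hz
    simp only [Finset.mem_filter, Finset.mem_univ, true_and] at hz
    constructor
    · intro h
      have hac : ∀ i, (a i = true → z i = true) ∧ (z i = true → c i = true) := fun i =>
        (by decide : ∀ a b c z : Bool, (a = true → b = true) → (b = true → c = true) →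
          (a = c → z = a) → (a = true → z = true) ∧ (z = true → c = true)) _ _ _ _ (hab i) (hbc i)
          (hz i)
      rcases hall z h (fun i => (hac i).1) (fun i => (hac i).2) with rfl | rfl | rfl
      · simp [hap, haq.1]
      · simp [hbp.1, haq.2]
      · simp [hbp.2, hcq]
    · rintro ⟨-, h⟩
      rw [h]
      split_ifs <;> assumption
  · intro x y hxy
    cases x <;> cases y <;> simp_all
  · intro x y hxy
    cases x <;> cases y <;> simp_all
  · intro x y i hi
    simp only [Finset.mem_filter, Finset.mem_univ, true_and] at hi
    split_ifs
    exacts [hi.symm, hconst i hi, rfl]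

end Chain

/-! ### Systems of implications as instances -/

section ImpInstance

variable {Γ : Finset BoolRel}

/-- The unary relation `{b}`. -/
def pinRel (h0 : Rzero ∈ Γ) (h1 : Rone ∈ Γ) : Bool → Γ
  | false => ⟨Rzero, h0⟩
  | true => ⟨Rone, h1⟩

theorem const_mem_pinRel (h0 : Rzero ∈ Γ) (h1 : Rone ∈ Γ) (b x : Bool) :
    (fun _ => x) ∈ (pinRel h0 h1 b).1.2 ↔ x = b := by
  cases b <;>
    exact (Finset.mem_singleton (α := Fin 1 → Bool)).trans
      ⟨fun h => congrFun h (0 : Fin 1), fun h => by rw [h]; rfl⟩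

theorem card_filter_pinRel (h0 : Rzero ∈ Γ) (h1 : Rone ∈ Γ) (b : Bool) (φ : Prop) [Decidable φ] :
    (Finset.univ.filter fun _ : Fin (pinRel h0 h1 b).1.1 => φ).card = if φ then 1 else 0 := by
  split_ifs with h <;> simp only [h, Finset.filter_true, Finset.filter_false, Finset.card_empty]
  cases b <;> rfl

theorem pinRel_arity (h0 : Rzero ∈ Γ) (h1 : Rone ∈ Γ) (b : Bool) : (pinRel h0 h1 b).1.1 = 1 := by
  cases b <;> rfl

theorem encode_pin (h0 : Rzero ∈ Γ) (h1 : Rone ∈ Γ) (b : Bool) {n : ℕ} (v : Fin n) :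
    Constraint.encode ⟨pinRel h0 h1 b, fun _ => v⟩ =
      unary (Γ.equivFin (pinRel h0 h1 b)) ++ unary v := by
  cases b <;> simp [Constraint.encode, pinRel, Rzero, Rone]

variable (h0 : Rzero ∈ Γ) (h1 : Rone ∈ Γ) (R : Γ) (s : Fin R.1.1 → Bool)
  (P : Finset (Fin R.1.1)) (p q : Fin R.1.1)

variable {M G : ℕ} (X Y : Fin G → Fin M)

/-- The auxiliary variable for the coordinate `i` of the relation in the gadget `g`. -/
def dummy (M : ℕ) {G r : ℕ} (g : Fin G) (i : Fin r) : Fin (M + G * r) :=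
  Fin.natAdd M (finProdFinEquiv (g, i))

theorem dummy_inj {r : ℕ} {g g' : Fin G} {i i' : Fin r} :
    dummy M g i = dummy M g' i' ↔ g = g' ∧ i = i' := by
  simp [dummy]

theorem castAdd_ne_dummy {r : ℕ} (v : Fin M) (g : Fin G) (i : Fin r) :
    Fin.castAdd (G * r) v ≠ dummy M g i := by
  intro h
  have := congrArg Fin.val h
  simp only [dummy, Fin.val_castAdd, Fin.val_natAdd] at this
  omega

/-- The scope of the main constraint of the gadget `g`. -/
def gadgetScope (g : Fin G) (i : Fin R.1.1) : Fin (M + G * R.1.1) :=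
  if i = p then Fin.castAdd _ (X g) else if i = q then Fin.castAdd _ (Y g) else dummy M g i

/-- The coordinates whose auxiliary variables are pinned. -/
noncomputable def pinned : List (Fin R.1.1) := (insert p (insert q P)).toList

/-- The constraints that express the implication from `X g` to `Y g`. -/
noncomputable def gadgetCons (g : Fin G) : List (Constraint Γ (M + G * R.1.1)) :=
  ⟨R, gadgetScope R p q X Y g⟩ ::
    (pinned R P p q).map fun i => ⟨pinRel h0 h1 (s i), fun _ => dummy M g i⟩

-- Main constraints are told apart by their scopes at p and q, and pins by their auxiliary
-- variables. A main constraint is never a pin, because p ≠ q forces arity at least two.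
variable {p q} in
theorem nodup_gadgetCons (hpq : p ≠ q) (hXY : ∀ g g', X g = X g' → Y g = Y g' → g = g')
    {L : List (Fin G)} (hL : L.Nodup) :
    (L.flatMap (gadgetCons h0 h1 R s P p q X Y)).Nodup := by
  have har : ∀ b, R ≠ pinRel h0 h1 b := by
    intro b h
    have h2 : R.1.1 = 1 := by rw [h, pinRel_arity]
    have := p.2
    have := q.2
    exact hpq (Fin.ext (by omega))
  have hpin : ∀ b b' g g' (i i' : Fin R.1.1),
      (⟨pinRel h0 h1 b, fun _ => dummy M g i⟩ : Constraint Γ (M + G * R.1.1)) =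
        ⟨pinRel h0 h1 b', fun _ => dummy M g' i'⟩ → g = g' ∧ i = i' := by
    intro b b' g g' i i' h
    have h2 := congrArg Constraint.encode h
    rw [encode_pin, encode_pin] at h2
    obtain ⟨-, h3⟩ := unary_append_inj h2
    have h4 := (unary_append_inj (s := []) (t := []) (by simpa using h3)).1
    exact dummy_inj.1 (Fin.ext h4)
  refine List.nodup_flatMap.2 ⟨fun g _ => ?_, hL.imp fun {g g'} hne => ?_⟩
  · refine List.nodup_cons.2 ⟨fun h => ?_, (Finset.nodup_toList _).map fun i i' h => ?_⟩
    · obtain ⟨i, -, h⟩ := List.mem_map.1 h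
      exact har _ (congrArg Sigma.fst h).symm
    · exact (hpin _ _ _ _ _ _ h).2
  · rw [Function.onFun, List.disjoint_left]
    intro c hc hc'
    rcases List.mem_cons.1 hc with rfl | hc
    · rcases List.mem_cons.1 hc' with h | hc'
      · have h2 := eq_of_heq (Sigma.mk.inj h).2
        have hp := congrFun h2 p
        have hq := congrFun h2 q
        simp only [gadgetScope, if_true, hpq.symm, if_false] at hp hq
        exact hne (hXY _ _ (by simpa using hp) (by simpa using hq))
      · obtain ⟨i, -, h⟩ := List.mem_map.1 hc'
        exact har _ (congrArg Sigma.fst h).symm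
    · obtain ⟨i, -, rfl⟩ := List.mem_map.1 hc
      rcases List.mem_cons.1 hc' with h | hc'
      · exact har _ (congrArg Sigma.fst h).symm
      · obtain ⟨i', -, h⟩ := List.mem_map.1 hc'
        exact hne (hpin _ _ _ _ _ _ h).1.symm

/-- The number of occurrences of `v` in the gadget `g`. -/
noncomputable def gadgetCount (v : Fin (M + G * R.1.1)) (g : Fin G) : ℕ :=
  (Finset.univ.filter fun i => gadgetScope R p q X Y g i = v).card +
    ((pinned R P p q).map fun i => if dummy M g i = v then 1 else 0).sum

theorem sum_gadgetCons (v : Fin (M + G * R.1.1)) (g : Fin G) :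
    ((gadgetCons h0 h1 R s P p q X Y g).map
      fun c => (Finset.univ.filter fun i => c.2 i = v).card).sum = gadgetCount R P p q X Y v g := by
  rw [gadgetCons, List.map_cons, List.sum_cons, List.map_map, gadgetCount]
  congr 2
  exact List.map_congr_left fun i _ => card_filter_pinRel h0 h1 (s i) (dummy M g i = v)

theorem gadgetCount_castAdd_le (v : Fin M) (g : Fin G) :
    gadgetCount R P p q X Y (Fin.castAdd _ v) g ≤
      (if X g = v then 1 else 0) + (if Y g = v then 1 else 0) := by
  have h2 : ((pinned R P p q).map fun i =>
      if dummy M g i = Fin.castAdd _ v then 1 else 0).sum = 0 := by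
    simp [(castAdd_ne_dummy v g _).symm]
  rw [gadgetCount, h2, add_zero]
  have h3 : (Finset.univ.filter fun i => gadgetScope R p q X Y g i = Fin.castAdd _ v) ⊆
      (if X g = v then {p} else ∅) ∪ (if Y g = v then {q} else ∅) := by
    intro i hi
    have hi := (Finset.mem_filter.1 hi).2
    rw [Finset.mem_union]
    unfold gadgetScope at hi
    split_ifs at hi with hp hq
    · left; rw [if_pos (by simpa using hi)]; simpa using hp
    · right; rw [if_pos (by simpa using hi)]; simpa using hq
    · exact absurd hi.symm (castAdd_ne_dummy _ _ _)
  refine (Finset.card_le_card h3).trans ((Finset.card_union_le _ _).trans (le_of_eq ?_))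
  split_ifs <;> rfl

/-- An auxiliary variable belongs to one gadget and occurs there at most once in the main scope and
at most once in a pin. -/
theorem gadgetCount_dummy_le (g₀ : Fin G) (i₀ : Fin R.1.1) (g : Fin G) :
    gadgetCount R P p q X Y (dummy M g₀ i₀) g ≤ if g = g₀ then 2 else 0 := by
  have h1 : (Finset.univ.filter fun i => gadgetScope R p q X Y g i = dummy M g₀ i₀) ⊆
      if g = g₀ then {i₀} else ∅ := by
    intro i hi
    have hi := (Finset.mem_filter.1 hi).2
    unfold gadgetScope at hi
    split_ifs at hi
    · exact absurd hi (castAdd_ne_dummy _ _ _)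
    · exact absurd hi (castAdd_ne_dummy _ _ _)
    · obtain ⟨h2, h3⟩ := dummy_inj.1 hi
      rw [if_pos h2]
      simpa using h3
  have h2 : ((pinned R P p q).map fun i => if dummy M g i = dummy M g₀ i₀ then 1 else 0).sum ≤
      if g = g₀ then 1 else 0 := by
    rw [pinned, Finset.sum_map_toList]
    simp only [dummy_inj]
    split_ifs with h <;> simp only [h, true_and, false_and]
    · rw [Finset.sum_ite_eq']
      split_ifs <;> simp
    · simp
  have h3 := Finset.card_le_card h1
  rw [gadgetCount]
  by_cases h : g = g₀
  · simp only [h, if_true, Finset.card_singleton] at h2 h3 ⊢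
    omega
  · simp only [h, if_false, Finset.card_empty] at h2 h3 ⊢
    omega

/-- The instance that expresses the implications from `X g` to `Y g`, with the gadgets in the order
of the list. -/
noncomputable def impInstance {p q : Fin R.1.1} (hpq : p ≠ q)
    (hXY : ∀ g g', X g = X g' → Y g = Y g' → g = g') {L : List (Fin G)} (hL : L.Nodup) :
    CSPInstance Γ where
  n := M + G * R.1.1
  cons := L.flatMap (gadgetCons h0 h1 R s P p q X Y)
  nodup := nodup_gadgetCons h0 h1 R s P X Y hpq hXY hL

variable {p q} (hpq : p ≠ q) (hXY : ∀ g g', X g = X g' → Y g = Y g' → g = g')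
  {L : List (Fin G)} (hL : L.Nodup)

theorem degree_impInstance_le {d : ℕ} (hd : 2 ≤ d)
    (hdeg : ∀ v, ∑ g, ((if X g = v then 1 else 0) + (if Y g = v then 1 else 0)) ≤ d) :
    (impInstance h0 h1 R s P X Y hpq hXY hL).degree ≤ d := by
  have h : ∀ v, ((L.flatMap (gadgetCons h0 h1 R s P p q X Y)).map
      fun c => (Finset.univ.filter fun i => c.2 i = v).card).sum ≤
        ∑ g, gadgetCount R P p q X Y v g := by
    intro v
    rw [List.map_flatMap, List.flatMap_def, List.sum_flatten, List.map_map, Function.comp_def,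
      List.map_congr_left fun g _ => sum_gadgetCons h0 h1 R s P p q X Y v g,
      ← List.sum_toFinset _ hL]
    exact Finset.sum_le_sum_of_subset (Finset.subset_univ _)
  refine Finset.sup_le fun v _ => (h v).trans ?_
  change Fin (M + G * R.1.1) at v
  refine Fin.addCases (fun v => ?_) (fun k => ?_) v
  · exact (Finset.sum_le_sum fun g _ => gadgetCount_castAdd_le R P p q X Y v g).trans (hdeg v)
  · obtain ⟨⟨g₀, i₀⟩, rfl⟩ := finProdFinEquiv.surjective k
    refine (Finset.sum_le_sum fun g _ => gadgetCount_dummy_le R P p q X Y g₀ i₀ g).trans ?_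
    simpa using hd

/-- The extension of an assignment to the auxiliary variables. -/
def extendAssignment (p q : Fin R.1.1) (ext : Bool → Bool → Fin R.1.1 → Bool) (τ : Fin M → Bool) :
    Fin (M + G * R.1.1) → Bool :=
  Fin.addCases τ fun k =>
    let gi := finProdFinEquiv.symm k
    if gi.2 = p ∨ gi.2 = q then s gi.2 else ext (τ (X gi.1)) (τ (Y gi.1)) gi.2

theorem extendAssignment_castAdd (ext : Bool → Bool → Fin R.1.1 → Bool) (τ : Fin M → Bool)
    (v : Fin M) : extendAssignment R s X Y p q ext τ (Fin.castAdd _ v) = τ v := by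
  simp [extendAssignment]

theorem extendAssignment_dummy (ext : Bool → Bool → Fin R.1.1 → Bool) (τ : Fin M → Bool)
    (g : Fin G) (i : Fin R.1.1) : extendAssignment R s X Y p q ext τ (dummy M g i) =
      if i = p ∨ i = q then s i else ext (τ (X g)) (τ (Y g)) i := by
  simp only [extendAssignment, dummy, Fin.addCases_right, Equiv.symm_apply_apply]

-- `extendAssignment` is a bijection from the solutions of the implications to the satisfying
-- assignments, as each gadget determines its auxiliary variables.
variable {s P} in
theorem Z_impInstance {ext : Bool → Bool → Fin R.1.1 → Bool}
    (hR : IsImpGadget R.1.2 s P p q ext) (hall : ∀ g, g ∈ L) :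
    (impInstance h0 h1 R s P X Y hpq hXY hL).Z =
      Set.ncard {τ : Fin M → Bool | ∀ g, τ (X g) = true → τ (Y g) = true} := by
  have hinj : Function.Injective (extendAssignment R s X Y p q ext) := by
    intro τ τ' h
    funext v
    have := congrFun h (Fin.castAdd _ v)
    rwa [extendAssignment_castAdd, extendAssignment_castAdd] at this
  rw [← Set.ncard_image_of_injective _ hinj, CSPInstance.Z]
  congr 1
  ext σ
  change Fin (M + G * R.1.1) → Bool at σ
  -- The auxiliary variables at p and q occur in no main scope. They are pinned as well, since each
  -- free one would double the count.
  have hsat : (impInstance h0 h1 R s P X Y hpq hXY hL).Satisfies σ ↔ ∀ g : Fin G,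
      (fun i => σ (gadgetScope R p q X Y g i)) ∈ R.1.2 ∧
        ∀ i, (i = p ∨ i = q ∨ i ∈ P) → σ (dummy M g i) = s i := by
    constructor
    · intro h g
      refine ⟨h ⟨R, _⟩ (List.mem_flatMap.2 ⟨g, hall g, List.mem_cons_self⟩), fun i hi => ?_⟩
      refine (const_mem_pinRel h0 h1 _ _).1 (h ⟨pinRel h0 h1 (s i), fun _ => dummy M g i⟩
        (List.mem_flatMap.2 ⟨g, hall g, List.mem_cons_of_mem _ (List.mem_map.2 ⟨i, ?_, rfl⟩)⟩))
      simpa [pinned] using hi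
    · intro h c hc
      obtain ⟨g, -, hc⟩ := List.mem_flatMap.1 hc
      rcases List.mem_cons.1 hc with rfl | hc
      · exact (h g).1
      · obtain ⟨i, hi, rfl⟩ := List.mem_map.1 hc
        exact (const_mem_pinRel h0 h1 _ _).2 ((h g).2 i (by simpa [pinned] using hi))
  have hscope : ∀ g : Fin G, (∀ i ∈ P, σ (dummy M g i) = s i) →
      ((fun i => σ (gadgetScope R p q X Y g i)) ∈ R.1.2 ↔
        (σ (Fin.castAdd _ (X g)) = true → σ (Fin.castAdd _ (Y g)) = true) ∧
        ∀ i, i ≠ p → i ≠ q →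
          σ (dummy M g i) = ext (σ (Fin.castAdd _ (X g))) (σ (Fin.castAdd _ (Y g))) i) := by
    intro g hP
    rw [hR.mem_iff _ fun i hi => ?_]
    · have hp : gadgetScope R p q X Y g p = Fin.castAdd _ (X g) := by simp [gadgetScope]
      have hq : gadgetScope R p q X Y g q = Fin.castAdd _ (Y g) := by
        simp [gadgetScope, hpq.symm]
      simp only [hp, hq]
      refine and_congr_right fun himp => ⟨fun h i h2 h3 => ?_, fun h => funext fun i => ?_⟩
      · have := congrFun h i
        simpa only [gadgetScope, h2, h3, if_false] using this
      · by_cases h2 : i = p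
        · rw [h2, hp, hR.ext_left _ _ himp]
        · by_cases h3 : i = q
          · rw [h3, hq, hR.ext_right _ _ himp]
          · simpa only [gadgetScope, h2, h3, if_false] using h i h2 h3
    · have h2 : i ≠ p := fun h => hR.left_notMem (h ▸ hi)
      have h3 : i ≠ q := fun h => hR.right_notMem (h ▸ hi)
      simpa only [gadgetScope, h2, h3, if_false] using hP i hi
  refine Iff.trans hsat ?_
  constructor
  · intro h
    refine ⟨fun v => σ (Fin.castAdd _ v), fun g =>
      ((hscope g fun i hi => (h g).2 i (.inr (.inr hi))).1 (h g).1).1, funext fun v => ?_⟩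
    refine Fin.addCases (fun v => ?_) (fun k => ?_) v
    · rw [extendAssignment_castAdd]
    · obtain ⟨⟨g, i⟩, rfl⟩ := finProdFinEquiv.surjective k
      change extendAssignment R s X Y p q ext _ (dummy M g i) = σ (dummy M g i)
      rw [extendAssignment_dummy]
      split_ifs with hi
      · exact ((h g).2 i (by tauto)).symm
      · exact (((hscope g fun i hi => (h g).2 i (.inr (.inr hi))).1 (h g).1).2 i
          (by tauto) (by tauto)).symm
  · rintro ⟨τ, hτ, rfl⟩ g
    have hpins : ∀ i, (i = p ∨ i = q ∨ i ∈ P) →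
        extendAssignment R s X Y p q ext τ (dummy M g i) = s i := by
      intro i hi
      rw [extendAssignment_dummy]
      split_ifs with h
      · rfl
      · exact hR.ext_pin _ _ i (by tauto)
    refine ⟨(hscope g fun i hi => hpins i (.inr (.inr hi))).2 ⟨?_, fun i h2 h3 => ?_⟩, hpins⟩
    · simpa only [extendAssignment_castAdd] using hτ g
    · simp only [extendAssignment_castAdd, extendAssignment_dummy, h2, h3, or_self, if_false]

end ImpInstance

/-! ### Independent sets as solutions of a system of implications -/

namespace BipartiteGraph

variable (B : BipartiteGraph)

/-- The variable for the copy `c` of the vertex `w`. -/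
def slot (l : ℕ) (c : Fin (l + 1)) (w : Fin (B.m + B.n)) : Fin ((l + 1) * (B.m + B.n)) :=
  finProdFinEquiv (c, w)

theorem slot_inj {l : ℕ} {c c' : Fin (l + 1)} {w w' : Fin (B.m + B.n)} :
    B.slot l c w = B.slot l c' w' ↔ c = c' ∧ w = w' := by
  simp [slot]

theorem exists_slot {l : ℕ} (k : Fin ((l + 1) * (B.m + B.n))) : ∃ c w, k = B.slot l c w := by
  obtain ⟨⟨c, w⟩, rfl⟩ := finProdFinEquiv.surjective k
  exact ⟨c, w, rfl⟩

/-- The next copy of the same vertex, cyclically. -/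
def nextSlot (l : ℕ) (k : Fin ((l + 1) * (B.m + B.n))) : Fin ((l + 1) * (B.m + B.n)) :=
  B.slot l ((finProdFinEquiv.symm k).1 + 1) (finProdFinEquiv.symm k).2

theorem nextSlot_slot {l : ℕ} (c : Fin (l + 1)) (w : Fin (B.m + B.n)) :
    B.nextSlot l (B.slot l c w) = B.slot l (c + 1) w := by
  simp only [nextSlot, slot, Equiv.symm_apply_apply]

theorem nextSlot_injective (l : ℕ) : Function.Injective (B.nextSlot l) := by
  intro k k' h
  obtain ⟨c, w, rfl⟩ := B.exists_slot k
  obtain ⟨c', w', rfl⟩ := B.exists_slot k'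
  rw [nextSlot_slot, nextSlot_slot, slot_inj] at h
  rw [add_left_inj] at h
  rw [B.slot_inj.2 h]

variable {B} {l : ℕ} (hl : B.edges.length ≤ l)

/-- The copy that is used for an edge. -/
def edgeCopy (t : Fin B.edges.length) : Fin (l + 1) := Fin.castLE (by omega) t

theorem edgeCopy_injective : Function.Injective (edgeCopy hl) :=
  fun t t' h => Fin.ext (show (edgeCopy hl t).val = (edgeCopy hl t').val by rw [h])

/-- The left end of an edge. -/
def edgeLeft (t : Fin B.edges.length) : Fin ((l + 1) * (B.m + B.n)) :=
  B.slot l (edgeCopy hl t) (Fin.castAdd B.n (B.edges.get t).1)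

/-- The right end of an edge. -/
def edgeRight (t : Fin B.edges.length) : Fin ((l + 1) * (B.m + B.n)) :=
  B.slot l (edgeCopy hl t) (Fin.natAdd B.m (B.edges.get t).2)

/-- The premises of the implications. -/
def impLeft : Fin ((l + 1) * (B.m + B.n) + B.edges.length) → Fin ((l + 1) * (B.m + B.n)) :=
  Fin.addCases id (edgeLeft hl)

/-- The conclusions of the implications. -/
def impRight : Fin ((l + 1) * (B.m + B.n) + B.edges.length) → Fin ((l + 1) * (B.m + B.n)) :=
  Fin.addCases (B.nextSlot l) (edgeRight hl)

theorem castAdd_ne_natAdd {m n : ℕ} (u : Fin m) (v : Fin n) : Fin.castAdd n u ≠ Fin.natAdd m v := by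
  intro h
  have := congrArg Fin.val h
  simp only [Fin.val_castAdd, Fin.val_natAdd] at this
  omega

/-- Cycle implications stay at one vertex, while edge implications lead from a left to a right
vertex, so the two kinds never coincide. Different entries of the edge list use different copies,
even if the edges are equal. -/
theorem imp_inj (g g' : Fin ((l + 1) * (B.m + B.n) + B.edges.length))
    (hX : impLeft hl g = impLeft hl g') (hY : impRight hl g = impRight hl g') : g = g' := by
  have hne : ∀ k t, k = edgeLeft hl t → B.nextSlot l k ≠ edgeRight hl t := by
    rintro k t rfl h
    rw [edgeLeft, edgeRight, nextSlot_slot, slot_inj] at h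
    exact castAdd_ne_natAdd _ _ h.2
  revert hX hY
  refine Fin.addCases (fun k => ?_) (fun t => ?_) g <;>
    refine Fin.addCases (fun k' => ?_) (fun t' => ?_) g' <;>
    simp only [impLeft, impRight, Fin.addCases_left, Fin.addCases_right, id] <;> intro hX hY
  · rw [hX]
  · exact absurd hY (hne _ _ hX)
  · exact absurd hY.symm (hne _ _ hX.symm)
  · rw [edgeLeft, edgeLeft, slot_inj] at hX
    rw [edgeCopy_injective hl hX.1]

/-- A slot is once a premise and at most once a conclusion in its cycle. At most one edge uses its
copy number, and this edge meets the slot at one end only. -/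
theorem sum_imp_le (v : Fin ((l + 1) * (B.m + B.n))) :
    ∑ g, ((if impLeft hl g = v then 1 else 0) + (if impRight hl g = v then 1 else 0)) ≤ 3 := by
  have hone : ∀ {α β : Type} [Fintype α] [DecidableEq β] (f : α → β) (b : β)
      (_ : Function.Injective f), (∑ a, if f a = b then 1 else 0) ≤ 1 := by
    intro α β _ _ f b hf
    rw [← Finset.card_filter, Finset.card_le_one]
    intro a ha a' ha'
    exact hf ((Finset.mem_filter.1 ha).2.trans (Finset.mem_filter.1 ha').2.symm)
  obtain ⟨c, w, rfl⟩ := B.exists_slot v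
  rw [Fin.sum_univ_add]
  simp only [impLeft, impRight, Fin.addCases_left, Fin.addCases_right, id]
  rw [Finset.sum_add_distrib]
  have h1 := hone (fun k : Fin ((l + 1) * (B.m + B.n)) => k) (B.slot l c w) fun _ _ h => h
  have h2 := hone (B.nextSlot l) (B.slot l c w) (B.nextSlot_injective l)
  have h3 := hone (edgeCopy hl) c (edgeCopy_injective hl)
  have h4 : ∀ t, (if edgeLeft hl t = B.slot l c w then 1 else 0) +
      (if edgeRight hl t = B.slot l c w then 1 else 0) ≤ if edgeCopy hl t = c then 1 else 0 := by
    intro t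
    simp only [edgeLeft, edgeRight, slot_inj]
    by_cases hc : edgeCopy hl t = c
    · simp only [hc, true_and, if_true]
      split_ifs with h h'
      · exact absurd (h.trans h'.symm) (castAdd_ne_natAdd _ _)
      all_goals simp
    · simp [hc]
  have h5 := Finset.sum_le_sum fun t (_ : t ∈ Finset.univ) => h4 t
  omega

open scoped Classical in
/-- The assignment that belongs to a set of vertices. -/
noncomputable def assignmentOf (l : ℕ) (S : Set (Fin B.m ⊕ Fin B.n)) :
    Fin ((l + 1) * (B.m + B.n)) → Bool := fun k =>
  Fin.addCases (fun u => decide (.inl u ∈ S)) (fun v => decide (.inr v ∉ S))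
    (finProdFinEquiv.symm k).2

theorem assignmentOf_left (S : Set (Fin B.m ⊕ Fin B.n)) (c : Fin (l + 1)) (u : Fin B.m) :
    assignmentOf l S (B.slot l c (Fin.castAdd _ u)) = true ↔ .inl u ∈ S := by
  simp only [assignmentOf, slot, Equiv.symm_apply_apply, Fin.addCases_left, decide_eq_true_eq]

theorem assignmentOf_right (S : Set (Fin B.m ⊕ Fin B.n)) (c : Fin (l + 1)) (v : Fin B.n) :
    assignmentOf l S (B.slot l c (Fin.natAdd _ v)) = true ↔ .inr v ∉ S := by
  simp only [assignmentOf, slot, Equiv.symm_apply_apply, Fin.addCases_right, decide_eq_true_eq]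

theorem assignmentOf_slot (S : Set (Fin B.m ⊕ Fin B.n)) (c c' : Fin (l + 1))
    (w : Fin (B.m + B.n)) :
    assignmentOf l S (B.slot l c w) = assignmentOf l S (B.slot l c' w) := by
  simp only [assignmentOf, slot, Equiv.symm_apply_apply]

/-- A property that is passed on cyclically holds always or never. -/
theorem forall_of_cyclic {l : ℕ} {φ : Fin (l + 1) → Prop} (h : ∀ c, φ c → φ (c + 1))
    (c c' : Fin (l + 1)) (hc : φ c) : φ c' := by
  have key : ∀ j : ℕ, φ (Fin.ofNat (l + 1) (c + j)) := by
    intro j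
    induction j with
    | zero => simpa using hc
    | succ j ih =>
      have := h _ ih
      rwa [show Fin.ofNat (l + 1) (c + j) + 1 = Fin.ofNat (l + 1) (c + (j + 1)) from
        Fin.ext (by simp [Fin.val_add, add_assoc])] at this
  have := key (c' + (l + 1 - c))
  rwa [show Fin.ofNat (l + 1) (c + (c' + (l + 1 - c))) = c' from Fin.ext (by
    rw [show (c : ℕ) + (c' + (l + 1 - c)) = c' + (l + 1) by omega]
    simpa using Nat.le_of_lt_succ c'.2)] at this

/-- Going round a cycle of implications makes all copies of a vertex equal, so any copy may stand
for it at an edge. -/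
theorem ncard_imp : Set.ncard {τ : Fin ((l + 1) * (B.m + B.n)) → Bool |
    ∀ g, τ (impLeft hl g) = true → τ (impRight hl g) = true} = B.numIndepSets := by
  have hinj : Function.Injective (assignmentOf (B := B) l) := by
    intro S S' h
    ext x
    rcases x with u | v
    · rw [← assignmentOf_left S 0, h, assignmentOf_left]
    · rw [← not_iff_not, ← assignmentOf_right S 0, h, assignmentOf_right]
  rw [numIndepSets, ← Set.ncard_image_of_injective _ hinj]
  congr 1
  ext τ
  have hτ : (∀ g, τ (impLeft hl g) = true → τ (impRight hl g) = true) ↔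
      (∀ k, τ k = true → τ (B.nextSlot l k) = true) ∧
        ∀ t, τ (edgeLeft hl t) = true → τ (edgeRight hl t) = true := by
    constructor
    · intro h
      refine ⟨fun k => ?_, fun t => ?_⟩
      · simpa [impLeft, impRight] using h (Fin.castAdd _ k)
      · simpa [impLeft, impRight] using h (Fin.natAdd _ t)
    · rintro ⟨h1, h2⟩ g
      refine Fin.addCases (fun k => ?_) (fun t => ?_) g
      · simpa [impLeft, impRight] using h1 k
      · simpa [impLeft, impRight] using h2 t
  refine Iff.trans hτ ⟨fun ⟨h1, h2⟩ => ?_, ?_⟩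
  · have hcopy : ∀ c c' w, τ (B.slot l c w) = true → τ (B.slot l c' w) = true := by
      intro c c' w
      exact forall_of_cyclic (φ := fun c => τ (B.slot l c w) = true) (fun c hc => by
        have := h1 _ hc
        rwa [nextSlot_slot] at this) c c'
    -- The right side is complemented, which turns "not both ends" into the implication from left to
    -- right.
    let S : Set (Fin B.m ⊕ Fin B.n) := {x | Sum.elim
      (fun u => τ (B.slot l 0 (Fin.castAdd _ u)) = true)
      (fun v => ¬ τ (B.slot l 0 (Fin.natAdd _ v)) = true) x}
    refine ⟨S, ?_, ?_⟩
    · refine (B.isIndepSet_iff S).2 fun e he ⟨hu, hv⟩ => hv ?_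
      obtain ⟨t, rfl⟩ := List.get_of_mem he
      exact hcopy _ _ _ (h2 t (hcopy 0 _ _ hu))
    · funext k
      obtain ⟨c, w, rfl⟩ := B.exists_slot k
      rw [Bool.eq_iff_iff]
      refine Fin.addCases (fun u => ?_) (fun v => ?_) w
      · rw [assignmentOf_left]
        exact ⟨hcopy 0 c _, hcopy c 0 _⟩
      · rw [assignmentOf_right]
        exact not_not.trans ⟨hcopy 0 c _, hcopy c 0 _⟩
  · rintro ⟨S, hS, rfl⟩
    refine ⟨fun k hk => ?_, fun t ht => ?_⟩
    · obtain ⟨c, w, rfl⟩ := B.exists_slot k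
      rwa [nextSlot_slot, assignmentOf_slot _ _ c]
    · rw [edgeLeft, assignmentOf_left] at ht
      rw [edgeRight, assignmentOf_right]
      exact fun h => (B.isIndepSet_iff S).1 hS _ (List.get_mem _ t) ⟨ht, h⟩

/-- The order in which the implications are written. -/
def impOrder (B : BipartiteGraph) (l : ℕ) :
    List (Fin ((l + 1) * (B.m + B.n) + B.edges.length)) :=
  (List.finRange _).map (Fin.castAdd _) ++ ((List.finRange _).reverse.map (Fin.natAdd _))

theorem mem_impOrder (g : Fin ((l + 1) * (B.m + B.n) + B.edges.length)) : g ∈ B.impOrder l := by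
  refine Fin.addCases (fun k => ?_) (fun t => ?_) g <;> simp [impOrder]

theorem nodup_impOrder : (B.impOrder l).Nodup := by
  refine List.nodup_append.2 ⟨(List.nodup_finRange _).map (Fin.castAdd_injective _ _),
    (List.nodup_reverse.2 (List.nodup_finRange _)).map (Fin.natAdd_injective _ _), ?_⟩
  intro a ha b hb
  obtain ⟨k, -, rfl⟩ := List.mem_map.1 ha
  obtain ⟨t, -, rfl⟩ := List.mem_map.1 hb
  exact castAdd_ne_natAdd _ _

end BipartiteGraph

/-! ### Writing a system of implications -/

section GadgetGen

variable {Γ : Finset BoolRel} (h0 : Rzero ∈ Γ) (h1 : Rone ∈ Γ) (R : Γ) (s : Fin R.1.1 → Bool)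
  (P : Finset (Fin R.1.1)) (p q : Fin R.1.1)

/-- The constraints of a gadget for the implication from `x` to `y`, whose auxiliary variables start
at `b`. -/
noncomputable def gadgetCode (b x y : ℕ) : List Bool :=
  unary (Γ.equivFin R) ++
    (((List.finRange R.1.1).flatMap fun i =>
      unary (if i = p then x else if i = q then y else b + i)) ++
    (pinned R P p q).flatMap fun i => unary (Γ.equivFin (pinRel h0 h1 (s i))) ++ unary (b + i))

theorem flatMap_encode_gadgetCons {M G : ℕ} (X Y : Fin G → Fin M) (g : Fin G) :
    (gadgetCons h0 h1 R s P p q X Y g).flatMap Constraint.encode =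
      gadgetCode h0 h1 R s P p q (M + R.1.1 * g) (X g) (Y g) := by
  have hd : ∀ i : Fin R.1.1, (dummy M g i : ℕ) = M + R.1.1 * g + i := by
    intro i
    simp only [dummy, Fin.val_natAdd, finProdFinEquiv_apply_val]
    ring
  rw [gadgetCons, List.flatMap_cons, Constraint.encode, gadgetCode, List.append_assoc]
  congr 2
  · rw [List.ofFn_eq_map, List.flatMap_map]
    refine List.flatMap_congr fun i _ => ?_
    change unary (gadgetScope R p q X Y g i) = _
    unfold gadgetScope
    split_ifs
    exacts [rfl, rfl, congrArg unary (hd i)]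
  · rw [List.flatMap_map]
    refine List.flatMap_congr fun i _ => ?_
    rw [encode_pin, hd]

variable {W : Type} [DecidableEq W]

open Gen in
/-- Writes a gadget; the numbers are written by the given generators. -/
noncomputable def gadgetGen (b x y : Gen W) : Gen W :=
  ((ones (Γ.equivFin R)).seq (bit false)).seq
    ((concat ((List.finRange R.1.1).map fun i =>
      (if i = p then x else if i = q then y else b.seq (ones i)).seq (bit false))).seq
    (concat ((pinned R P p q).map fun i =>
      ((ones (Γ.equivFin (pinRel h0 h1 (s i)))).seq (bit false)).seq
        ((b.seq (ones i)).seq (bit false)))))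

theorem emits_gadgetGen {b x y : Gen W} {ρ : W → ℕ} {b' x' y' : ℕ}
    (hb : b.Emits ρ (List.replicate b' true)) (hx : x.Emits ρ (List.replicate x' true))
    (hy : y.Emits ρ (List.replicate y' true)) :
    (gadgetGen h0 h1 R s P p q b x y).Emits ρ (gadgetCode h0 h1 R s P p q b' x' y') := by
  refine (Gen.emits_ones _ ρ).unary.seq (Gen.Emits.seq ?_ ?_)
  · refine Gen.emits_concat _ _ _ _ fun i _ => ?_
    split_ifs
    exacts [hx.unary, hy.unary, (hb.seq_ones (Gen.emits_ones _ ρ)).unary]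
  · exact Gen.emits_concat _ _ _ _ fun i _ =>
      (Gen.emits_ones _ ρ).unary.seq (hb.seq_ones (Gen.emits_ones _ ρ)).unary

end GadgetGen

/-- The counters for writing the implications of a bipartite graph: the number of copies `l` (and
`c`), the number `n` (and `w`) of vertices, the number `m` of left vertices, the number `t` of edges
so far, the current edge `u, v`, and auxiliary ones. -/
inductive ImpReg
  | c | l | w | n | m | t | u | v | i₁ | i₂ | i₃ | i₄
deriving DecidableEq

instance : Finite ImpReg := by
  refine Finite.of_injective (β := Fin 12) (fun
    | .c => 0 | .l => 1 | .w => 2 | .n => 3 | .m => 4 | .t => 5 | .u => 6 | .v => 7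
    | .i₁ => 8 | .i₂ => 9 | .i₃ => 10 | .i₄ => 11) ?_
  intro r r' h
  cases r <;> cases r' <;> simp_all

def impEnv (l n m t u v : ℕ) : ImpReg → ℕ
  | .c => l
  | .l => l
  | .w => n
  | .n => n
  | .m => m
  | .t => t
  | .u => u
  | .v => v
  | .i₁ | .i₂ | .i₃ | .i₄ => 0

namespace Gen

/-- Writes `k` ones for each unit of the counter `a`. -/
def rep (a : ImpReg) (k : ℕ) : Gen ImpReg := loop a .i₃ (ones k)

/-- Writes `k` ones for each of the `n` vertices in each of the copies before `a`. -/
def layers (a : ImpReg) (k : ℕ) : Gen ImpReg := loop a .i₃ (loop .n .i₄ (ones k))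

theorem emits_rep_ones {a : ImpReg} {k b : ℕ} {ρ : ImpReg → ℕ} (ha : a ≠ .i₃) (h3 : ρ .i₃ = 0)
    (hb : ρ a * k = b) : (rep a k).Emits ρ (List.replicate b true) := by
  rw [← hb]
  exact Emits.loop_ones ha h3 fun j _ => emits_ones k _

theorem emits_layers {a : ImpReg} {k b : ℕ} {ρ : ImpReg → ℕ} (ha : a ≠ .i₃) (ha4 : a ≠ .i₄)
    (han : a ≠ .n) (h3 : ρ .i₃ = 0) (h4 : ρ .i₄ = 0) (hb : ρ a * (ρ .n * k) = b) :
    (layers a k).Emits ρ (List.replicate b true) := by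
  rw [← hb]
  refine Emits.loop_ones ha h3 fun j _ => ?_
  have := Emits.loop_ones (g := ones k) (r := .n) (i := .i₄) (ρ := loopEnv ρ a .i₃ j) (m := k)
    (by simp) (by simp [loopEnv, ha4.symm, h4]) fun j _ => emits_ones k _
  rwa [show loopEnv ρ a .i₃ j .n = ρ .n by simp [loopEnv, han.symm]] at this

/-- Writes the number of main variables. -/
def mainGen (k : ℕ) : Gen ImpReg := (layers .l k).seq (rep .n k)

theorem emits_mainGen {k b : ℕ} {ρ : ImpReg → ℕ} (h3 : ρ .i₃ = 0) (h4 : ρ .i₄ = 0)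
    (hb : (ρ .l + 1) * ρ .n * k = b) : (mainGen k).Emits ρ (List.replicate b true) := by
  rw [← hb, show (ρ .l + 1) * ρ .n * k = ρ .l * (ρ .n * k) + ρ .n * k by ring]
  exact (emits_layers (by simp) (by simp) (by simp) h3 h4 rfl).seq_ones
    (emits_rep_ones (by simp) h3 rfl)

/-- Writes the number of the slot given by `c` and `w`. -/
def slotGen (k : ℕ) : Gen ImpReg := (layers .c k).seq (rep .w k)

theorem emits_slotGen {k b : ℕ} {ρ : ImpReg → ℕ} (h3 : ρ .i₃ = 0) (h4 : ρ .i₄ = 0)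
    (hb : (ρ .c * ρ .n + ρ .w) * k = b) : (slotGen k).Emits ρ (List.replicate b true) := by
  rw [← hb, show (ρ .c * ρ .n + ρ .w) * k = ρ .c * (ρ .n * k) + ρ .w * k by ring]
  exact (emits_layers (by simp) (by simp) (by simp) h3 h4 rfl).seq_ones
    (emits_rep_ones (by simp) h3 rfl)

end Gen

section ImpGen

variable {Γ : Finset BoolRel} (h0 : Rzero ∈ Γ) (h1 : Rone ∈ Γ) (R : Γ) (s : Fin R.1.1 → Bool)
  (P : Finset (Fin R.1.1)) (p q : Fin R.1.1)

open Gen in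
/-- Writes the number of the first auxiliary variable of the gadget for the edge `t`, which is also
the total number of variables if there are `t` edges. -/
def edgeBase (r : ℕ) : Gen ImpReg := (mainGen 1).seq ((mainGen r).seq (rep .t r))

theorem emits_edgeBase {r b : ℕ} {ρ : ImpReg → ℕ} (h3 : ρ .i₃ = 0) (h4 : ρ .i₄ = 0)
    (hb : (ρ .l + 1) * ρ .n + r * ((ρ .l + 1) * ρ .n + ρ .t) = b) :
    (edgeBase r).Emits ρ (List.replicate b true) := by
  rw [← hb, show (ρ .l + 1) * ρ .n + r * ((ρ .l + 1) * ρ .n + ρ .t) =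
    (ρ .l + 1) * ρ .n * 1 + ((ρ .l + 1) * ρ .n * r + ρ .t * r) by ring]
  exact (Gen.emits_mainGen h3 h4 rfl).seq_ones ((Gen.emits_mainGen h3 h4 rfl).seq_ones
    (Gen.emits_rep_ones (by simp) h3 rfl))

open Gen in
/-- Writes the gadget for the current edge. -/
noncomputable def edgeGen : Gen ImpReg :=
  gadgetGen h0 h1 R s P p q (edgeBase R.1.1) ((layers .t 1).seq (rep .u 1))
    ((layers .t 1).seq ((rep .m 1).seq (rep .v 1)))

/-- The gadget for the edge `t = (u, v)`. -/
noncomputable def edgeGadgetCode (l n m t u v : ℕ) : List Bool :=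
  gadgetCode h0 h1 R s P p q ((l + 1) * n + R.1.1 * ((l + 1) * n + t)) (t * n + u) (t * n + (m + v))

theorem emits_edgeGen (l n m t u v : ℕ) :
    (edgeGen h0 h1 R s P p q).Emits (impEnv l n m t u v)
      (edgeGadgetCode h0 h1 R s P p q l n m t u v) := by
  have ht : (Gen.layers .t 1).Emits (impEnv l n m t u v) (List.replicate (t * n) true) :=
    Gen.emits_layers (by simp) (by simp) (by simp) rfl rfl (by simp [impEnv])
  refine emits_gadgetGen h0 h1 R s P p q (emits_edgeBase rfl rfl rfl) (ht.seq_ones ?_)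
    (ht.seq_ones (Gen.Emits.seq_ones ?_ ?_))
  all_goals exact Gen.emits_rep_ones (by simp) rfl (by simp [impEnv])

open Gen in
/-- Writes the number of the first auxiliary variable of the gadget for the slot given by `c` and
`w`. -/
def slotBase (r : ℕ) : Gen ImpReg := (mainGen 1).seq (slotGen r)

theorem emits_slotBase {r : ℕ} {ρ : ImpReg → ℕ} (h3 : ρ .i₃ = 0) (h4 : ρ .i₄ = 0) :
    (slotBase r).Emits ρ
      (List.replicate ((ρ .l + 1) * ρ .n + r * (ρ .c * ρ .n + ρ .w)) true) := by
  rw [show (ρ .l + 1) * ρ .n + r * (ρ .c * ρ .n + ρ .w) =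
    (ρ .l + 1) * ρ .n * 1 + (ρ .c * ρ .n + ρ .w) * r by ring]
  exact (Gen.emits_mainGen h3 h4 rfl).seq_ones (Gen.emits_slotGen h3 h4 rfl)

open Gen in
/-- Writes the number of variables, and the gadgets for the implications between the copies. -/
noncomputable def impHeadGen : Gen ImpReg :=
  ((edgeBase R.1.1).seq (bit false)).seq
    ((loop .c .i₁ (loop .w .i₂ (gadgetGen h0 h1 R s P p q (slotBase R.1.1) (slotGen 1)
      ((slotGen 1).seq (rep .n 1))))).seq
    (loop .w .i₂ (gadgetGen h0 h1 R s P p q (slotBase R.1.1) (slotGen 1) (rep .w 1))))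

/-- The gadget for the implication from the slot `k` to the next slot. -/
noncomputable def slotGadgetCode (l n k : ℕ) : List Bool :=
  gadgetCode h0 h1 R s P p q ((l + 1) * n + R.1.1 * k) k ((k + n) % ((l + 1) * n))

theorem flatMap_range_mul {α : Type*} (a n : ℕ) (f : ℕ → List α) :
    (List.range (a * n)).flatMap f =
      (List.range a).flatMap fun c => (List.range n).flatMap fun w => f (c * n + w) := by
  induction a with
  | zero => simp
  | succ a ih =>
    rw [add_mul, one_mul, List.range_add, List.flatMap_append, ih, List.range_succ,
      List.flatMap_append, List.flatMap_map, List.flatMap_singleton]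

/-- The successor modulo (l + 1)n adds n in all copies but the last, where it returns to copy 0:
hence two loops. In the second one `c` still holds `l`, the number of the last copy. -/
theorem emits_impHeadGen (l n m t : ℕ) :
    (impHeadGen h0 h1 R s P p q).Emits (impEnv l n m t 0 0)
      (unary ((l + 1) * n + R.1.1 * ((l + 1) * n + t)) ++
        (List.range ((l + 1) * n)).flatMap (slotGadgetCode h0 h1 R s P p q l n)) := by
  rw [flatMap_range_mul, List.range_succ, List.flatMap_append, List.flatMap_singleton]
  refine (emits_edgeBase rfl rfl rfl).unary.seq (Gen.Emits.seq ?_ ?_)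
  · refine Gen.Emits.loop (r := .c) (i := .i₁) (ρ := impEnv l n m t 0 0) (by simp) rfl
      fun c hc => ?_
    refine Gen.Emits.loop (r := .w) (i := .i₂) (ρ := Gen.loopEnv (impEnv l n m t 0 0) .c .i₁ c)
      (by simp) rfl fun w hw => ?_
    replace hc : c < l := hc
    replace hw : w < n := hw
    have hlt : c * n + w + n < (l + 1) * n := by
      have : (c + 1) * n ≤ l * n := Nat.mul_le_mul_right n hc
      nlinarith
    rw [slotGadgetCode, Nat.mod_eq_of_lt hlt]
    exact emits_gadgetGen h0 h1 R s P p q (emits_slotBase rfl rfl)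
      (Gen.emits_slotGen rfl rfl (mul_one _))
      ((Gen.emits_slotGen rfl rfl (mul_one _)).seq_ones
        (Gen.emits_rep_ones (by simp) rfl (mul_one _)))
  · refine Gen.Emits.loop (r := .w) (i := .i₂) (ρ := impEnv l n m t 0 0) (by simp) rfl
      fun w hw => ?_
    replace hw : w < n := hw
    have hmod : (l * n + w + n) % ((l + 1) * n) = w := by
      rw [show l * n + w + n = w + (l + 1) * n by ring, Nat.add_mod_right]
      exact Nat.mod_eq_of_lt (by nlinarith [Nat.zero_le (l * n)])
    rw [slotGadgetCode, hmod]
    exact emits_gadgetGen h0 h1 R s P p q (emits_slotBase rfl rfl)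
      (Gen.emits_slotGen rfl rfl (mul_one _)) (Gen.emits_rep_ones (by simp) rfl (mul_one _))

end ImpGen

/-! ### The reduction from `#BIS` -/

section FromBIS

variable {Γ : Finset BoolRel} (h0 : Rzero ∈ Γ) (h1 : Rone ∈ Γ) (R : Γ) (s : Fin R.1.1 → Bool)
  (P : Finset (Fin R.1.1)) (p q : Fin R.1.1)

/-- Read and handle an edge. -/
noncomputable def edgeFrag : Frag ImpReg :=
  (Frag.readUnary [.u]).seq ((Frag.readUnary [.v]).seq ((edgeGen h0 h1 R s P p q).write.seq
    ((Frag.push (.work .t) true).seq ((Frag.clear .u).seq (Frag.clear .v)))))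

noncomputable def edgeCost (B : ℕ) : ℕ :=
  (B * 2 + 1) + ((B * 2 + 1) + ((edgeGen h0 h1 R s P p q).cost B + (1 + ((B + 1) + (B + 1)))))

theorem runs_edgeFrag {l n m t u v B : ℕ} (hl : l ≤ B) (hn : n ≤ B) (hm : m ≤ B) (ht : t ≤ B)
    (hu : u ≤ B) (hv : v ≤ B) (rest : List Bool) (C : Core)
    (hC : C.inp = unary u ++ (unary v ++ rest)) :
    (edgeFrag h0 h1 R s P p q).Runs (C.stk (impEnv l n m t 0 0))
      ({ C with inp := rest, out := edgeGadgetCode h0 h1 R s P p q l n m t u v ++ C.out }.stk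
        (impEnv l n m (t + 1) 0 0)) (edgeCost h0 h1 R s P p q B) := by
  have r1 := Frag.runs_readUnary [.u] u (unary v ++ rest) C (impEnv l n m t 0 0) hC
  have r2 := Frag.runs_readUnary [.v] v rest { C with inp := unary v ++ rest }
    (impEnv l n m t u 0) rfl
  have e1 : (fun r => impEnv l n m t 0 0 r + u * [ImpReg.u].count r) = impEnv l n m t u 0 := by
    funext r; cases r <;> simp [impEnv]
  have e2 : (fun r => impEnv l n m t u 0 r + v * [ImpReg.v].count r) = impEnv l n m t u v := by
    funext r; cases r <;> simp [impEnv]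
  rw [e1] at r1
  rw [e2] at r2
  have hem := emits_edgeGen h0 h1 R s P p q l n m t u v
  have r3 := (edgeGen h0 h1 R s P p q).runs_write (B := B) { C with inp := rest } hem.1 (by
    intro r; cases r <;> simp [impEnv, *])
  rw [hem.2] at r3
  have r4 := Frag.runs_inc ImpReg.t
    { C with inp := rest, out := edgeGadgetCode h0 h1 R s P p q l n m t u v ++ C.out }
    (impEnv l n m t u v)
  have e4 : Function.update (impEnv l n m t u v) .t (impEnv l n m t u v .t + 1) =
      impEnv l n m (t + 1) u v := by
    funext r; cases r <;> simp [impEnv]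
  rw [e4] at r4
  have r5 := Frag.runs_clear ImpReg.u
    { C with inp := rest, out := edgeGadgetCode h0 h1 R s P p q l n m t u v ++ C.out }
    (impEnv l n m (t + 1) u v)
  have e5 : Function.update (impEnv l n m (t + 1) u v) .u 0 = impEnv l n m (t + 1) 0 v := by
    funext r; cases r <;> simp [impEnv]
  rw [e5] at r5
  have r6 := Frag.runs_clear ImpReg.v
    { C with inp := rest, out := edgeGadgetCode h0 h1 R s P p q l n m t u v ++ C.out }
    (impEnv l n m (t + 1) 0 v)
  have e6 : Function.update (impEnv l n m (t + 1) 0 v) .v 0 = impEnv l n m (t + 1) 0 0 := by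
    funext r; cases r <;> simp [impEnv]
  rw [e6] at r6
  refine (r1.seq (r2.seq (r3.seq (r4.seq (r5.seq r6))))).mono ?_
  simp only [edgeCost, impEnv, List.length_singleton]
  omega

/-- The fragment that writes the system of implications for a bipartite graph. -/
noncomputable def fromBISFrag : Frag ImpReg :=
  (Frag.measure [.c, .l]).seq ((Frag.readUnary [.w, .n, .m]).seq ((Frag.readUnary [.w, .n]).seq
    ((Frag.records (edgeFrag h0 h1 R s P p q)).seq (impHeadGen h0 h1 R s P p q).write)))

noncomputable def fromBISCost (l : ℕ) : ℕ :=
  (l * 6 + 2) + ((l * 4 + 1) + ((l * 3 + 1) + ((l * (edgeCost h0 h1 R s P p q l + 2) + 1) +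
    (impHeadGen h0 h1 R s P p q).cost l)))

theorem polyBdd_fromBISCost : PolyBdd (fromBISCost h0 h1 R s P p q) := by
  have hid : ∀ a b : ℕ, PolyBdd fun l => l * a + b := fun a b =>
    (PolyBdd.id.mul (.const a)).add (.const b)
  have h : PolyBdd (edgeCost h0 h1 R s P p q) :=
    (hid 2 1).add ((hid 2 1).add ((Gen.polyBdd_cost _).add
      ((PolyBdd.const 1).add ((PolyBdd.id.add (.const 1)).add (PolyBdd.id.add (.const 1))))))
  exact (hid 6 2).add ((hid 4 1).add ((hid 3 1).add
    (((PolyBdd.id.mul (h.add (.const 2))).add (.const 1)).add (Gen.polyBdd_cost _))))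

/-- The gadgets for the edges in a list, in reverse order. -/
noncomputable def edgesCode (l n m : ℕ) {a b : ℕ} (L : List (Fin a × Fin b)) : List Bool :=
  L.zipIdx.reverse.flatMap fun e => edgeGadgetCode h0 h1 R s P p q l n m e.2 e.1.1 e.1.2

theorem edgesCode_append (l n m : ℕ) {a b : ℕ} (L : List (Fin a × Fin b)) (e : Fin a × Fin b) :
    edgesCode h0 h1 R s P p q l n m (L ++ [e]) =
      edgeGadgetCode h0 h1 R s P p q l n m L.length e.1 e.2 ++
        edgesCode h0 h1 R s P p q l n m L := by
  simp [edgesCode, List.zipIdx_append]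

theorem BipartiteGraph.size_le_length_encode (B : BipartiteGraph) :
    B.m + B.n + B.edges.length ≤ B.encode.length := by
  have h := length_le_length_flatMap (fun e : Fin B.m × Fin B.n => unary e.1 ++ unary e.2)
    (fun e => by simp [unary]) B.edges
  rw [BipartiteGraph.encode, List.length_append, List.length_append]
  simp only [unary, List.length_append, List.length_replicate, List.length_singleton] at h ⊢
  omega

theorem runs_fromBISFrag (B : BipartiteGraph) (num den : List Bool) :
    (fromBISFrag h0 h1 R s P p q).Runs
      (Core.stk ⟨B.encode, num, den, [], [], [], []⟩ fun _ => 0)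
      (Core.stk ⟨[], num, den, unary ((B.encode.length + 1) * (B.m + B.n) + R.1.1 *
        ((B.encode.length + 1) * (B.m + B.n) + B.edges.length)) ++
        (List.range ((B.encode.length + 1) * (B.m + B.n))).flatMap
          (slotGadgetCode h0 h1 R s P p q B.encode.length (B.m + B.n)) ++
        edgesCode h0 h1 R s P p q B.encode.length (B.m + B.n) B.m B.edges, [], [], []⟩
        (impEnv B.encode.length (B.m + B.n) B.m B.edges.length 0 0))
      (fromBISCost h0 h1 R s P p q B.encode.length) := by
  let code : Fin B.m × Fin B.n → List Bool := fun e => unary e.1 ++ unary e.2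
  have hne : ∀ e, code e ≠ [] := fun e => by simp [code, unary]
  have hlen := B.size_le_length_encode
  generalize hl : B.encode.length = l at *
  have r1 := Frag.runs_measure (R := ImpReg) [.c, .l] ⟨B.encode, num, den, [], [], [], []⟩
    (fun _ => 0) rfl
  have r2 := Frag.runs_readUnary (R := ImpReg) [.w, .n, .m] B.m
    (unary B.n ++ B.edges.flatMap code) ⟨B.encode, num, den, [], [], [], []⟩
    (impEnv l 0 0 0 0 0) rfl
  have r3 := Frag.runs_readUnary (R := ImpReg) [.w, .n] B.n (B.edges.flatMap code)
    ⟨unary B.n ++ B.edges.flatMap code, num, den, [], [], [], []⟩ (impEnv l B.m B.m 0 0 0) rfl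
  have e1 : (fun r : ImpReg => (fun _ => 0) r + B.encode.length * [.c, .l].count r) =
      impEnv l 0 0 0 0 0 := by
    funext r; cases r <;> simp [impEnv, hl]
  have e2 : (fun r : ImpReg => impEnv l 0 0 0 0 0 r + B.m * [.w, .n, .m].count r) =
      impEnv l B.m B.m 0 0 0 := by
    funext r; cases r <;> simp [impEnv]
  have e3 : (fun r : ImpReg => impEnv l B.m B.m 0 0 0 r + B.n * [.w, .n].count r) =
      impEnv l (B.m + B.n) B.m 0 0 0 := by
    funext r; cases r <;> simp [impEnv]
  rw [e1] at r1
  rw [e2] at r2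
  rw [e3] at r3
  -- The counter `t` is the index of the next edge, hence also its copy number. At the end it is the
  -- number of edges, so `edgeBase` then writes the number of variables.
  have r4 := Frag.runs_records (edgeFrag h0 h1 R s P p q) code hne
    (fun d L => Core.stk ⟨L.flatMap code, num, den,
      edgesCode h0 h1 R s P p q l (B.m + B.n) B.m d.reverse, [], [], []⟩
      (impEnv l (B.m + B.n) B.m d.length 0 0))
    (fun d L => rfl) (edgeCost h0 h1 R s P p q l) B.edges (by
      intro d a L hd
      have hdl : d.length ≤ B.edges.length := by rw [← hd]; simp
      have := runs_edgeFrag h0 h1 R s P p q (l := l) (n := B.m + B.n) (m := B.m) (t := d.length)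
        (u := a.1) (v := a.2) (B := l) le_rfl (by omega) (by omega) (by omega) (by omega) (by omega)
        (L.flatMap code) ⟨(a :: L).flatMap code, num, den,
          edgesCode h0 h1 R s P p q l (B.m + B.n) B.m d.reverse, [], [], []⟩ (by simp [code])
      simpa only [List.reverse_cons, edgesCode_append, List.length_reverse,
        List.length_cons] using this)
  have hem := emits_impHeadGen h0 h1 R s P p q l (B.m + B.n) B.m B.edges.length
  have r5 := (impHeadGen h0 h1 R s P p q).runs_write (B := l)
    ⟨[], num, den, edgesCode h0 h1 R s P p q l (B.m + B.n) B.m B.edges, [], [], []⟩ hem.1 (by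
      intro r
      cases r <;> simp only [impEnv] <;> omega)
  rw [hem.2] at r5
  simp only [List.reverse_reverse, List.length_reverse] at r4
  refine (r1.seq (r2.seq (r3.seq (r4.seq r5)))).mono ?_
  have hE := Nat.mul_le_mul_right (edgeCost h0 h1 R s P p q l + 2)
    (show B.edges.length ≤ l by omega)
  simp only [fromBISCost, List.length_cons, List.length_nil, hl]
  omega

theorem nextSlot_val (B : BipartiteGraph) (l : ℕ) (k : Fin ((l + 1) * (B.m + B.n))) :
    (B.nextSlot l k : ℕ) = (k + (B.m + B.n)) % ((l + 1) * (B.m + B.n)) := by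
  obtain ⟨c, w, rfl⟩ := B.exists_slot k
  rw [B.nextSlot_slot]
  simp only [BipartiteGraph.slot, finProdFinEquiv_apply_val]
  have hw := w.2
  generalize B.m + B.n = n at *
  rcases lt_or_ge (c : ℕ) l with hc | hc
  · have hlt : (w : ℕ) + n * c + n < (l + 1) * n := by
      have : (c + 1) * n ≤ l * n := Nat.mul_le_mul_right n hc
      nlinarith
    rw [Nat.mod_eq_of_lt hlt, Fin.val_add_one_of_lt (Fin.lt_def.2 (by simpa using hc))]
    ring
  · have hc' : c = Fin.last l := Fin.ext (le_antisymm (Nat.le_of_lt_succ c.2) hc)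
    rw [hc', Fin.last_add_one, Fin.val_last, Fin.val_zero,
      show (w : ℕ) + n * l + n = w + (l + 1) * n by ring, Nat.add_mod_right,
      Nat.mod_eq_of_lt (by nlinarith [Nat.zero_le (l * n)])]
    simp

/-- `impOrder` is the order that the machine produces: the cycle gadgets come in order, being
written by a generator, and the edge gadgets are reversed, being pushed as the edges are read. -/
theorem flatMap_impOrder (B : BipartiteGraph) {l : ℕ} (hl : B.edges.length ≤ l) :
    ((B.impOrder l).flatMap (gadgetCons h0 h1 R s P p q (BipartiteGraph.impLeft hl)
        (BipartiteGraph.impRight hl))).flatMap Constraint.encode =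
      (List.range ((l + 1) * (B.m + B.n))).flatMap
          (slotGadgetCode h0 h1 R s P p q l (B.m + B.n)) ++
        edgesCode h0 h1 R s P p q l (B.m + B.n) B.m B.edges := by
  rw [List.flatMap_assoc, BipartiteGraph.impOrder, List.flatMap_append, List.flatMap_map,
    List.flatMap_map]
  congr 1
  · rw [← List.map_coe_finRange_eq_range, List.flatMap_map]
    refine List.flatMap_congr fun k _ => ?_
    rw [flatMap_encode_gadgetCons, slotGadgetCode, BipartiteGraph.impLeft, BipartiteGraph.impRight,
      Fin.addCases_left, Fin.addCases_left, nextSlot_val]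
    rfl
  · have hz : B.edges.zipIdx = (List.finRange B.edges.length).map fun t => (B.edges.get t, (t : ℕ)) := by
      refine List.ext_getElem (by simp) fun i hi hi' => by simp
    rw [edgesCode, hz, ← List.map_reverse, List.flatMap_map]
    refine List.flatMap_congr fun t _ => ?_
    rw [flatMap_encode_gadgetCons, edgeGadgetCode, BipartiteGraph.impLeft, BipartiteGraph.impRight,
      Fin.addCases_right, Fin.addCases_right]
    have hval : ∀ w, (B.slot l (BipartiteGraph.edgeCopy hl t) w : ℕ) = t * (B.m + B.n) + w := by
      intro w
      simp only [BipartiteGraph.slot, finProdFinEquiv_apply_val, BipartiteGraph.edgeCopy,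
        Fin.val_castLE]
      ring
    rw [BipartiteGraph.edgeLeft, BipartiteGraph.edgeRight, hval, hval]
    rfl

end FromBIS

/-- `#BIS` reduces to `#CSP` of degree three with a relation that is not affine and with pins. -/
theorem numBIS_apReducible_numCSPd (Γ : Finset BoolRel) (h0 : Rzero ∈ Γ) (h1 : Rone ∈ Γ)
    (R : BoolRel) (hRΓ : R ∈ Γ) (hR : R ∈ IMConj) (hRa : ¬ IsAffine R) {d : ℕ} (hd : 3 ≤ d) :
    APReducible numBIS (numCSPd d Γ) := by
  obtain ⟨φ, hφ⟩ := hR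
  obtain ⟨s, P, p, q, ext, hg⟩ := exists_isImpGadget hφ hRa
  -- The count is preserved exactly, so the error parameter is not scaled and no digit of the answer
  -- is dropped.
  refine apReducible_of_frag (R := ImpReg) (fromBISFrag h0 h1 ⟨R, hRΓ⟩ s P p q) Gen.nil 0
    (T := fun l => fromBISCost h0 h1 ⟨R, hRΓ⟩ s P p q l + l)
    ((polyBdd_fromBISCost h0 h1 ⟨R, hRΓ⟩ s P p q).add .id) fun (B : BipartiteGraph) => ?_
  have hsize := B.size_le_length_encode
  -- The copies are numbered from 0 to the length of the encoding. This value can be measured before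
  -- any edge is read, and it leaves a separate copy for each edge.
  have hl : B.edges.length ≤ B.encode.length := by omega
  refine ⟨⟨impInstance h0 h1 ⟨R, hRΓ⟩ s P _ _ hg.ne (BipartiteGraph.imp_inj hl)
    BipartiteGraph.nodup_impOrder, (degree_impInstance_le _ _ _ _ _ _ _ _ _ _ (by omega)
      fun v => (BipartiteGraph.sum_imp_le hl v).trans hd)⟩,
    impEnv B.encode.length (B.m + B.n) B.m B.edges.length 0 0, fun num den => ?_, trivial, ?_, ?_⟩
  · have h := runs_fromBISFrag h0 h1 ⟨R, hRΓ⟩ s P p q B num den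
    rw [List.append_assoc, ← flatMap_impOrder h0 h1 ⟨R, hRΓ⟩ s P p q B hl,
      mul_comm R.1 (_ + _)] at h
    exact h.mono (Nat.le_add_right _ _)
  · intro r
    have : numBIS.encode B = B.encode := rfl
    cases r <;> simp only [impEnv, this] <;> omega
  · intro ε h0' h1' Y hY1 hY2
    have hZ := Z_impInstance h0 h1 ⟨R, hRΓ⟩ _ _ hg.ne (BipartiteGraph.imp_inj hl)
      BipartiteGraph.nodup_impOrder hg BipartiteGraph.mem_impOrder
    rw [BipartiteGraph.ncard_imp hl] at hZ
    change Real.exp (-(ε / 2 ^ 0)) * (CSPInstance.Z _ : ℕ) ≤ Y at hY1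
    change Y ≤ Real.exp (ε / 2 ^ 0) * (CSPInstance.Z _ : ℕ) at hY2
    rw [hZ, pow_zero, div_one] at hY1 hY2
    simp only [Gen.str, List.length_nil, pow_zero, Nat.div_one]
    exact ⟨hY1, hY2⟩

theorem pinLanguage_subset_IMConj : (pinLanguage : Set BoolRel) ⊆ IMConj := by
  intro R hR
  have key : ∀ b : Bool, (⟨1, {fun _ => b}⟩ : BoolRel) ∈ IMConj := fun b =>
    ⟨[.pin 0 b], fun a => by
      simp only [Finset.mem_singleton, List.mem_singleton, forall_eq, IMClause.Holds]
      exact ⟨fun h => by rw [h], fun h => funext fun i => by rw [Subsingleton.elim i 0, h]⟩⟩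
  rcases Finset.mem_insert.1 (Finset.mem_coe.1 hR) with rfl | hR
  · exact key false
  · rw [Finset.mem_singleton.1 hR]
    exact key true

theorem mainTheorem5 (Γ : Finset BoolRel) (hΓ : (Γ : Set BoolRel) ⊆ IMConj)
    (hna : ∃ R ∈ Γ, ¬ IsAffine R) (d : ℕ) (hd : 3 ≤ d) :
    numCSPd d (Γ ∪ pinLanguage) ≡AP numBIS := by
  obtain ⟨R, hRΓ, hRa⟩ := hna
  refine ⟨numCSPd_apReducible_numBIS _ ?_ d,
    numBIS_apReducible_numCSPd _ ?_ ?_ R (Finset.mem_union_left _ hRΓ) (hΓ hRΓ) hRa hd⟩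
  · rw [Finset.coe_union]
    exact Set.union_subset hΓ pinLanguage_subset_IMConj
  · exact Finset.mem_union_right _ (by simp [pinLanguage])
  · exact Finset.mem_union_right _ (by simp [pinLanguage])
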